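/- **Setting.** The finite types $\mathcal T$ are generated from $\mathbb B,\mathbb N$ by $\sigma\to\tau$; the types $\mathcal T^*$ are generated in addition by finite sequence types $\tau^*$. Theories are first-order intuitionistic theories with untyped variables, typing predicates $\tau(x)$, equality predicates $=_\tau$, typed constants, and function symbols $\mathrm{Ap}_{\sigma,\tau}$; connectives are $\bot,\wedge,\to,\forall,\exists$. Put $\forall z^\tau A:\equiv\forall z(\tau(z)\to A)$, $\exists z^\tau A:\equiv\exists z(\tau(z)\wedge A)$, $A\vee B:\equiv\exists z^{\mathbb B}((z=\mathrm T\to A)\wedge(z=\mathrm F\to B))$. The source theory $\mathcal I_s$ is $\mathbf{WE\text{-}HA}^\omega$ with explicit typing: types $\mathcal T$; typing axioms for the constants $0,\mathrm{Suc},\mathrm T,\mathrm F$, definition by cases, $K,S$, recursors, and for application; equality at type level $0$ only, higher equations being read pointwise; the defining equations (relativised to typed arguments), successor axioms, case distinction on booleans and induction for all formulas; and the quantifier-free rule of extensionality QF-ER (from $A_0\vdash s=_\rho t$ infer $A_0\vdash r[s]=_\tau r[t]$, with $s,t,r$ well typed, equations read pointwise, and $A_0$ consisting of type declarations of variables and quantifier-free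 formulas over level-$0$ equations). The target theory $\mathcal I_t$ is the corresponding theory over $\mathcal T^*$ (with empty sequence, prefixing, sequence recursion, sequence induction) in which equality is a predicate symbol at all types, with reflexivity on typed objects and replacement in all formulas, and the defining equations hold with this equality; i.e. $\mathbf{N\text{-}HA}^\omega$ with sequence types, together with QF-ER. For $x:\tau$ and $a:\tau^*$ let $x\in_\tau a$ mean that $x$ is an entry of the sequence $a$ (finite sets are represented by possibly empty finite sequences), and let $\forall\vec x\in_{\vec\tau}\vec a\,A$ be $\forall x_1^{\tau_1}\in a_1\cdots\forall x_n^{\tau_n}\in a_n\,A$. **The interpretation.** Let $A^*$ be Girard's translation into affine logic: $P^*=P$ for atomic $P$ (and $\bot$), $(A\wedge B)^*=A^*\otimes B^*$, $(A\to B)^*={!}A^*\multimap B^*$, $(\forall zA)^*=\forall zA^*$, $(\exists zA)^*=\exists z\,{!}A^*$. Let $(\cdot)^{\mathcal F}$ be the forgetful translation back ($\otimes\mapsto\wedge$, $\multimap\mapsto\to$, ${!}$ erased). To affine formulas assign $|\tau(t)|^a=\tau(t)\wedge t\in_\tau a$ with $a$ of type $\tau^*$; $|s=t|=(s=t)$ and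 $|\bot|=\bot$ with empty tuples; $|A\multimap B|^{\vec f,\vec g}_{\vec x,\vec w}=|A|^{\vec x}_{\vec g\vec x\vec w}\multimap|B|^{\vec f\vec x}_{\vec w}$; $|A\otimes B|^{\vec x,\vec v}_{\vec y,\vec w}=|A|^{\vec x}_{\vec y}\otimes|B|^{\vec v}_{\vec w}$; $|QzA|^{\vec x}_{\vec y}=Qz|A|^{\vec x}_{\vec y}$ for $Q\in\{\forall,\exists\}$; $|{!}A|^{\vec x}_{\vec a}={!}\,\forall\vec y\in\vec a\,|A|^{\vec x}_{\vec y}$ with $\vec a$ of types $(\vec\tau^-_A)^*$, where intuitionistic formulas on the right are understood through $(\cdot)^*$, and $\vec\tau^+_A,\vec\tau^-_A$ are the resulting types of the upper and lower tuples. For intuitionistic $A$ put $\langle A\rangle^{\vec x}_{\vec y}:=(|A^*|^{\vec x}_{\vec y})^{\mathcal F}$, $\vec\tau^\pm_A:=\vec\tau^\pm_{A^*}$. (This is the parametrised $\ell$-interpretation with $x\prec_\tau a:\equiv\tau(x)\wedge x\in_\tau a$, witnessing types $\tau^*$, no restriction $W$ on witnesses beyond typing, and contraction bounds $\forall\vec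 x\in\vec a$ of types $\vec\tau^*$.) **Proposition (Herbrand Diller–Nahm interpretation).** (1) The following are provable in $\mathcal I_t$ (even without QF-ER), for all formulas $A,B$, all types $\tau$, and all tuples of the appropriate lengths: - $\langle A\to B\rangle^{\vec f,\vec g}_{\vec x,\vec w}\leftrightarrow\bigl(\forall\vec y\in\vec g\vec x\vec w\,\langle A\rangle^{\vec x}_{\vec y}\to\langle B\rangle^{\vec f\vec x}_{\vec w}\bigr)$; - $\langle A\wedge B\rangle^{\vec x,\vec v}_{\vec y,\vec w}\leftrightarrow\langle A\rangle^{\vec x}_{\vec y}\wedge\langle B\rangle^{\vec v}_{\vec w}$; - for $\vec y,\vec w$ of types $(\vec\tau^-_A)^*,(\vec\tau^-_B)^*$: $\langle A\vee B\rangle^{b,\vec x,\vec v}_{\vec y,\vec w}\to\forall\vec y'\in\vec y\,\langle A\rangle^{\vec x}_{\vec y'}\vee\forall\vec w'\in\vec w\,\langle B\rangle^{\vec v}_{\vec w'}$, and this is an equivalence if $\mathrm T,\mathrm F\in_{\mathbb B}b$; - $\exists z\in_\tau c\,\forall\vec y'\in\vec y\,\langle A\rangle^{\vec x}_{\vec y'}\to\langle\exists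 z^\tau A\rangle^{c,\vec x}_{\vec y}$, and this is an equivalence if all the sets $\vec y$ are inhabited, and also if $c$ is inhabited and $\vec y$ is of type $(\vec\tau^-_A)^*$; - $\langle\forall z^\tau A\rangle^{\vec f}_{b,\vec y}\leftrightarrow\forall z\in_\tau b\,\langle A\rangle^{\vec f b}_{\vec y}$. (2) The interpretation is sound: if $\mathbf{WE\text{-}HA}^\omega$ proves $\Gamma\vdash A$, then there are tuples of closed terms $\vec\gamma$ and $\vec a$ which $\mathcal I_t$ proves to be of types $\vec\tau^+_\Gamma\to\vec\tau^-_A\to(\vec\tau^-_\Gamma)^*$ and $\vec\tau^+_\Gamma\to\vec\tau^+_A$, such that $\mathcal I_t$ proves, for $\vec x$ of types $\vec\tau^+_\Gamma$ and $\vec w$ of types $\vec\tau^-_A$, $$\forall\vec y\in\vec\gamma\vec x\vec w\ \langle\Gamma\rangle^{\vec x}_{\vec y}\ \vdash\ \langle A\rangle^{\vec a\vec x}_{\vec w}.$$ The same holds when QF-ER is omitted from both theories. -/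

import Mathlib

namespace HDN

/-! ## Types, terms and formulas -/

/-- The types of `𝒯*`: booleans, natural numbers, function types and types of finite sequences. -/
inductive Ty
  | bool
  | nat
  | arr (σ τ : Ty)
  | star (τ : Ty)

/-- The finite types `𝒯 ⊆ 𝒯*`: those built without sequence types. -/
def Ty.IsFin : Ty → Prop
  | .bool => True
  | .nat => True
  | .arr σ τ => σ.IsFin ∧ τ.IsFin
  | .star _ => False

/-- The types of type level `0`. -/
def Ty.IsBase : Ty → Prop
  | .bool => True
  | .nat => True
  | .arr _ _ => False
  | .star _ => False

/-- `arrs [ρ₁, …, ρₙ] σ` is `ρ₁ → … → ρₙ → σ`. -/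
def arrs : List Ty → Ty → Ty
  | [], σ => σ
  | ρ :: ρs, σ => .arr ρ (arrs ρs σ)

/-- The constants: zero, successor, the two booleans, definition by cases, the combinators `K` and
`S`, the recursors `R`, the empty sequence, prefixing an element to a sequence, and the sequence
recursors `L`. -/
inductive Ct
  | zero
  | suc
  | tt
  | ff
  | cond (σ : Ty)
  | K (σ τ : Ty)
  | S (σ τ ρ : Ty)
  | R (σ : Ty)
  | nil (σ : Ty)
  | cons (σ : Ty)
  | L (σ ρ : Ty)

/-- The type of a constant. -/
def Ct.ty : Ct → Ty
  | .zero => .nat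
  | .suc => .arr .nat .nat
  | .tt => .bool
  | .ff => .bool
  | .cond σ => arrs [.bool, σ, σ] σ
  | .K σ τ => arrs [σ, τ] σ
  | .S σ τ ρ => arrs [.arr σ (.arr τ ρ), .arr σ τ, σ] ρ
  | .R σ => arrs [.nat, σ, .arr .nat (.arr σ σ)] σ
  | .nil σ => .star σ
  | .cons σ => arrs [σ, .star σ] (.star σ)
  | .L σ ρ => arrs [.star σ, ρ, .arr σ (.arr ρ ρ)] ρ

/-- Terms. Variables are untyped and are de Bruijn indices; `ap σ τ` is the binary function
symbol `Ap_{σ,τ}`. -/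
inductive Tm
  | var (i : ℕ)
  | const (c : Ct)
  | ap (σ τ : Ty) (s t : Tm)

/-- Simultaneous substitution. -/
def Tm.subst (θ : ℕ → Tm) : Tm → Tm
  | .var i => θ i
  | .const c => .const c
  | .ap σ τ s t => .ap σ τ (s.subst θ) (t.subst θ)

/-- Weakening by `n` new innermost variables. -/
def Tm.wk (n : ℕ) (t : Tm) : Tm := t.subst fun i => .var (i + n)

/-- A term without variables. -/
def Tm.Closed : Tm → Prop
  | .var _ => False
  | .const _ => True
  | .ap _ _ s t => s.Closed ∧ t.Closed

/-- The substitution `θ` under one more binder. -/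
def up (θ : ℕ → Tm) : ℕ → Tm
  | 0 => .var 0
  | i + 1 => (θ i).wk 1

/-- The substitution replacing variable `0` by `t` and lowering the other variables. -/
def single (t : Tm) : ℕ → Tm
  | 0 => t
  | i + 1 => .var i

/-- Intuitionistic formulas. The predicate symbols are the typing predicates `τ(x)` and the
equality predicates `=_τ`. Quantifiers are untyped. -/
inductive Fm
  | typ (τ : Ty) (t : Tm)
  | eq (τ : Ty) (s t : Tm)
  | bot
  | and (A B : Fm)
  | imp (A B : Fm)
  | all (A : Fm)
  | ex (A : Fm)

def Fm.subst : Fm → (ℕ → Tm) → Fm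
  | .typ τ t, θ => .typ τ (t.subst θ)
  | .eq τ s t, θ => .eq τ (s.subst θ) (t.subst θ)
  | .bot, _ => .bot
  | .and A B, θ => .and (A.subst θ) (B.subst θ)
  | .imp A B, θ => .imp (A.subst θ) (B.subst θ)
  | .all A, θ => .all (A.subst (up θ))
  | .ex A, θ => .ex (A.subst (up θ))

/-- Weakening by `n` new innermost variables. -/
def Fm.wk (n : ℕ) (A : Fm) : Fm := A.subst fun i => .var (i + n)

/-- `A[t/x]`, where `x` is variable `0`. -/
def Fm.inst (A : Fm) (t : Tm) : Fm := A.subst (single t)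

def Fm.top : Fm := .imp .bot .bot

def Fm.neg (A : Fm) : Fm := .imp A .bot

def Fm.iff (A B : Fm) : Fm := .and (.imp A B) (.imp B A)

/-- `∀ x^τ A`, that is `∀ x (τ(x) → A)`. -/
def Fm.allT (τ : Ty) (A : Fm) : Fm := .all (.imp (.typ τ (.var 0)) A)

/-- `∃ x^τ A`, that is `∃ x (τ(x) ∧ A)`. -/
def Fm.exT (τ : Ty) (A : Fm) : Fm := .ex (.and (.typ τ (.var 0)) A)

/-- Disjunction, `A ∨ B :≡ ∃ z^𝔹 ((z = T → A) ∧ (z = F → B))`. -/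
def Fm.or (A B : Fm) : Fm :=
  .exT .bool (.and (.imp (.eq .bool (.var 0) (.const .tt)) (A.wk 1))
    (.imp (.eq .bool (.var 0) (.const .ff)) (B.wk 1)))

/-- The terms built from types satisfying `P`. -/
def Tm.Over (P : Ty → Prop) : Tm → Prop
  | .var _ => True
  | .const c => P c.ty
  | .ap σ τ s t => P (.arr σ τ) ∧ s.Over P ∧ t.Over P

/-- The formulas built from types satisfying `P`, with equality at types satisfying `Q` only. -/
def Fm.Over (P Q : Ty → Prop) : Fm → Prop
  | .typ τ t => P τ ∧ t.Over P
  | .eq τ s t => Q τ ∧ s.Over P ∧ t.Over P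
  | .bot => True
  | .and A B => A.Over P Q ∧ B.Over P Q
  | .imp A B => A.Over P Q ∧ B.Over P Q
  | .all A => A.Over P Q
  | .ex A => A.Over P Q

/-! ## Term notation -/

/-- `c t₁ … tₙ` for `t : ρ₁ → … → ρₙ → σ`. -/
def apT : List Ty → Ty → Tm → List Tm → Tm
  | ρ :: ρs, σ, t, x :: xs => apT ρs σ (.ap ρ (arrs ρs σ) t x) xs
  | _, _, t, _ => t

/-- `t⃗ x⃗ = t₁ x⃗, …, tₙ x⃗` for a tuple `t⃗` of terms, the `i`-th one of type `ρ⃗ → σᵢ`. -/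
def apTs (ρs σs : List Ty) (ts xs : List Tm) : List Tm :=
  List.zipWith (fun σ t => apT ρs σ t xs) σs ts

def zeroT : Tm := .const .zero

def sucT (t : Tm) : Tm := .ap .nat .nat (.const .suc) t

def nilT (σ : Ty) : Tm := .const (.nil σ)

def consT (σ : Ty) (x u : Tm) : Tm :=
  apT [σ, .star σ] (.star σ) (.const (.cons σ)) [x, u]

def recT (σ : Ty) (n y z : Tm) : Tm :=
  apT [.nat, σ, .arr .nat (.arr σ σ)] σ (.const (.R σ)) [n, y, z]

def condT (σ : Ty) (b x y : Tm) : Tm :=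
  apT [.bool, σ, σ] σ (.const (.cond σ)) [b, x, y]

def seqRecT (σ ρ : Ty) (u y z : Tm) : Tm :=
  apT [.star σ, ρ, .arr σ (.arr ρ ρ)] ρ (.const (.L σ ρ)) [u, y, z]

/-- Concatenation of sequences. -/
def appendT (σ : Ty) (u v : Tm) : Tm := seqRecT σ (.star σ) u v (.const (.cons σ))

/-- `x ∈_τ a`: the sequence `a` is of the form `u * ⟨x⟩ * v`. -/
def Fm.mem (τ : Ty) (x a : Tm) : Fm :=
  .exT (.star τ) (.exT (.star τ)
    (.eq (.star τ) (a.wk 2) (appendT τ (.var 1) (consT τ (x.wk 2) (.var 0)))))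

/-- The set `a` is inhabited. -/
def Fm.inh (τ : Ty) (a : Tm) : Fm := .exT τ (.mem τ (.var 0) (a.wk 1))

/-- Extensional equality: `∀ y⃗ (s y⃗ = t y⃗)`, with equality at the final non-function type. -/
def extEq : Ty → Tm → Tm → Fm
  | .arr σ τ, s, t => .allT σ (extEq τ (.ap σ τ (s.wk 1) (.var 0)) (.ap σ τ (t.wk 1) (.var 0)))
  | τ, s, t => .eq τ s t

/-! ## Intuitionistic theories and provability -/

/-- The non-logical axioms, as sequents, where `E τ s t` expresses equality at type `τ` in the
defining equations of the constants. -/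
inductive Ax (E : Ty → Tm → Tm → Fm) : List Fm → Fm → Prop
  | tyConst (c : Ct) : Ax E [] (.typ c.ty (.const c))
  | tyAp (σ τ : Ty) (f x : Tm) :
      Ax E [.typ (.arr σ τ) f, .typ σ x] (.typ τ (.ap σ τ f x))
  | eqRefl (τ : Ty) (x : Tm) : Ax E [.typ τ x] (.eq τ x x)
  | eqRepl (τ : Ty) (x y : Tm) (A : Fm) : Ax E [.eq τ x y, A.inst x] (A.inst y)
  | boolNe : Ax E [] (.neg (.eq .bool (.const .tt) (.const .ff)))
  | boolCases (A : Fm) (z : Tm) :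
      Ax E [A.inst (.const .tt), A.inst (.const .ff), .typ .bool z] (A.inst z)
  | condTrue (σ : Ty) (x y : Tm) :
      Ax E [.typ σ x, .typ σ y] (E σ (condT σ (.const .tt) x y) x)
  | condFalse (σ : Ty) (x y : Tm) :
      Ax E [.typ σ x, .typ σ y] (E σ (condT σ (.const .ff) x y) y)
  | combK (σ τ : Ty) (x y : Tm) :
      Ax E [.typ σ x, .typ τ y] (E σ (apT [σ, τ] σ (.const (.K σ τ)) [x, y]) x)
  | combS (σ τ ρ : Ty) (x y z : Tm) :
      Ax E [.typ (.arr σ (.arr τ ρ)) x, .typ (.arr σ τ) y, .typ σ z]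
        (E ρ (apT [.arr σ (.arr τ ρ), .arr σ τ, σ] ρ (.const (.S σ τ ρ)) [x, y, z])
          (apT [σ, τ] ρ x [z, .ap σ τ y z]))
  | sucNe (x : Tm) : Ax E [.typ .nat x] (.neg (.eq .nat (sucT x) zeroT))
  | sucInj (x y : Tm) :
      Ax E [.typ .nat x, .typ .nat y, .eq .nat (sucT x) (sucT y)] (.eq .nat x y)
  | recZero (σ : Ty) (y z : Tm) :
      Ax E [.typ σ y, .typ (.arr .nat (.arr σ σ)) z] (E σ (recT σ zeroT y z) y)
  | recSuc (σ : Ty) (n y z : Tm) :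
      Ax E [.typ .nat n, .typ σ y, .typ (.arr .nat (.arr σ σ)) z]
        (E σ (recT σ (sucT n) y z) (apT [.nat, σ] σ z [n, recT σ n y z]))
  | ind (A : Fm) :
      Ax E [A.inst zeroT,
          .allT .nat (.imp A (A.subst fun i => match i with
            | 0 => sucT (.var 0)
            | i + 1 => .var (i + 1)))]
        (.allT .nat A)
  | seqRecNil (σ ρ : Ty) (y z : Tm) :
      Ax E [.typ ρ y, .typ (.arr σ (.arr ρ ρ)) z] (E ρ (seqRecT σ ρ (nilT σ) y z) y)
  | seqRecCons (σ ρ : Ty) (x u y z : Tm) :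
      Ax E [.typ σ x, .typ (.star σ) u, .typ ρ y, .typ (.arr σ (.arr ρ ρ)) z]
        (E ρ (seqRecT σ ρ (consT σ x u) y z) (apT [σ, ρ] ρ z [x, seqRecT σ ρ u y z]))
  | seqInd (σ : Ty) (A : Fm) :
      Ax E [A.inst (nilT σ),
          .allT σ (.allT (.star σ) (.imp
            (A.subst fun i => match i with
              | 0 => .var 0
              | i + 1 => .var (i + 2))
            (A.subst fun i => match i with
              | 0 => consT σ (.var 1) (.var 0)
              | i + 1 => .var (i + 2))))]
        (.allT (.star σ) A)

/-- The intuitionistic theories considered here: which types are available, at which types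
equality is a predicate symbol, how equality is expressed in the defining equations, and whether
the quantifier-free rule of extensionality is available. -/
structure Theory where
  tyOK : Ty → Prop
  eqOK : Ty → Prop
  eqAt : Ty → Tm → Tm → Fm
  wext : Bool

/-- The terms of the theory. -/
def Theory.LangT (T : Theory) (t : Tm) : Prop := t.Over T.tyOK

/-- The formulas of the theory. -/
def Theory.Lang (T : Theory) (A : Fm) : Prop := A.Over T.tyOK T.eqOK

/-- Quantifier-free formulas over equations of type level `0`. -/
def Fm.QF : Fm → Prop
  | .typ _ _ => False
  | .eq τ _ _ => τ.IsBase
  | .bot => True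
  | .and A B => A.QF ∧ B.QF
  | .imp A B => A.QF ∧ B.QF
  | .all _ => False
  | .ex _ => False

/-- `t` is well typed of type `τ`, the types of its variables being declared in `Γ`. -/
inductive HasTy (Γ : List Fm) : Tm → Ty → Prop
  | var {σ : Ty} {i : ℕ} : Fm.typ σ (.var i) ∈ Γ → HasTy Γ (.var i) σ
  | const (c : Ct) : HasTy Γ (.const c) c.ty
  | ap {σ τ : Ty} {s t : Tm} : HasTy Γ s (.arr σ τ) → HasTy Γ t σ → HasTy Γ (.ap σ τ s t) τ

/-- Derivability in natural deduction, all formulas being formulas of the theory. In `qfER` the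
premise is a sequent whose assumptions declare types of variables or are quantifier-free. -/
inductive Der (T : Theory) : List Fm → Fm → Prop
  | hyp {Γ : List Fm} {A : Fm} : A ∈ Γ → Der T Γ A
  | nonlog {Γ Δ : List Fm} {A : Fm} :
      Ax T.eqAt Δ A → T.Lang A → (∀ B ∈ Δ, Der T Γ B) → Der T Γ A
  | botE {Γ : List Fm} {A : Fm} : T.Lang A → Der T Γ .bot → Der T Γ A
  | andI {Γ : List Fm} {A B : Fm} : Der T Γ A → Der T Γ B → Der T Γ (.and A B)
  | andE₁ {Γ : List Fm} {A B : Fm} : Der T Γ (.and A B) → Der T Γ A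
  | andE₂ {Γ : List Fm} {A B : Fm} : Der T Γ (.and A B) → Der T Γ B
  | impI {Γ : List Fm} {A B : Fm} : T.Lang A → Der T (A :: Γ) B → Der T Γ (.imp A B)
  | impE {Γ : List Fm} {A B : Fm} : Der T Γ (.imp A B) → Der T Γ A → Der T Γ B
  | allI {Γ : List Fm} {A : Fm} : Der T (Γ.map (Fm.wk 1)) A → Der T Γ (.all A)
  | allE {Γ : List Fm} {A : Fm} (t : Tm) :
      T.LangT t → Der T Γ (.all A) → Der T Γ (A.inst t)
  | exI {Γ : List Fm} {A : Fm} (t : Tm) : Der T Γ (A.inst t) → Der T Γ (.ex A)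
  | exE {Γ : List Fm} {A B : Fm} :
      Der T Γ (.ex A) → Der T (A :: Γ.map (Fm.wk 1)) (B.wk 1) → Der T Γ B
  | qfER {Γ Γ₀ : List Fm} {ρ τ : Ty} {s t r : Tm} :
      T.wext = true →
      (∀ B ∈ Γ₀, B.QF ∨ ∃ σ i, B = .typ σ (.var i)) →
      HasTy Γ₀ s ρ → HasTy Γ₀ t ρ →
      HasTy (.typ ρ (.var 0) :: Γ₀.map (Fm.wk 1)) r τ →
      T.Lang (extEq τ (r.subst (single s)) (r.subst (single t))) →
      Der T Γ₀ (extEq ρ s t) → (∀ B ∈ Γ₀, Der T Γ B) →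
      Der T Γ (extEq τ (r.subst (single s)) (r.subst (single t)))

/-- The theory proves the sequent `Γ ⊢ A` of its language. -/
def Theory.Proves (T : Theory) (Γ : List Fm) (A : Fm) : Prop :=
  (∀ B ∈ Γ, T.Lang B) ∧ Der T Γ A

/-- `WEHA true` is weakly extensional Heyting arithmetic in all finite types with explicit typing:
no sequence types, equality at type level `0` only, higher equations being read extensionally, and
the quantifier-free rule of extensionality. `WEHA false` is the same without that rule. -/
def WEHA (wext : Bool) : Theory where
  tyOK := Ty.IsFin
  eqOK := Ty.IsBase
  eqAt := extEq
  wext := wext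

/-- `NHA false` is Heyting arithmetic in all finite types and sequence types with explicit typing
and with equality as a predicate symbol at all types, without extensionality. `NHA true` is the
same with the quantifier-free rule of extensionality. -/
def NHA (wext : Bool) : Theory where
  tyOK := fun _ => True
  eqOK := fun _ => True
  eqAt := Fm.eq
  wext := wext

/-! ## Affine logic and the translations -/

/-- Formulas of intuitionistic affine logic. -/
inductive ALFm
  | typ (τ : Ty) (t : Tm)
  | eq (τ : Ty) (s t : Tm)
  | bot
  | tensor (A B : ALFm)
  | lolli (A B : ALFm)
  | bang (A : ALFm)
  | all (A : ALFm)
  | ex (A : ALFm)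

/-- The Girard translation `A*`. -/
def Fm.girard : Fm → ALFm
  | .typ τ t => .typ τ t
  | .eq τ s t => .eq τ s t
  | .bot => .bot
  | .and A B => .tensor A.girard B.girard
  | .imp A B => .lolli (.bang A.girard) B.girard
  | .all A => .all A.girard
  | .ex A => .ex (.bang A.girard)

/-- The forgetful translation. -/
def ALFm.forget : ALFm → Fm
  | .typ τ t => .typ τ t
  | .eq τ s t => .eq τ s t
  | .bot => .bot
  | .tensor A B => .and A.forget B.forget
  | .lolli A B => .imp A.forget B.forget
  | .bang A => A.forget
  | .all A => .all A.forget
  | .ex A => .ex A.forget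

/-! ## The parametrised interpretation

The typing predicates are computational, equality is non-computational. -/

/-- The parameters of the interpretation of an affine theory. -/
structure ALParams where
  /-- the witnessing type of the predicate `τ(x)` -/
  wtype : Ty → Ty
  /-- `bound τ x a` is the formula `x ≺_τ a` -/
  bound : Ty → Tm → Tm → ALFm
  /-- the bounding types of a tuple of types -/
  btype : List Ty → List Ty
  /-- `ubq [τ₁, …, τₙ] a⃗ A` is the bounded quantification `∀ x⃗ ⊏_τ⃗ a⃗ A`; it binds the `n` innermost
  variables of `A`, the variable of `τᵢ` having index `n - i` -/
  ubq : List Ty → List Tm → ALFm → ALFm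

/-- The parameters of the interpretation of an intuitionistic theory, as above. -/
structure ILParams where
  wtype : Ty → Ty
  bound : Ty → Tm → Tm → Fm
  /-- the domain `W_τ(x)` of the witnesses -/
  W : Ty → Tm → Fm
  btype : List Ty → List Ty
  ubq : List Ty → List Tm → Fm → Fm

/-- The affine parameters obtained from intuitionistic ones by the Girard translation. -/
def ILParams.toAL (p : ILParams) : ALParams where
  wtype := p.wtype
  bound := fun τ x a => (p.bound τ x a).girard
  btype := p.btype
  ubq := fun τs a A => (p.ubq τs a A.forget).girard

/-- The types of the witnesses (first component) and of the counter-witnesses (second component)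
of a formula. -/
def ALParams.types (p : ALParams) : ALFm → List Ty × List Ty
  | .typ τ _ => ([p.wtype τ], [])
  | .eq _ _ _ => ([], [])
  | .bot => ([], [])
  | .tensor A B => ((p.types A).1 ++ (p.types B).1, (p.types A).2 ++ (p.types B).2)
  | .lolli A B =>
      ((p.types B).1.map (arrs (p.types A).1) ++
        (p.types A).2.map (arrs ((p.types A).1 ++ (p.types B).2)),
       (p.types A).1 ++ (p.types B).2)
  | .bang A => ((p.types A).1, p.btype (p.types A).2)
  | .all A => p.types A
  | .ex A => p.types A

/-- The `n` innermost bound variables, outermost first. -/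
def bvs (n : ℕ) : List Tm := (List.range n).reverse.map Tm.var

/-- `p.inter A θ x⃗ y⃗` is the interpretation `|A[θ]|^{x⃗}_{y⃗}`, with tuples of terms `x⃗` and `y⃗`
in the places of the witnesses and of the counter-witnesses. -/
def ALParams.inter (p : ALParams) : ALFm → (ℕ → Tm) → List Tm → List Tm → ALFm
  | .typ τ t, θ, x, _ => p.bound τ (t.subst θ) (x.headD zeroT)
  | .eq τ s t, θ, _, _ => .eq τ (s.subst θ) (t.subst θ)
  | .bot, _, _, _ => .bot
  | .tensor A B, θ, x, y =>
      .tensor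
        (p.inter A θ (x.take (p.types A).1.length) (y.take (p.types A).2.length))
        (p.inter B θ (x.drop (p.types A).1.length) (y.drop (p.types A).2.length))
  | .lolli A B, θ, fg, xw =>
      .lolli
        (p.inter A θ (xw.take (p.types A).1.length)
          (apTs ((p.types A).1 ++ (p.types B).2) (p.types A).2
            (fg.drop (p.types B).1.length) xw))
        (p.inter B θ
          (apTs (p.types A).1 (p.types B).1 (fg.take (p.types B).1.length)
            (xw.take (p.types A).1.length))
          (xw.drop (p.types A).1.length))
  | .bang A, θ, x, a =>
      .bang (p.ubq (p.types A).2 a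
        (p.inter A (fun i => (θ i).wk (p.types A).2.length)
          (x.map (Tm.wk (p.types A).2.length)) (bvs (p.types A).2.length)))
  | .all A, θ, x, y => .all (p.inter A (up θ) (x.map (Tm.wk 1)) (y.map (Tm.wk 1)))
  | .ex A, θ, x, y => .ex (p.inter A (up θ) (x.map (Tm.wk 1)) (y.map (Tm.wk 1)))

/-- The types of the witnesses of an intuitionistic formula. -/
def ILParams.pos (p : ILParams) (A : Fm) : List Ty := (p.toAL.types A.girard).1

/-- The types of the counter-witnesses of an intuitionistic formula. -/
def ILParams.neg (p : ILParams) (A : Fm) : List Ty := (p.toAL.types A.girard).2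

/-- The types of the bounds for the counter-witnesses of an intuitionistic formula. -/
def ILParams.bneg (p : ILParams) (A : Fm) : List Ty := p.btype (p.neg A)

/-- The interpretation of intuitionistic formulas: Girard translation, followed by the
parametrised interpretation of affine logic, followed by the forgetful translation. -/
def ILParams.inter (p : ILParams) (A : Fm) (x y : List Tm) : Fm :=
  (p.toAL.inter A.girard Tm.var x y).forget

/-- The bounded interpretation `∀ y⃗ ⊏ a⃗ |A|^{x⃗}_{y⃗}`. -/
def ILParams.binter (p : ILParams) (A : Fm) (x a : List Tm) : Fm :=
  p.ubq (p.neg A) a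
    (p.inter (A.wk (p.neg A).length) (x.map (Tm.wk (p.neg A).length)) (bvs (p.neg A).length))

/-- The bounded interpretations of a list of formulas. -/
def ILParams.binters (p : ILParams) : List Fm → List Tm → List Tm → List Fm
  | [], _, _ => []
  | A :: Γ, x, a =>
      p.binter A (x.take (p.pos A).length) (a.take (p.bneg A).length) ::
        p.binters Γ (x.drop (p.pos A).length) (a.drop (p.bneg A).length)

/-- The typing assumptions `τ₁(x₁), …, τₙ(xₙ)`. -/
def typs (τs : List Ty) (xs : List Tm) : List Fm := List.zipWith Fm.typ τs xs

/-- The sequent `Γ ⊢ A` is witnessable in `T`: there are tuples `γ⃗` and `a⃗` of closed terms of the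
right types, in the domain of witnesses, such that `T` proves
`W(x⃗, w⃗), ∀ y⃗ ⊏ γ⃗ x⃗ w⃗ |Γ|^{x⃗}_{y⃗} ⊢ |A|^{a⃗ x⃗}_{w⃗}`
where `x⃗` and `w⃗` are arbitrary tuples whose typing is assumed. -/
def ILParams.Witnessable (p : ILParams) (T : Theory) (Γ : List Fm) (A : Fm) : Prop :=
  ∃ γ a : List Tm,
    (∀ t ∈ γ, t.Closed ∧ T.LangT t) ∧ (∀ t ∈ a, t.Closed ∧ T.LangT t) ∧
    List.Forall₂ (fun τ t => Der T [] (.typ τ t) ∧ Der T [] (p.W τ t))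
      ((Γ.flatMap p.bneg).map (arrs (Γ.flatMap p.pos ++ p.neg A))) γ ∧
    List.Forall₂ (fun τ t => Der T [] (.typ τ t) ∧ Der T [] (p.W τ t))
      ((p.pos A).map (arrs (Γ.flatMap p.pos))) a ∧
    ∀ x w : List Tm, x.length = (Γ.flatMap p.pos).length → w.length = (p.neg A).length →
      (∀ t ∈ x, T.LangT t) → (∀ t ∈ w, T.LangT t) →
      Der T
        (typs (Γ.flatMap p.pos) x ++ typs (p.neg A) w ++
          List.zipWith p.W (Γ.flatMap p.pos) x ++ List.zipWith p.W (p.neg A) w ++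
          p.binters Γ x
            (apTs (Γ.flatMap p.pos ++ p.neg A) (Γ.flatMap p.bneg) γ (x ++ w)))
        (p.inter A (apTs (Γ.flatMap p.pos) (p.pos A) a x) w)

/-- The interpretation of `T` into `T'` is sound. -/
def ILParams.Sound (p : ILParams) (T T' : Theory) : Prop :=
  ∀ (Γ : List Fm) (A : Fm), T.Proves Γ A → p.Witnessable T' Γ A

/-! ## The Herbrand Diller–Nahm instance -/

/-- `∀ x⃗ ∈_τ⃗ a⃗ A`, that is `∀ x₁^{τ₁} ∈ a₁ … ∀ xₙ^{τₙ} ∈ aₙ A`. -/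
def memAll : List Ty → List Tm → Fm → Fm
  | τ :: τs, a :: as, A =>
      .allT τ (.imp (.mem τ (.var 0) (a.wk 1)) (memAll τs (as.map (Tm.wk 1)) A))
  | _, _, A => A

/-- `x ≺_τ a` is `τ(x) ∧ x ∈_τ a`, witnesses are finite sequences (regarded as finite sets) and are
not restricted any further, and contraction is bounded by finite sets. -/
def hdn : ILParams where
  wtype := Ty.star
  bound := fun τ x a => .and (.typ τ x) (.mem τ x a)
  W := fun _ _ => .top
  btype := List.map Ty.star
  ubq := memAll

/-- `∀ y⃗ ∈ a⃗ |A|^{x⃗}_{y⃗}`. -/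
def memInter (A : Fm) (x a : List Tm) : Fm :=
  memAll (hdn.neg A) a
    (hdn.inter (A.wk (hdn.neg A).length) (x.map (Tm.wk (hdn.neg A).length))
      (bvs (hdn.neg A).length))

end HDN

open HDN

/-! Derivability in the target theory is treated as forcing. Every term and formula belongs to its
language, so over contexts ordered by inclusion an implication is a transfer of derivability at all
larger contexts, a universal formula is the family of its term instances, and an existential is
eliminated against an arbitrary witness in a larger context (`Der.imp_iff`, `Der.all_iff`,
`Der.exE'`). Object-level proofs thereby become ordinary reasoning about derivable formulas.
Forgetting undoes the Girard translation, so the interpretation has direct recursive clauses,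
written with `J` and its bounded form `JB`.

The core of soundness is that witnesses are finite sets, or functionals whose final values are
finite sets, and that the interpretation is monotone in them (`J_mono`): a pointwise larger witness
is still a witness. A realizer never has to choose correctly; it only has to collect finitely many
candidates, and the matrix need not be decidable. Application is answered by the set of all `f x`
with `f` and `x` from given sets; a boolean case distinction by the union over the possible
booleans; the two premises of modus ponens share a context, whose bounds are concatenated, and the
counter-witnesses ranging over a finite set are absorbed by a union over that set (`RepT.bigUnion`).

Realizers are handled as functions on tuples of terms that come from well-typed open terms (`Rep`,
`RepT`), so that they compose like functions. Combinatory completeness turns them into functionals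
(`RepT.curry`), and finally into closed terms; the conversion holds only up to provable equality,
which monotonicity absorbs.

Induction on source derivations shows that each derivable sequent has such realizers (`Wit`). They
work uniformly under all substitutions for the free variables, so untyped quantifiers contribute no
data. Each non-logical axiom is realized as a sequent and cut in. Quantifier-free formulas interpret
themselves, and an extensional equation is equivalent to its interpretation because every object
lies in a singleton (`J_extEq_iff`); this settles the defining equations and the extensionality
rule. Induction is reduced to a rule with empty side context, whose realizer comes from simultaneous
recursion on tuples (`RepT.simRec`) followed by a union over the finite set of candidate numbers.

In the clauses for the connectives, only existence and disjunction need more than unfolding. There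
the claim that the witness lies in its set stands inside the quantification over the bounding sets,
and is lost when one of these is empty. The remedy is a provable distinction between inhabited and
empty sets (`Typs.inh_cases`). -/

namespace HDN

/-! ## Substitution -/

/-- Extension of a substitution by a term for variable `0`. -/
def scons (t : Tm) (θ : ℕ → Tm) : ℕ → Tm
  | 0 => t
  | i + 1 => θ i

@[simp] theorem scons_zero (t : Tm) (θ : ℕ → Tm) : scons t θ 0 = t := rfl
@[simp] theorem scons_succ (t : Tm) (θ : ℕ → Tm) (i : ℕ) : scons t θ (i + 1) = θ i := rfl
@[simp] theorem single_zero (t : Tm) : single t 0 = t := rfl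
@[simp] theorem single_succ (t : Tm) (i : ℕ) : single t (i + 1) = .var i := rfl
@[simp] theorem up_zero (θ : ℕ → Tm) : up θ 0 = .var 0 := rfl
@[simp] theorem up_succ (θ : ℕ → Tm) (i : ℕ) : up θ (i + 1) = (θ i).wk 1 := rfl

@[simp] theorem Tm.subst_subst (t : Tm) (θ η : ℕ → Tm) :
    (t.subst θ).subst η = t.subst fun i => (θ i).subst η := by
  induction t <;> simp_all [Tm.subst]

@[simp] theorem Tm.subst_var (t : Tm) : t.subst Tm.var = t := by
  induction t <;> simp_all [Tm.subst]

@[simp] theorem Tm.var_subst (i : ℕ) (θ : ℕ → Tm) : (Tm.var i).subst θ = θ i := rfl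

@[simp] theorem Tm.const_subst (c : Ct) (θ : ℕ → Tm) : (Tm.const c).subst θ = .const c := rfl

@[simp] theorem Tm.ap_subst (σ τ : Ty) (s t : Tm) (θ : ℕ → Tm) :
    (Tm.ap σ τ s t).subst θ = .ap σ τ (s.subst θ) (t.subst θ) := rfl

theorem Tm.wk_subst (n : ℕ) (t : Tm) (θ : ℕ → Tm) :
    (t.wk n).subst θ = t.subst fun i => θ (i + n) := by
  simp [Tm.wk]

theorem Tm.subst_wk (n : ℕ) (t : Tm) (θ : ℕ → Tm) :
    (t.subst θ).wk n = t.subst fun i => (θ i).wk n := by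
  simp [Tm.wk]

@[simp] theorem Tm.wk_subst_single (t s : Tm) : (t.wk 1).subst (single s) = t := by
  rw [Tm.wk_subst]
  exact t.subst_var

@[simp] theorem Tm.wk_subst_up (t : Tm) (θ : ℕ → Tm) :
    (t.wk 1).subst (up θ) = (t.subst θ).wk 1 := by
  rw [Tm.wk_subst, Tm.subst_wk]; rfl

@[simp] theorem Tm.wk_zero (t : Tm) : t.wk 0 = t := t.subst_var

@[simp] theorem Tm.wk_wk (m n : ℕ) (t : Tm) : (t.wk m).wk n = t.wk (m + n) := by
  simp [Tm.wk, Tm.subst, Nat.add_assoc]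

theorem up_up (θ η : ℕ → Tm) :
    (fun i => (up θ i).subst (up η)) = up fun i => (θ i).subst η := by
  funext i; cases i <;> simp

@[simp] theorem up_var : up Tm.var = Tm.var := by
  funext i; cases i <;> simp [Tm.wk, Tm.subst]

@[simp] theorem Fm.subst_subst (A : Fm) (θ η : ℕ → Tm) :
    (A.subst θ).subst η = A.subst fun i => (θ i).subst η := by
  induction A generalizing θ η <;> simp_all [Fm.subst, up_up]

@[simp] theorem Fm.subst_var (A : Fm) : A.subst Tm.var = A := by
  induction A <;> simp_all [Fm.subst]

theorem up_scons (θ : ℕ → Tm) (t : Tm) :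
    (fun i => (up θ i).subst (single t)) = scons t θ := by
  funext i; cases i <;> simp

theorem Fm.subst_up_inst (A : Fm) (θ : ℕ → Tm) (t : Tm) :
    (A.subst (up θ)).inst t = A.subst (scons t θ) := by
  simp [Fm.inst, up_scons]

theorem single_subst (θ : ℕ → Tm) (t : Tm) :
    (fun i => (single t i).subst θ) = scons (t.subst θ) θ := by
  funext i; cases i <;> simp

theorem Fm.inst_subst (A : Fm) (t : Tm) (θ : ℕ → Tm) :
    (A.inst t).subst θ = A.subst (scons (t.subst θ) θ) := by
  simp [Fm.inst, single_subst]

theorem Fm.inst_subst' (A : Fm) (t : Tm) (θ : ℕ → Tm) :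
    (A.inst t).subst θ = (A.subst (up θ)).inst (t.subst θ) := by
  rw [Fm.inst_subst, Fm.subst_up_inst]

theorem Fm.wk_subst (n : ℕ) (A : Fm) (θ : ℕ → Tm) :
    (A.wk n).subst θ = A.subst fun i => θ (i + n) := by
  simp [Fm.wk]

@[simp] theorem Fm.wk_inst (A : Fm) (t : Tm) : (A.wk 1).inst t = A := by
  rw [Fm.inst, Fm.wk_subst]
  exact A.subst_var

theorem Fm.wk_subst_up (A : Fm) (θ : ℕ → Tm) :
    (A.wk 1).subst (up θ) = (A.subst θ).wk 1 := by
  simp [Fm.wk, Tm.wk]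

@[simp] theorem Fm.typ_subst (τ : Ty) (t : Tm) (θ : ℕ → Tm) :
    (Fm.typ τ t).subst θ = .typ τ (t.subst θ) := rfl

@[simp] theorem Fm.eq_subst (τ : Ty) (s t : Tm) (θ : ℕ → Tm) :
    (Fm.eq τ s t).subst θ = .eq τ (s.subst θ) (t.subst θ) := rfl

@[simp] theorem Fm.bot_subst (θ : ℕ → Tm) : Fm.bot.subst θ = .bot := rfl

@[simp] theorem Fm.and_subst (A B : Fm) (θ : ℕ → Tm) :
    (Fm.and A B).subst θ = .and (A.subst θ) (B.subst θ) := rfl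

@[simp] theorem Fm.imp_subst (A B : Fm) (θ : ℕ → Tm) :
    (Fm.imp A B).subst θ = .imp (A.subst θ) (B.subst θ) := rfl

@[simp] theorem Fm.all_subst (A : Fm) (θ : ℕ → Tm) :
    (Fm.all A).subst θ = .all (A.subst (up θ)) := rfl

@[simp] theorem Fm.ex_subst (A : Fm) (θ : ℕ → Tm) :
    (Fm.ex A).subst θ = .ex (A.subst (up θ)) := rfl

@[simp] theorem Fm.allT_subst (τ : Ty) (A : Fm) (θ : ℕ → Tm) :
    (Fm.allT τ A).subst θ = .allT τ (A.subst (up θ)) := rfl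

@[simp] theorem Fm.exT_subst (τ : Ty) (A : Fm) (θ : ℕ → Tm) :
    (Fm.exT τ A).subst θ = .exT τ (A.subst (up θ)) := rfl

@[simp] theorem apT_subst (ρs : List Ty) (σ : Ty) (t : Tm) (xs : List Tm) (θ : ℕ → Tm) :
    (apT ρs σ t xs).subst θ = apT ρs σ (t.subst θ) (xs.map (Tm.subst θ)) := by
  induction ρs generalizing t xs with
  | nil => cases xs <;> rfl
  | cons ρ ρs ih =>
    cases xs with
    | nil => rfl
    | cons x xs => simp [apT, ih]

@[simp] theorem appendT_subst (σ : Ty) (u v : Tm) (θ : ℕ → Tm) :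
    (appendT σ u v).subst θ = appendT σ (u.subst θ) (v.subst θ) := rfl

@[simp] theorem consT_subst (σ : Ty) (x u : Tm) (θ : ℕ → Tm) :
    (consT σ x u).subst θ = consT σ (x.subst θ) (u.subst θ) := rfl

@[simp] theorem nilT_subst (σ : Ty) (θ : ℕ → Tm) : (nilT σ).subst θ = nilT σ := rfl

@[simp] theorem zeroT_subst (θ : ℕ → Tm) : zeroT.subst θ = zeroT := rfl

@[simp] theorem sucT_subst (t : Tm) (θ : ℕ → Tm) : (sucT t).subst θ = sucT (t.subst θ) := rfl

@[simp] theorem condT_subst (σ : Ty) (b x y : Tm) (θ : ℕ → Tm) :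
    (condT σ b x y).subst θ = condT σ (b.subst θ) (x.subst θ) (y.subst θ) := rfl

@[simp] theorem seqRecT_subst (σ ρ : Ty) (u y z : Tm) (θ : ℕ → Tm) :
    (seqRecT σ ρ u y z).subst θ = seqRecT σ ρ (u.subst θ) (y.subst θ) (z.subst θ) := rfl

@[simp] theorem Fm.mem_subst (τ : Ty) (x a : Tm) (θ : ℕ → Tm) :
    (Fm.mem τ x a).subst θ = .mem τ (x.subst θ) (a.subst θ) := by
  simp [Fm.mem, Tm.wk]

@[simp] theorem extEq_subst (τ : Ty) (s t : Tm) (θ : ℕ → Tm) :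
    (extEq τ s t).subst θ = extEq τ (s.subst θ) (t.subst θ) := by
  induction τ generalizing s t θ with
  | arr σ τ _ ih => simp [extEq, ih]
  | _ => rfl

/-- The substitution turning `A` into the induction step `A[Suc x/x]`. -/
def sucSub : ℕ → Tm
  | 0 => sucT (.var 0)
  | i + 1 => .var (i + 1)

theorem Ax.subst {Δ : List Fm} {A : Fm} (h : Ax Fm.eq Δ A) (θ : ℕ → Tm) :
    Ax Fm.eq (Δ.map fun B => B.subst θ) (A.subst θ) := by
  cases h with
  | tyConst c => exact .tyConst c
  | tyAp σ τ f x => exact .tyAp σ τ _ _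
  | eqRefl τ x => exact .eqRefl τ _
  | eqRepl τ x y A =>
    simpa [Fm.inst_subst'] using Ax.eqRepl τ (x.subst θ) (y.subst θ) (A.subst (up θ))
  | boolNe => exact .boolNe
  | boolCases A z =>
    simpa [Fm.inst_subst'] using Ax.boolCases (A.subst (up θ)) (z.subst θ)
  | condTrue σ x y => exact .condTrue σ _ _
  | condFalse σ x y => exact .condFalse σ _ _
  | combK σ τ x y => exact .combK σ τ _ _
  | combS σ τ ρ x y z => exact .combS σ τ ρ _ _ _
  | sucNe x => exact .sucNe _
  | sucInj x y => exact .sucInj _ _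
  | recZero σ y z => exact .recZero σ _ _
  | recSuc σ n y z => exact .recSuc σ _ _ _
  | ind A =>
    convert Ax.ind (E := Fm.eq) (A.subst (up θ)) using 1
    · simp only [List.map_cons, List.map_nil, Fm.inst_subst', Fm.allT_subst, Fm.imp_subst,
        Fm.subst_subst, zeroT_subst]
      congr 5
      funext i
      rcases i with _ | i
      · rfl
      · simp [Tm.wk]
    · rfl
  | seqRecNil σ ρ y z => exact .seqRecNil σ ρ _ _
  | seqRecCons σ ρ x u y z => exact .seqRecCons σ ρ _ _ _ _
  | seqInd σ A =>
    convert Ax.seqInd (E := Fm.eq) σ (A.subst (up θ)) using 1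
    · simp only [List.map_cons, List.map_nil, Fm.inst_subst', Fm.allT_subst, Fm.imp_subst,
        Fm.subst_subst, nilT_subst]
      congr 6
      all_goals
        funext i
        rcases i with _ | i
        · rfl
        · simp [Tm.wk]
    · rfl

/-! ## Derivability in the target theory -/

theorem NHA.langT (e : Bool) (t : Tm) : (NHA e).LangT t := by
  induction t <;> simp_all [Theory.LangT, Tm.Over, NHA]

theorem NHA.lang (e : Bool) (A : Fm) : (NHA e).Lang A := by
  have ht : ∀ t : Tm, t.Over (fun _ => True) := NHA.langT e
  induction A <;> simp_all [Theory.Lang, Fm.Over, NHA]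

/-- Renaming of variables, as a substitution. -/
def ren (ρ : ℕ → ℕ) : ℕ → Tm := fun i => .var (ρ i)

theorem up_ren (ρ : ℕ → ℕ) : up (ren ρ) = ren fun i => Nat.casesOn i 0 fun j => ρ j + 1 := by
  funext i; cases i <;> simp [ren, Tm.wk]

theorem HasTy.rename {Γ : List Fm} {t : Tm} {τ : Ty} (h : HasTy Γ t τ) (ρ : ℕ → ℕ) :
    HasTy (Γ.map fun B => B.subst (ren ρ)) (t.subst (ren ρ)) τ := by
  induction h with
  | var h => exact .var (List.mem_map.2 ⟨_, h, rfl⟩)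
  | const c => exact .const c
  | ap _ _ ih₁ ih₂ => exact .ap ih₁ ih₂

theorem Fm.QF.subst {A : Fm} (h : A.QF) (θ : ℕ → Tm) : (A.subst θ).QF := by
  induction A with
  | and A B ihA ihB => exact ⟨ihA h.1, ihB h.2⟩
  | imp A B ihA ihB => exact ⟨ihA h.1, ihB h.2⟩
  | eq => exact h
  | bot => exact h
  | _ => exact h.elim

theorem map_wk_map_up (Γ : List Fm) (θ : ℕ → Tm) :
    (Γ.map (Fm.wk 1)).map (fun B => B.subst (up θ)) =
      (Γ.map fun B => B.subst θ).map (Fm.wk 1) := by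
  simp [Fm.wk_subst_up]

variable {e : Bool}

/-- Only renamings can be pushed through a derivation directly: the premise of `qfER` may declare
types of variables but not of compound terms, and a general substitution would destroy this form.
Substitution of terms is recovered later through the universal quantifier. -/
theorem Der.rename {Γ : List Fm} {A : Fm} (h : Der (NHA e) Γ A) (ρ : ℕ → ℕ) :
    Der (NHA e) (Γ.map fun B => B.subst (ren ρ)) (A.subst (ren ρ)) := by
  induction h generalizing ρ with
  | hyp h => exact .hyp (List.mem_map.2 ⟨_, h, rfl⟩)
  | nonlog ax _ _ ih =>
    refine .nonlog (Ax.subst ax _) (NHA.lang _ _) fun B hB => ?_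
    obtain ⟨C, hC, rfl⟩ := List.mem_map.1 hB
    exact ih C hC ρ
  | botE _ _ ih => exact .botE (NHA.lang _ _) (ih ρ)
  | andI _ _ ih₁ ih₂ => exact .andI (ih₁ ρ) (ih₂ ρ)
  | andE₁ _ ih => exact .andE₁ (ih ρ)
  | andE₂ _ ih => exact .andE₂ (ih ρ)
  | impI _ _ ih => exact .impI (NHA.lang _ _) (ih ρ)
  | impE _ _ ih₁ ih₂ => exact .impE (ih₁ ρ) (ih₂ ρ)
  | allI _ ih =>
    refine .allI ?_
    rw [← map_wk_map_up, up_ren]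
    exact ih _
  | allE t _ _ ih =>
    rw [Fm.inst_subst']
    exact .allE _ (NHA.langT _ _) (ih ρ)
  | exI t _ ih =>
    refine .exI (t.subst (ren ρ)) ?_
    rw [← Fm.inst_subst']
    exact ih ρ
  | exE _ _ ih₁ ih₂ =>
    refine .exE (ih₁ ρ) ?_
    have := ih₂ fun i => Nat.casesOn i 0 fun j => ρ j + 1
    rw [← up_ren, List.map_cons, map_wk_map_up, Fm.wk_subst_up] at this
    exact this
  | @qfER Γ Γ₀ ρ' τ s t r hw hΓ hs ht hr _ _ _ ih₁ ih₂ =>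
    have key : ∀ s : Tm, (r.subst (single s)).subst (ren ρ) =
        (r.subst (up (ren ρ))).subst (single (s.subst (ren ρ))) := by
      intro s; simp [single_subst, up_scons]
    rw [extEq_subst, key, key]
    refine .qfER (Γ₀ := Γ₀.map fun B => B.subst (ren ρ)) hw ?_ (hs.rename ρ) (ht.rename ρ) ?_
      (NHA.lang _ _) ?_ ?_
    · intro B hB
      obtain ⟨C, hC, rfl⟩ := List.mem_map.1 hB
      rcases hΓ C hC with h | ⟨σ, i, rfl⟩
      · exact .inl (h.subst _)
      · exact .inr ⟨σ, ρ i, rfl⟩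
    · have := hr.rename fun i => Nat.casesOn i 0 fun j => ρ j + 1
      rw [← up_ren, List.map_cons, map_wk_map_up] at this
      exact this
    · simpa using ih₁ ρ
    · intro B hB
      obtain ⟨C, hC, rfl⟩ := List.mem_map.1 hB
      exact ih₂ C hC ρ

theorem Der.wk {Γ : List Fm} {A : Fm} (h : Der (NHA e) Γ A) (n : ℕ) :
    Der (NHA e) (Γ.map (Fm.wk n)) (A.wk n) :=
  h.rename fun i => i + n

theorem Der.mono {Γ Δ : List Fm} {A : Fm} (h : Der (NHA e) Γ A) (hΔ : Γ ⊆ Δ) :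
    Der (NHA e) Δ A := by
  induction h generalizing Δ with
  | hyp h => exact .hyp (hΔ h)
  | nonlog ax hl _ ih => exact .nonlog ax hl fun B hB => ih B hB hΔ
  | botE hl _ ih => exact .botE hl (ih hΔ)
  | andI _ _ ih₁ ih₂ => exact .andI (ih₁ hΔ) (ih₂ hΔ)
  | andE₁ _ ih => exact .andE₁ (ih hΔ)
  | andE₂ _ ih => exact .andE₂ (ih hΔ)
  | impI hl _ ih => exact .impI hl (ih (List.cons_subset_cons _ hΔ))
  | impE _ _ ih₁ ih₂ => exact .impE (ih₁ hΔ) (ih₂ hΔ)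
  | allI _ ih => exact .allI (ih (List.map_subset _ hΔ))
  | allE t hl _ ih => exact .allE t hl (ih hΔ)
  | exI t _ ih => exact .exI t (ih hΔ)
  | exE _ _ ih₁ ih₂ => exact .exE (ih₁ hΔ) (ih₂ (List.cons_subset_cons _ (List.map_subset _ hΔ)))
  | qfER hw hΓ hs ht hr hl h₁ _ _ ih₂ =>
    exact .qfER hw hΓ hs ht hr hl h₁ fun B hB => ih₂ B hB hΔ

theorem Der.impI' {Γ : List Fm} {A B : Fm} (h : Der (NHA e) (A :: Γ) B) :
    Der (NHA e) Γ (.imp A B) :=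
  .impI (NHA.lang _ _) h

/-! ### Fresh variables -/

/-- A strict upper bound for the variables of a term. -/
def Tm.bd : Tm → ℕ
  | .var i => i + 1
  | .const _ => 0
  | .ap _ _ s t => max s.bd t.bd

/-- A strict upper bound for the free variables of a formula. -/
def Fm.bd : Fm → ℕ
  | .typ _ t => t.bd
  | .eq _ s t => max s.bd t.bd
  | .bot => 0
  | .and A B => max A.bd B.bd
  | .imp A B => max A.bd B.bd
  | .all A => A.bd - 1
  | .ex A => A.bd - 1

theorem Tm.subst_congr {t : Tm} {θ η : ℕ → Tm} (h : ∀ i < t.bd, θ i = η i) :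
    t.subst θ = t.subst η := by
  induction t with
  | var i => exact h i (Nat.lt_succ_self i)
  | const c => rfl
  | ap σ τ s t ihs iht =>
    simp only [Tm.bd, lt_max_iff] at h
    simp [ihs fun i hi => h i (.inl hi), iht fun i hi => h i (.inr hi)]

theorem Fm.subst_congr {A : Fm} {θ η : ℕ → Tm} (h : ∀ i < A.bd, θ i = η i) :
    A.subst θ = A.subst η := by
  have hup : ∀ {n : ℕ} {θ η : ℕ → Tm}, (∀ i < n - 1, θ i = η i) → ∀ i < n, up θ i = up η i := by
    intro n θ η h i hi
    rcases i with _ | i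
    · rfl
    · rw [up_succ, up_succ, h i (by omega)]
  induction A generalizing θ η with
  | typ τ t => rw [typ_subst, typ_subst, Tm.subst_congr h]
  | eq τ s t =>
    simp only [Fm.bd, lt_max_iff] at h
    rw [eq_subst, eq_subst, Tm.subst_congr fun i hi => h i (.inl hi),
      Tm.subst_congr fun i hi => h i (.inr hi)]
  | bot => rfl
  | and A B ihA ihB =>
    simp only [Fm.bd, lt_max_iff] at h
    rw [and_subst, and_subst, ihA fun i hi => h i (.inl hi), ihB fun i hi => h i (.inr hi)]
  | imp A B ihA ihB =>
    simp only [Fm.bd, lt_max_iff] at h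
    rw [imp_subst, imp_subst, ihA fun i hi => h i (.inl hi), ihB fun i hi => h i (.inr hi)]
  | all A ih => rw [all_subst, all_subst, ih (hup h)]
  | ex A ih => rw [ex_subst, ex_subst, ih (hup h)]

theorem exists_bd_le (Γ : List Fm) : ∃ k, ∀ B ∈ Γ, B.bd ≤ k := by
  induction Γ with
  | nil => exact ⟨0, by simp⟩
  | cons A Γ ih =>
    obtain ⟨k, hk⟩ := ih
    exact ⟨max A.bd k, by simp; exact fun B hB => .inr (hk B hB)⟩

/-- A context is finite, so some variable is fresh for it and for `A`. The instance at that variable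
is generic, and a renaming makes it the eigenvariable. -/
theorem Der.allI' {Γ : List Fm} {A : Fm} (h : ∀ t, Der (NHA e) Γ (A.inst t)) :
    Der (NHA e) Γ (.all A) := by
  obtain ⟨k, hk⟩ := exists_bd_le (.all A :: Γ)
  -- The fresh variable `k` becomes the innermost one and all others are shifted, which agrees with
  -- weakening on formulas in which `k` does not occur.
  have := (h (.var k)).rename fun i => if i = k then 0 else i + 1
  refine .allI ?_
  convert this using 1
  · refine List.map_congr_left fun B hB => Fm.subst_congr fun i hi => ?_
    have := hk B (List.mem_cons_of_mem _ hB)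
    simp [ren, show i ≠ k by omega]
  · rw [Fm.inst_subst]
    conv_lhs => rw [← A.subst_var]
    refine Fm.subst_congr fun i hi => ?_
    have := hk _ List.mem_cons_self
    rcases i with _ | i
    · simp [ren]
    · simp only [Fm.bd] at this
      simp [ren, show i ≠ k by omega]

/-! ### Connectives and quantifiers as conditions on extended contexts -/

theorem Der.allE' {Γ : List Fm} {A : Fm} (h : Der (NHA e) Γ (.all A)) (t : Tm) :
    Der (NHA e) Γ (A.inst t) :=
  .allE t (NHA.langT _ _) h

/-- The Kripke clause: the extension of `Γ` by `A` itself suffices for the converse. Together with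
the clauses below it replaces bookkeeping of hypotheses by quantification over larger contexts. -/
theorem Der.imp_iff {Γ : List Fm} {A B : Fm} :
    Der (NHA e) Γ (.imp A B) ↔ ∀ Δ, Γ ⊆ Δ → Der (NHA e) Δ A → Der (NHA e) Δ B :=
  ⟨fun h _ hΔ hA => .impE (h.mono hΔ) hA,
    fun h => .impI' (h _ (List.subset_cons_self _ _) (.hyp List.mem_cons_self))⟩

theorem Der.and_iff {Γ : List Fm} {A B : Fm} :
    Der (NHA e) Γ (.and A B) ↔ Der (NHA e) Γ A ∧ Der (NHA e) Γ B :=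
  ⟨fun h => ⟨h.andE₁, h.andE₂⟩, fun h => .andI h.1 h.2⟩

theorem Der.all_iff {Γ : List Fm} {A : Fm} :
    Der (NHA e) Γ (.all A) ↔ ∀ t, Der (NHA e) Γ (A.inst t) :=
  ⟨Der.allE', Der.allI'⟩

theorem Der.allT_iff {Γ : List Fm} {τ : Ty} {A : Fm} :
    Der (NHA e) Γ (.allT τ A) ↔
      ∀ Δ t, Γ ⊆ Δ → Der (NHA e) Δ (.typ τ t) → Der (NHA e) Δ (A.inst t) := by
  simp only [Fm.allT, Der.all_iff, Fm.inst, Fm.imp_subst, Der.imp_iff]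
  exact ⟨fun h Δ t hΔ => h t Δ hΔ, fun h t Δ hΔ => h Δ t hΔ⟩

theorem Der.of_all {Γ : List Fm} {A : Fm} (h : Der (NHA e) Γ (.all A)) :
    Der (NHA e) (Γ.map (Fm.wk 1)) A := by
  have := (h.wk 1).allE' (.var 0)
  rw [Fm.subst_up_inst] at this
  convert this using 1
  conv_lhs => rw [← A.subst_var]
  congr 1
  funext i
  cases i <;> rfl

/-- The continuation is available at every term, hence proves `∀ x (A → B)` with `B` weakened.
Reading this at the eigenvariable of the elimination rule gives `B`. -/
theorem Der.exE' {Γ : List Fm} {A B : Fm} (h : Der (NHA e) Γ (.ex A))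
    (hB : ∀ Δ t, Γ ⊆ Δ → Der (NHA e) Δ (A.inst t) → Der (NHA e) Δ B) : Der (NHA e) Γ B := by
  have h' : Der (NHA e) Γ (.all (.imp A (B.wk 1))) := by
    refine .allI' fun t => Der.imp_iff.2 fun Δ hΔ hA => ?_
    have := hB Δ t hΔ hA
    rwa [← B.wk_inst t] at this
  exact .exE h (.impE (h'.of_all.mono (List.subset_cons_self _ _)) (.hyp List.mem_cons_self))

theorem Der.exT_elim {Γ : List Fm} {τ : Ty} {A B : Fm} (h : Der (NHA e) Γ (.exT τ A))
    (hB : ∀ Δ t, Γ ⊆ Δ → Der (NHA e) Δ (.typ τ t) → Der (NHA e) Δ (A.inst t) → Der (NHA e) Δ B) :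
    Der (NHA e) Γ B :=
  h.exE' fun Δ t hΔ hA => hB Δ t hΔ hA.andE₁ hA.andE₂

theorem Der.exT_intro {Γ : List Fm} {τ : Ty} {A : Fm} (t : Tm) (ht : Der (NHA e) Γ (.typ τ t))
    (h : Der (NHA e) Γ (A.inst t)) : Der (NHA e) Γ (.exT τ A) :=
  .exI t (.andI ht h)

theorem Der.exfalso {Γ : List Fm} {A : Fm} (h : Der (NHA e) Γ .bot) : Der (NHA e) Γ A :=
  .botE (NHA.lang _ _) h

/-! ### Closure under substitution -/

/-- A substitution that is a renaming from index `n` on is a renaming followed by `n` single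
instantiations. Each of these is a generalisation and an instantiation, which is unproblematic
because the context is empty. -/
theorem Der.subst_nil_aux {A : Fm} (h : Der (NHA e) [] A) (n : ℕ) (θ : ℕ → Tm)
    (hθ : ∀ i, ∃ j, θ (n + i) = .var j) : Der (NHA e) [] (A.subst θ) := by
  induction n generalizing θ with
  | zero =>
    choose ρ hρ using hθ
    obtain rfl : θ = ren ρ := by
      funext i; rw [← Nat.zero_add i, hρ, ren]; simp
    exact h.rename ρ
  | succ n ih =>
    -- The variable `n` is kept as the innermost variable and everything else is moved out of its
    -- way; generalising over it and instantiating with `θ n` restores `θ`.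
    have h₁ := ih (fun i => if i = n then .var 0 else (θ i).wk 1) fun i => by
      rcases i with _ | i
      · exact ⟨0, by simp⟩
      · obtain ⟨j, hj⟩ := hθ i
        refine ⟨j + 1, ?_⟩
        rw [if_neg (by omega), show n + (i + 1) = n + 1 + i by omega, hj]
        rfl
    have h₂ := (Der.allI (Γ := []) h₁).allE' (θ n)
    convert h₂ using 1
    rw [Fm.inst, Fm.subst_subst]
    congr 1
    funext i
    split_ifs with hi
    · subst hi; rfl
    · simp

theorem Der.subst_nil {A : Fm} (h : Der (NHA e) [] A) (θ : ℕ → Tm) :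
    Der (NHA e) [] (A.subst θ) := by
  have := h.subst_nil_aux A.bd (fun i => if i < A.bd then θ i else .var i)
    fun i => ⟨_, if_neg (by omega)⟩
  rwa [Fm.subst_congr (η := θ) fun i hi => if_pos hi] at this

/-- The hypotheses are discharged into implications, the closed sequent is substituted, and the
implications are then applied to the given derivations. -/
theorem Der.subst {Γ Δ : List Fm} {A : Fm} (h : Der (NHA e) Γ A) (θ : ℕ → Tm)
    (hΔ : ∀ B ∈ Γ, Der (NHA e) Δ (B.subst θ)) : Der (NHA e) Δ (A.subst θ) := by
  induction Γ generalizing A with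
  | nil => exact (h.subst_nil θ).mono (List.nil_subset _)
  | cons B Γ ih =>
    exact .impE (ih h.impI' fun C hC => hΔ C (List.mem_cons_of_mem _ hC))
      (hΔ B List.mem_cons_self)

/-! ## Equality and the constants -/

theorem Der.ax {Γ Δ : List Fm} {A : Fm} (h : Ax Fm.eq Δ A) (hΔ : ∀ B ∈ Δ, Der (NHA e) Γ B) :
    Der (NHA e) Γ A :=
  .nonlog h (NHA.lang _ _) hΔ

section
variable {Γ Δ : List Fm}

theorem Der.ty_const (c : Ct) : Der (NHA e) Γ (.typ c.ty (.const c)) :=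
  .ax (.tyConst c) (by simp)

theorem Der.ty_ap {σ τ : Ty} {f x : Tm} (hf : Der (NHA e) Γ (.typ (.arr σ τ) f))
    (hx : Der (NHA e) Γ (.typ σ x)) : Der (NHA e) Γ (.typ τ (.ap σ τ f x)) :=
  .ax (.tyAp σ τ f x) (by simp [hf, hx])

theorem Der.refl {τ : Ty} {x : Tm} (hx : Der (NHA e) Γ (.typ τ x)) :
    Der (NHA e) Γ (.eq τ x x) :=
  .ax (.eqRefl τ x) (by simp [hx])

theorem Der.repl {τ : Ty} {x y : Tm} (A : Fm) (h : Der (NHA e) Γ (.eq τ x y))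
    (hA : Der (NHA e) Γ (A.inst x)) : Der (NHA e) Γ (A.inst y) :=
  .ax (.eqRepl τ x y A) (by simp [h, hA])

theorem Der.symm {τ : Ty} {x y : Tm} (h : Der (NHA e) Γ (.eq τ x y))
    (hx : Der (NHA e) Γ (.typ τ x)) : Der (NHA e) Γ (.eq τ y x) := by
  have := h.repl (.eq τ (.var 0) (x.wk 1)) (by simpa [Fm.inst] using hx.refl)
  simpa [Fm.inst] using this

theorem Der.trans {τ : Ty} {x y z : Tm} (h : Der (NHA e) Γ (.eq τ x y))
    (h' : Der (NHA e) Γ (.eq τ y z)) : Der (NHA e) Γ (.eq τ x z) := by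
  have := h'.repl (.eq τ (x.wk 1) (.var 0)) (by simpa [Fm.inst] using h)
  simpa [Fm.inst] using this

theorem Der.ty_of_eq {τ σ : Ty} {x y : Tm} (h : Der (NHA e) Γ (.eq τ x y))
    (hx : Der (NHA e) Γ (.typ σ x)) : Der (NHA e) Γ (.typ σ y) :=
  h.repl (.typ σ (.var 0)) hx

theorem Der.congr_tm {σ τ : Ty} {x y : Tm} (t : Tm) (h : Der (NHA e) Γ (.eq σ x y))
    (ht : Der (NHA e) Γ (.typ τ (t.subst (single x)))) :
    Der (NHA e) Γ (.eq τ (t.subst (single x)) (t.subst (single y))) := by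
  have := h.repl (.eq τ ((t.subst (single x)).wk 1) t) (by simpa [Fm.inst] using ht.refl)
  simpa [Fm.inst] using this

theorem Der.congr_fun {σ τ : Ty} {f g x : Tm} (h : Der (NHA e) Γ (.eq (.arr σ τ) f g))
    (hf : Der (NHA e) Γ (.typ (.arr σ τ) f)) (hx : Der (NHA e) Γ (.typ σ x)) :
    Der (NHA e) Γ (.eq τ (.ap σ τ f x) (.ap σ τ g x)) := by
  have := h.congr_tm (τ := τ) (.ap σ τ (.var 0) (x.wk 1)) (by simpa using hf.ty_ap hx)
  simpa using this

theorem Der.congr_arg {σ τ : Ty} {f x y : Tm} (h : Der (NHA e) Γ (.eq σ x y))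
    (hf : Der (NHA e) Γ (.typ (.arr σ τ) f)) (hx : Der (NHA e) Γ (.typ σ x)) :
    Der (NHA e) Γ (.eq τ (.ap σ τ f x) (.ap σ τ f y)) := by
  have := h.congr_tm (τ := τ) (.ap σ τ (f.wk 1) (.var 0)) (by simpa using hf.ty_ap hx)
  simpa using this

/-- Derivability of the typings of a tuple of terms. -/
def Typs (e : Bool) (Γ : List Fm) (τs : List Ty) (xs : List Tm) : Prop :=
  List.Forall₂ (fun τ x => Der (NHA e) Γ (.typ τ x)) τs xs

theorem Typs.mono {τs : List Ty} {xs : List Tm} (h : Typs e Γ τs xs) (hΔ : Γ ⊆ Δ) :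
    Typs e Δ τs xs :=
  List.Forall₂.imp (fun _ _ h => h.mono hΔ) h

theorem Typs.length {τs : List Ty} {xs : List Tm} (h : Typs e Γ τs xs) :
    xs.length = τs.length :=
  (List.Forall₂.length_eq h).symm

theorem Typs.append {σs τs : List Ty} {xs ys : List Tm} (h : Typs e Γ σs xs)
    (h' : Typs e Γ τs ys) : Typs e Γ (σs ++ τs) (xs ++ ys) :=
  List.rel_append h h'

theorem Typs.of_append {σs τs : List Ty} {xs : List Tm} (h : Typs e Γ (σs ++ τs) xs) :
    ∃ ys zs, xs = ys ++ zs ∧ Typs e Γ σs ys ∧ Typs e Γ τs zs := by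
  refine ⟨xs.take σs.length, xs.drop σs.length, by simp, ?_, ?_⟩
  · simpa [Typs] using List.forall₂_take σs.length h
  · simpa [Typs] using List.forall₂_drop σs.length h

theorem Typs.nil : Typs e Γ [] [] := List.Forall₂.nil

theorem Typs.cons {σ : Ty} {τs : List Ty} {x : Tm} {xs : List Tm}
    (hx : Der (NHA e) Γ (.typ σ x)) (h : Typs e Γ τs xs) : Typs e Γ (σ :: τs) (x :: xs) :=
  List.Forall₂.cons hx h

theorem Der.ty_apT {ρs : List Ty} {σ : Ty} {t : Tm} {xs : List Tm}
    (ht : Der (NHA e) Γ (.typ (arrs ρs σ) t)) (hx : Typs e Γ ρs xs) :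
    Der (NHA e) Γ (.typ σ (apT ρs σ t xs)) := by
  induction hx generalizing t with
  | nil => exact ht
  | cons h _ ih => exact ih (ht.ty_ap h)

theorem Der.congr_apT {ρs : List Ty} {σ : Ty} {t t' : Tm} {xs : List Tm}
    (h : Der (NHA e) Γ (.eq (arrs ρs σ) t t'))
    (ht : Der (NHA e) Γ (.typ (arrs ρs σ) t)) (hx : Typs e Γ ρs xs) :
    Der (NHA e) Γ (.eq σ (apT ρs σ t xs) (apT ρs σ t' xs)) := by
  induction hx generalizing t t' with
  | nil => exact h
  | cons hx _ ih => exact ih (h.congr_fun ht hx) (ht.ty_ap hx)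

/-! ### Typing and defining equations of the constants; case distinction and induction -/

theorem Der.ty_nil (σ : Ty) : Der (NHA e) Γ (.typ (.star σ) (nilT σ)) := .ty_const (.nil σ)

theorem Der.ty_zero : Der (NHA e) Γ (.typ .nat zeroT) := .ty_const .zero

theorem Der.ty_tt : Der (NHA e) Γ (.typ .bool (.const .tt)) := .ty_const .tt

theorem Der.ty_ff : Der (NHA e) Γ (.typ .bool (.const .ff)) := .ty_const .ff

theorem Der.ty_suc {n : Tm} (h : Der (NHA e) Γ (.typ .nat n)) :
    Der (NHA e) Γ (.typ .nat (sucT n)) :=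
  (Der.ty_const .suc).ty_ap h

theorem Der.ty_cons {σ : Ty} {x u : Tm} (hx : Der (NHA e) Γ (.typ σ x))
    (hu : Der (NHA e) Γ (.typ (.star σ) u)) :
    Der (NHA e) Γ (.typ (.star σ) (consT σ x u)) :=
  ((Der.ty_const (.cons σ)).ty_ap hx).ty_ap hu

theorem Der.ty_seqRec {σ ρ : Ty} {u y z : Tm} (hu : Der (NHA e) Γ (.typ (.star σ) u))
    (hy : Der (NHA e) Γ (.typ ρ y)) (hz : Der (NHA e) Γ (.typ (.arr σ (.arr ρ ρ)) z)) :
    Der (NHA e) Γ (.typ ρ (seqRecT σ ρ u y z)) :=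
  (((Der.ty_const (.L σ ρ)).ty_ap hu).ty_ap hy).ty_ap hz

theorem Der.ty_rec {σ : Ty} {n y z : Tm} (hn : Der (NHA e) Γ (.typ .nat n))
    (hy : Der (NHA e) Γ (.typ σ y)) (hz : Der (NHA e) Γ (.typ (.arr .nat (.arr σ σ)) z)) :
    Der (NHA e) Γ (.typ σ (recT σ n y z)) :=
  (((Der.ty_const (.R σ)).ty_ap hn).ty_ap hy).ty_ap hz

theorem Der.ty_append {σ : Ty} {u v : Tm} (hu : Der (NHA e) Γ (.typ (.star σ) u))
    (hv : Der (NHA e) Γ (.typ (.star σ) v)) :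
    Der (NHA e) Γ (.typ (.star σ) (appendT σ u v)) :=
  hu.ty_seqRec hv (.ty_const (.cons σ))

theorem Der.seqRec_nil {σ ρ : Ty} {y z : Tm} (hy : Der (NHA e) Γ (.typ ρ y))
    (hz : Der (NHA e) Γ (.typ (.arr σ (.arr ρ ρ)) z)) :
    Der (NHA e) Γ (.eq ρ (seqRecT σ ρ (nilT σ) y z) y) :=
  .ax (.seqRecNil σ ρ y z) (by simp [hy, hz])

theorem Der.seqRec_cons {σ ρ : Ty} {x u y z : Tm} (hx : Der (NHA e) Γ (.typ σ x))
    (hu : Der (NHA e) Γ (.typ (.star σ) u))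
    (hy : Der (NHA e) Γ (.typ ρ y)) (hz : Der (NHA e) Γ (.typ (.arr σ (.arr ρ ρ)) z)) :
    Der (NHA e) Γ (.eq ρ (seqRecT σ ρ (consT σ x u) y z)
      (.ap ρ ρ (.ap σ (.arr ρ ρ) z x) (seqRecT σ ρ u y z))) :=
  .ax (.seqRecCons σ ρ x u y z) (by simp [hx, hu, hy, hz])

theorem Der.append_nil {σ : Ty} {v : Tm} (hv : Der (NHA e) Γ (.typ (.star σ) v)) :
    Der (NHA e) Γ (.eq (.star σ) (appendT σ (nilT σ) v) v) :=
  hv.seqRec_nil (.ty_const (.cons σ))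

theorem Der.append_cons {σ : Ty} {x u v : Tm} (hx : Der (NHA e) Γ (.typ σ x))
    (hu : Der (NHA e) Γ (.typ (.star σ) u)) (hv : Der (NHA e) Γ (.typ (.star σ) v)) :
    Der (NHA e) Γ
      (.eq (.star σ) (appendT σ (consT σ x u) v) (consT σ x (appendT σ u v))) :=
  hx.seqRec_cons hu hv (.ty_const (.cons σ))

theorem Der.bool_ind (A : Fm) {z : Tm} (h₁ : Der (NHA e) Γ (A.inst (.const .tt)))
    (h₂ : Der (NHA e) Γ (A.inst (.const .ff))) (hz : Der (NHA e) Γ (.typ .bool z)) :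
    Der (NHA e) Γ (A.inst z) :=
  .ax (.boolCases A z) (by simp [h₁, h₂, hz])

/-- The axiom is applied to `z = · → C`, so that each case may use the equation; reflexivity at `z`
then releases `C`. -/
theorem Der.bool_cases {C : Fm} {z : Tm} (hz : Der (NHA e) Γ (.typ .bool z))
    (h₁ : ∀ Δ, Γ ⊆ Δ → Der (NHA e) Δ (.eq .bool z (.const .tt)) → Der (NHA e) Δ C)
    (h₂ : ∀ Δ, Γ ⊆ Δ → Der (NHA e) Δ (.eq .bool z (.const .ff)) → Der (NHA e) Δ C) :
    Der (NHA e) Γ C := by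
  have := Der.bool_ind (.imp (.eq .bool (z.wk 1) (.var 0)) (C.wk 1)) (z := z) (Γ := Γ) (e := e)
    (by simpa [Fm.inst, Fm.wk_subst, Der.imp_iff] using h₁)
    (by simpa [Fm.inst, Fm.wk_subst, Der.imp_iff] using h₂) hz
  simp only [Fm.inst, Fm.imp_subst, Fm.eq_subst, Tm.wk_subst_single, Tm.var_subst,
    single_zero] at this
  rw [← Fm.inst, Fm.wk_inst] at this
  exact this.impE hz.refl

theorem Der.nat_ind (A : Fm) {n : Tm} (h₁ : Der (NHA e) Γ (A.inst zeroT))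
    (h₂ : ∀ Δ n, Γ ⊆ Δ → Der (NHA e) Δ (.typ .nat n) → Der (NHA e) Δ (A.inst n) →
      Der (NHA e) Δ (A.inst (sucT n)))
    (hn : Der (NHA e) Γ (.typ .nat n)) : Der (NHA e) Γ (A.inst n) := by
  refine Der.allT_iff.1 (Der.ax (.ind A) ?_) Γ n (List.Subset.refl _) hn
  simp only [List.mem_cons, List.not_mem_nil, or_false, forall_eq_or_imp, forall_eq]
  refine ⟨h₁, Der.allT_iff.2 fun Δ n hΔ hn => ?_⟩
  rw [Fm.inst, Fm.imp_subst, Der.imp_iff]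
  intro Δ' hΔ' h
  have := h₂ Δ' n (List.Subset.trans hΔ hΔ') (hn.mono hΔ') h
  rw [Fm.subst_subst]
  rw [Fm.inst] at this
  convert this using 2
  funext i
  cases i <;> rfl

theorem Der.seq_ind {σ : Ty} (A : Fm) {t : Tm} (h₁ : Der (NHA e) Γ (A.inst (nilT σ)))
    (h₂ : ∀ Δ x u, Γ ⊆ Δ → Der (NHA e) Δ (.typ σ x) → Der (NHA e) Δ (.typ (.star σ) u) →
      Der (NHA e) Δ (A.inst u) → Der (NHA e) Δ (A.inst (consT σ x u)))
    (ht : Der (NHA e) Γ (.typ (.star σ) t)) : Der (NHA e) Γ (A.inst t) := by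
  refine Der.allT_iff.1 (Der.ax (.seqInd σ A) ?_) Γ t (List.Subset.refl _) ht
  simp only [List.mem_cons, List.not_mem_nil, or_false, forall_eq_or_imp, forall_eq]
  refine ⟨h₁, Der.allT_iff.2 fun Δ x hΔ hx => ?_⟩
  rw [Fm.inst, Fm.allT_subst, Der.allT_iff]
  intro Δ' u hΔ' hu
  rw [Fm.imp_subst, Fm.inst, Fm.imp_subst, Der.imp_iff]
  intro Δ'' hΔ'' h
  have := h₂ Δ'' x u (List.Subset.trans (List.Subset.trans hΔ hΔ') hΔ'')
    (hx.mono (List.Subset.trans hΔ' hΔ'')) (hu.mono hΔ'')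
  simp only [Fm.subst_subst, Fm.inst] at h this ⊢
  convert this ?_ using 2
  · funext i
    cases i <;> simp
  · convert h using 2
    funext i
    cases i <;> simp

/-- Sequence induction on `a = · → C` with the induction hypothesis discarded, released by
reflexivity at `a`. -/
theorem Der.star_cases {σ : Ty} {C : Fm} {a : Tm} (ha : Der (NHA e) Γ (.typ (.star σ) a))
    (h₁ : ∀ Δ, Γ ⊆ Δ → Der (NHA e) Δ (.eq (.star σ) a (nilT σ)) → Der (NHA e) Δ C)
    (h₂ : ∀ Δ x u, Γ ⊆ Δ → Der (NHA e) Δ (.typ σ x) → Der (NHA e) Δ (.typ (.star σ) u) →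
      Der (NHA e) Δ (.eq (.star σ) a (consT σ x u)) → Der (NHA e) Δ C) :
    Der (NHA e) Γ C := by
  have key : ∀ t, (Fm.imp (.eq (.star σ) (a.wk 1) (.var 0)) (C.wk 1)).inst t =
      .imp (.eq (.star σ) a t) C := by
    intro t
    have := C.wk_inst t
    simp_all [Fm.inst]
  have := Der.seq_ind (e := e) (Γ := Γ) (.imp (.eq (.star σ) (a.wk 1) (.var 0)) (C.wk 1)) (t := a)
    (by rw [key, Der.imp_iff]; exact h₁)
    (by
      intro Δ x u hΔ hx hu _
      rw [key, Der.imp_iff]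
      exact fun Δ' hΔ' h => h₂ Δ' x u (List.Subset.trans hΔ hΔ') (hx.mono hΔ') (hu.mono hΔ') h) ha
  rw [key] at this
  exact this.impE ha.refl

theorem Der.tt_ne_ff (h : Der (NHA e) Γ (.eq .bool (.const .tt) (.const .ff))) :
    Der (NHA e) Γ .bot :=
  (Der.ax .boolNe (by simp)).impE h

theorem Der.combK {σ τ : Ty} {x y : Tm} (hx : Der (NHA e) Γ (.typ σ x))
    (hy : Der (NHA e) Γ (.typ τ y)) :
    Der (NHA e) Γ (.eq σ (.ap τ σ (.ap σ (.arr τ σ) (.const (.K σ τ)) x) y) x) :=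
  .ax (.combK σ τ x y) (by simp [hx, hy])

theorem Der.ty_K {σ : Ty} (τ : Ty) {x : Tm} (hx : Der (NHA e) Γ (.typ σ x)) :
    Der (NHA e) Γ (.typ (.arr τ σ) (.ap σ (.arr τ σ) (.const (.K σ τ)) x)) :=
  (Der.ty_const (.K σ τ)).ty_ap hx

theorem Der.combS {σ τ ρ : Ty} {x y z : Tm} (hx : Der (NHA e) Γ (.typ (.arr σ (.arr τ ρ)) x))
    (hy : Der (NHA e) Γ (.typ (.arr σ τ) y)) (hz : Der (NHA e) Γ (.typ σ z)) :
    Der (NHA e) Γ (.eq ρ (.ap σ ρ (.ap (.arr σ τ) (.arr σ ρ)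
        (.ap (.arr σ (.arr τ ρ)) (.arr (.arr σ τ) (.arr σ ρ)) (.const (.S σ τ ρ)) x) y) z)
      (.ap τ ρ (.ap σ (.arr τ ρ) x z) (.ap σ τ y z))) :=
  .ax (.combS σ τ ρ x y z) (by simp [hx, hy, hz])

/-- No axiom separates the two kinds of sequences. A sequence recursion into the booleans, with
value `F` at the empty sequence and constant step `T`, does, and reduces the claim to `T ≠ F`. -/
theorem Der.cons_ne_nil {σ : Ty} {x u : Tm} (hx : Der (NHA e) Γ (.typ σ x))
    (hu : Der (NHA e) Γ (.typ (.star σ) u))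
    (h : Der (NHA e) Γ (.eq (.star σ) (consT σ x u) (nilT σ))) : Der (NHA e) Γ .bot := by
  let k : Tm := .ap .bool (.arr .bool .bool) (.const (.K .bool .bool)) (.const .tt)
  have hk : Der (NHA e) Γ (.typ (.arr .bool .bool) k) := Der.ty_tt.ty_K _
  let z : Tm := .ap (.arr .bool .bool) (.arr σ (.arr .bool .bool))
    (.const (.K (.arr .bool .bool) σ)) k
  have hz : Der (NHA e) Γ (.typ (.arr σ (.arr .bool .bool)) z) := hk.ty_K _
  have hr : ∀ {v}, Der (NHA e) Γ (.typ (.star σ) v) →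
      Der (NHA e) Γ (.typ .bool (seqRecT σ .bool v (.const .ff) z)) :=
    fun hv => hv.ty_seqRec .ty_ff hz
  have h₁ : Der (NHA e) Γ (.eq .bool (seqRecT σ .bool (consT σ x u) (.const .ff) z)
      (.const .tt)) :=
    (hx.seqRec_cons hu .ty_ff hz).trans
      (((hk.combK hx).congr_fun (hz.ty_ap hx) (hr hu)).trans (Der.ty_tt.combK (hr hu)))
  have h₂ := h.congr_tm (τ := .bool) (seqRecT σ .bool (.var 0) (.const .ff) z)
    (hr (hx.ty_cons hu))
  have h₂ : Der (NHA e) Γ (.eq .bool (seqRecT σ .bool (consT σ x u) (.const .ff) z)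
    (seqRecT σ .bool (nilT σ) (.const .ff) z)) := h₂
  exact ((h₁.symm (hr (hx.ty_cons hu))).trans (h₂.trans (Der.seqRec_nil .ty_ff hz))).tt_ne_ff

/-! ## Membership -/

theorem Tm.wk_two_subst_up_single (t s : Tm) : (t.wk 2).subst (up (single s)) = t.wk 1 := by
  simp [Tm.wk]

theorem Der.mem_intro {τ : Ty} {x a u v : Tm} (hu : Der (NHA e) Γ (.typ (.star τ) u))
    (hv : Der (NHA e) Γ (.typ (.star τ) v))
    (h : Der (NHA e) Γ (.eq (.star τ) a (appendT τ u (consT τ x v)))) :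
    Der (NHA e) Γ (.mem τ x a) := by
  refine .exT_intro u hu (.exT_intro v hv ?_)
  simpa [Fm.inst, Tm.wk_two_subst_up_single, Tm.wk_subst_single] using h

theorem Der.mem_elim {τ : Ty} {x a : Tm} {C : Fm} (h : Der (NHA e) Γ (.mem τ x a))
    (hC : ∀ Δ u v, Γ ⊆ Δ → Der (NHA e) Δ (.typ (.star τ) u) →
      Der (NHA e) Δ (.typ (.star τ) v) →
      Der (NHA e) Δ (.eq (.star τ) a (appendT τ u (consT τ x v))) → Der (NHA e) Δ C) :
    Der (NHA e) Γ C := by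
  refine h.exT_elim fun Δ u hΔ hu h => Der.exT_elim h fun Δ' v hΔ' hv h => ?_
  refine hC Δ' u v (List.Subset.trans hΔ hΔ') (hu.mono hΔ') hv ?_
  simpa [Fm.inst, Tm.wk_two_subst_up_single, Tm.wk_subst_single] using h

theorem Der.mem_of_eq {τ σ : Ty} {x a b : Tm} (h : Der (NHA e) Γ (.mem τ x a))
    (hab : Der (NHA e) Γ (.eq σ a b)) : Der (NHA e) Γ (.mem τ x b) := by
  have := hab.repl (.mem τ (x.wk 1) (.var 0)) (by simpa [Fm.inst] using h)
  simpa [Fm.inst] using this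

theorem Der.mem_cons_self {τ : Ty} {x a : Tm} (hx : Der (NHA e) Γ (.typ τ x))
    (ha : Der (NHA e) Γ (.typ (.star τ) a)) : Der (NHA e) Γ (.mem τ x (consT τ x a)) :=
  .mem_intro (.ty_nil τ) ha ((Der.append_nil (hx.ty_cons ha)).symm
    ((Der.ty_nil τ).ty_append (hx.ty_cons ha)))

theorem Der.mem_cons {τ : Ty} {x y a : Tm} (hx : Der (NHA e) Γ (.typ τ x))
    (hy : Der (NHA e) Γ (.typ τ y)) (ha : Der (NHA e) Γ (.typ (.star τ) a))
    (h : Der (NHA e) Γ (.mem τ x a)) : Der (NHA e) Γ (.mem τ x (consT τ y a)) := by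
  refine h.mem_elim fun Δ u v hΔ hu hv h => ?_
  have hy := hy.mono hΔ
  have hxv := (hx.mono hΔ).ty_cons hv
  refine .mem_intro (hy.ty_cons hu) hv (Der.trans ?_ ((hy.append_cons hu hxv).symm
    ((hy.ty_cons hu).ty_append hxv)))
  have := h.congr_tm (τ := .star τ) (consT τ (y.wk 1) (.var 0))
    (by simpa using hy.ty_cons (ha.mono hΔ))
  simpa using this

/-- To prove something about a sequence `a` containing `x`, prove it for sequences with head `x`
and show that it is preserved by prefixing. -/
theorem Der.mem_ind {τ : Ty} {x a : Tm} (A : Fm) (hx : Der (NHA e) Γ (.typ τ x))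
    (h : Der (NHA e) Γ (.mem τ x a)) (ha : Der (NHA e) Γ (.typ (.star τ) a))
    (h₁ : ∀ Δ v, Γ ⊆ Δ → Der (NHA e) Δ (.typ (.star τ) v) →
      Der (NHA e) Δ (A.inst (consT τ x v)))
    (h₂ : ∀ Δ y u, Γ ⊆ Δ → Der (NHA e) Δ (.typ τ y) → Der (NHA e) Δ (.typ (.star τ) u) →
      Der (NHA e) Δ (A.inst u) → Der (NHA e) Δ (A.inst (consT τ y u))) :
    Der (NHA e) Γ (A.inst a) := by
  -- Membership gives `a = u * ⟨x⟩ * v`. The induction runs over the prefix `u`, the tail `⟨x⟩ * v`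
  -- being fixed.
  refine h.mem_elim fun Δ u v hΔ hu hv h => ?_
  have hxv := (hx.mono hΔ).ty_cons hv
  have key : ∀ t, (A.subst (scons (appendT τ (.var 0) ((consT τ x v).wk 1))
      fun i => .var (i + 1))).inst t = A.inst (appendT τ t (consT τ x v)) := by
    intro t
    rw [Fm.inst, Fm.subst_subst, Fm.inst]
    congr 1
    funext i
    cases i <;> simp
  refine (h.symm (ha.mono hΔ)).repl A ?_
  rw [← key]
  refine Der.seq_ind _ ?_ ?_ hu
  · rw [key]
    exact ((Der.append_nil hxv).symm ((Der.ty_nil τ).ty_append hxv)).repl A (h₁ Δ v hΔ hv)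
  · intro Δ' y u hΔ' hy hu h
    rw [key] at h ⊢
    have hxv := hxv.mono hΔ'
    exact ((hy.append_cons hu hxv).symm ((hy.ty_cons hu).ty_append hxv)).repl A
      (h₂ Δ' y _ (List.Subset.trans hΔ hΔ') hy (hu.ty_append hxv) h)

theorem Der.mem_append_right {τ : Ty} {x a b : Tm} (hx : Der (NHA e) Γ (.typ τ x))
    (ha : Der (NHA e) Γ (.typ (.star τ) a)) (hb : Der (NHA e) Γ (.typ (.star τ) b))
    (h : Der (NHA e) Γ (.mem τ x b)) : Der (NHA e) Γ (.mem τ x (appendT τ a b)) := by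
  have key : ∀ t, (Fm.mem τ (x.wk 1) (appendT τ (.var 0) (b.wk 1))).inst t =
      .mem τ x (appendT τ t b) := by
    intro t; simp [Fm.inst]
  rw [← key]
  refine Der.seq_ind _ ?_ ?_ ha
  · rw [key]
    exact h.mem_of_eq ((Der.append_nil hb).symm ((Der.ty_nil τ).ty_append hb))
  · intro Δ y u hΔ hy hu h
    rw [key] at h ⊢
    have hb := hb.mono hΔ
    exact (Der.mem_cons (hx.mono hΔ) hy (hu.ty_append hb) h).mem_of_eq
      ((hy.append_cons hu hb).symm ((hy.ty_cons hu).ty_append hb))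

theorem Der.mem_append_left {τ : Ty} {x a b : Tm} (hx : Der (NHA e) Γ (.typ τ x))
    (ha : Der (NHA e) Γ (.typ (.star τ) a)) (hb : Der (NHA e) Γ (.typ (.star τ) b))
    (h : Der (NHA e) Γ (.mem τ x a)) : Der (NHA e) Γ (.mem τ x (appendT τ a b)) := by
  have key : ∀ t, (Fm.mem τ (x.wk 1) (appendT τ (.var 0) (b.wk 1))).inst t =
      .mem τ x (appendT τ t b) := by
    intro t; simp [Fm.inst]
  rw [← key]
  refine Der.mem_ind _ hx h ha ?_ ?_
  · intro Δ v hΔ hv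
    rw [key]
    have hx := hx.mono hΔ
    have hb := hb.mono hΔ
    exact (Der.mem_cons_self hx (hv.ty_append hb)).mem_of_eq
      ((hx.append_cons hv hb).symm ((hx.ty_cons hv).ty_append hb))
  · intro Δ y u hΔ hy hu h
    rw [key] at h ⊢
    have hb := hb.mono hΔ
    exact (Der.mem_cons (hx.mono hΔ) hy (hu.ty_append hb) h).mem_of_eq
      ((hy.append_cons hu hb).symm ((hy.ty_cons hu).ty_append hb))

/-- Being nonempty holds of sequences with head `x` and survives prefixing, so it passes to every
sequence containing `x`. -/
theorem Der.not_mem_nil {τ : Ty} {x : Tm} (hx : Der (NHA e) Γ (.typ τ x))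
    (h : Der (NHA e) Γ (.mem τ x (nilT τ))) : Der (NHA e) Γ .bot := by
  have := Der.mem_ind (.imp (.eq (.star τ) (.var 0) (nilT τ)) .bot) hx h (.ty_nil τ)
    (fun Δ v hΔ hv => Der.imp_iff.2 fun Δ' hΔ' h =>
      Der.cons_ne_nil (hx.mono (List.Subset.trans hΔ hΔ')) (hv.mono hΔ') h)
    (fun Δ y u hΔ hy hu _ => Der.imp_iff.2 fun Δ' hΔ' h =>
      Der.cons_ne_nil (hy.mono hΔ') (hu.mono hΔ') h)
  exact this.impE (Der.ty_nil τ).refl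

end

/-! ## Definable functions -/

/-- The substitution of the terms `xs` for the variables `0, 1, …`. -/
def env (xs : List Tm) : ℕ → Tm := fun i => xs.getD i zeroT

/-- Well-typed terms, the variable `i` being of type `σs[i]`. -/
inductive Typed (σs : List Ty) : Tm → Ty → Prop
  | var {i : ℕ} {σ : Ty} : σs[i]? = some σ → Typed σs (.var i) σ
  | const (c : Ct) : Typed σs (.const c) c.ty
  | ap {σ τ : Ty} {s t : Tm} : Typed σs s (.arr σ τ) → Typed σs t σ → Typed σs (.ap σ τ s t) τ

theorem Typed.subst {σs ρs : List Ty} {t : Tm} {τ : Ty} {θ : ℕ → Tm} (h : Typed σs t τ)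
    (hθ : ∀ i σ, σs[i]? = some σ → Typed ρs (θ i) σ) : Typed ρs (t.subst θ) τ := by
  induction h with
  | var h => exact hθ _ _ h
  | const c => exact .const c
  | ap _ _ ih₁ ih₂ => exact .ap ih₁ ih₂

theorem Typed.subst_congr {σs : List Ty} {t : Tm} {τ : Ty} {θ η : ℕ → Tm} (h : Typed σs t τ)
    (hθ : ∀ i < σs.length, θ i = η i) : t.subst θ = t.subst η := by
  induction h with
  | var h => exact hθ _ (List.getElem?_eq_some_iff.1 h).1
  | const c => rfl
  | ap _ _ ih₁ ih₂ => simp [ih₁, ih₂]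

theorem Typed.closed {t : Tm} {τ : Ty} (h : Typed [] t τ) : t.Closed := by
  induction h with
  | var h => simp at h
  | const c => trivial
  | ap _ _ ih₁ ih₂ => exact ⟨ih₁, ih₂⟩

theorem Typed.subst_nil {t : Tm} {τ : Ty} (h : Typed [] t τ) (θ : ℕ → Tm) : t.subst θ = t := by
  conv_rhs => rw [← t.subst_var]
  exact h.subst_congr (by simp)

theorem Typs.env {Γ : List Fm} {σs : List Ty} {xs : List Tm} (h : Typs e Γ σs xs) {i : ℕ} {σ : Ty}
    (hi : σs[i]? = some σ) : Der (NHA e) Γ (.typ σ (env xs i)) := by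
  induction h generalizing i with
  | nil => simp at hi
  | cons hx _ ih =>
    rcases i with _ | i
    · obtain rfl : _ = σ := by simpa using hi
      exact hx
    · exact ih (by simpa using hi)

theorem Typed.ty {Γ : List Fm} {σs : List Ty} {xs : List Tm} {t : Tm} {τ : Ty}
    (h : Typed σs t τ) (hx : Typs e Γ σs xs) : Der (NHA e) Γ (.typ τ (t.subst (env xs))) := by
  induction h with
  | var h => exact hx.env h
  | const c => exact .ty_const c
  | ap _ _ ih₁ ih₂ => exact ih₁.ty_ap ih₂

/-- Bracket abstraction `λ x_n. t` for `t` of type `τ` and the variable `n` of type `α`. -/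
def lamAt (n : ℕ) (α : Ty) : Ty → Tm → Tm
  | τ, .var i =>
      if i = n then
        -- The abstracted variable itself yields the identity `S K K`.
        .ap (.arr α (.arr α α)) (.arr α α)
          (.ap (.arr α (.arr (.arr α α) α)) (.arr (.arr α (.arr α α)) (.arr α α))
            (.const (.S α (.arr α α) α)) (.const (.K α (.arr α α)))) (.const (.K α α))
      else .ap τ (.arr α τ) (.const (.K τ α)) (.var i)
  | τ, .const c => .ap τ (.arr α τ) (.const (.K τ α)) (.const c)
  | _, .ap σ τ s t =>
      .ap (.arr α σ) (.arr α τ)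
        (.ap (.arr α (.arr σ τ)) (.arr (.arr α σ) (.arr α τ)) (.const (.S α σ τ))
          (lamAt n α (.arr σ τ) s)) (lamAt n α σ t)

theorem Typed.lamAt {σs : List Ty} {α τ : Ty} {t : Tm} (h : Typed (σs ++ [α]) t τ) :
    Typed σs (lamAt σs.length α τ t) (.arr α τ) := by
  induction h with
  | @var i σ h =>
    rw [HDN.lamAt]
    split_ifs with hi
    · subst hi
      obtain rfl : α = σ := by simpa using h
      exact .ap (.ap (.const (.S α (.arr α α) α)) (.const (.K α (.arr α α)))) (.const (.K α α))
    · refine .ap (.const (.K σ α)) (.var ?_)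
      have := (List.getElem?_eq_some_iff.1 h).1
      rw [List.length_append, List.length_singleton] at this
      rwa [List.getElem?_append_left (by omega)] at h
  | const c => exact .ap (.const (.K _ α)) (.const c)
  | ap _ _ ih₁ ih₂ => exact .ap (.ap (.const (.S α _ _)) ih₁) ih₂

theorem env_append_left {xs ys : List Tm} {i : ℕ} (h : i < xs.length) :
    env (xs ++ ys) i = env xs i := by
  simp [env, List.getElem?_append_left h]

theorem env_append_right (xs ys : List Tm) (i : ℕ) :
    env (xs ++ ys) (xs.length + i) = env ys i := by
  simp [env, List.getElem?_append_right]

theorem Typed.lamAt_beta {Γ : List Fm} {σs : List Ty} {α τ : Ty} {t y : Tm} {xs : List Tm}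
    (h : Typed (σs ++ [α]) t τ) (hx : Typs e Γ σs xs) (hy : Der (NHA e) Γ (.typ α y)) :
    Der (NHA e) Γ (.eq τ (.ap α τ ((HDN.lamAt σs.length α τ t).subst (env xs)) y)
      (t.subst (env (xs ++ [y])))) := by
  have hxy := hx.append (Typs.nil.cons hy)
  induction h with
  | @var i σ h =>
    rw [HDN.lamAt]
    split_ifs with hi
    · subst hi
      obtain rfl : α = σ := by simpa using h
      have hK := (Der.ty_const (e := e) (Γ := Γ) (.K α α)).ty_ap hy
      have := env_append_right xs [y] 0
      rw [hx.length] at this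
      have h₂ : (Tm.var σs.length).subst (HDN.env (xs ++ [y])) = y := this
      rw [h₂]
      exact (Der.combS (.ty_const (.K α (.arr α α))) (.ty_const (.K α α)) hy).trans
        (hy.combK hK)
    · have hi' := (List.getElem?_eq_some_iff.1 h).1
      rw [List.length_append, List.length_singleton] at hi'
      rw [List.getElem?_append_left (by omega)] at h
      have := env_append_left (xs := xs) (ys := [y]) (i := i) (by rw [hx.length]; omega)
      rw [Tm.var_subst, this]
      exact (hx.env h).combK hy
  | const c => exact (Der.ty_const c).combK hy
  | @ap σ τ s t hs ht ih₁ ih₂ =>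
    have hs' := hs.lamAt.ty hx
    have ht' := ht.lamAt.ty hx
    refine (Der.combS hs' ht' hy).trans ?_
    exact (ih₁.congr_fun (hs'.ty_ap hy) (ht'.ty_ap hy)).trans
      (ih₂.congr_arg (hs.ty hxy) (ht'.ty_ap hy))

/-- `F` is given by a term of type `τ` in variables of types `σs`. -/
def Rep (σs : List Ty) (τ : Ty) (F : List Tm → Tm) : Prop :=
  ∃ t, Typed σs t τ ∧ ∀ xs, xs.length = σs.length → F xs = t.subst (env xs)

/-- `F` is given by terms of types `τs` in variables of types `σs`. -/
def RepT (σs τs : List Ty) (F : List Tm → List Tm) : Prop :=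
  ∃ ts, List.Forall₂ (fun τ t => Typed σs t τ) τs ts ∧
    ∀ xs, xs.length = σs.length → F xs = ts.map (Tm.subst (env xs))

section
variable {σs τs ρs : List Ty} {α σ τ ρ : Ty} {Γ Δ : List Fm}

theorem Rep.ty {F : List Tm → Tm} (h : Rep σs τ F) {xs : List Tm} (hx : Typs e Γ σs xs) :
    Der (NHA e) Γ (.typ τ (F xs)) := by
  obtain ⟨t, ht, h⟩ := h
  rw [h xs hx.length]
  exact ht.ty hx

theorem RepT.ty {F : List Tm → List Tm} (h : RepT σs τs F) {xs : List Tm}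
    (hx : Typs e Γ σs xs) : Typs e Γ τs (F xs) := by
  obtain ⟨ts, ht, h⟩ := h
  rw [h xs hx.length]
  exact List.forall₂_map_right_iff.2 (ht.imp fun _ _ h => h.ty hx)

theorem RepT.length {F : List Tm → List Tm} (h : RepT σs τs F) {xs : List Tm}
    (hx : xs.length = σs.length) : (F xs).length = τs.length := by
  obtain ⟨ts, ht, h⟩ := h
  rw [h xs hx, List.length_map, ht.length_eq]

theorem Rep.congr {F G : List Tm → Tm} (h : Rep σs τ F)
    (hG : ∀ xs, xs.length = σs.length → G xs = F xs) : Rep σs τ G := by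
  obtain ⟨t, ht, h⟩ := h
  exact ⟨t, ht, fun xs hx => (hG xs hx).trans (h xs hx)⟩

theorem RepT.congr {F G : List Tm → List Tm} (h : RepT σs τs F)
    (hG : ∀ xs, xs.length = σs.length → G xs = F xs) : RepT σs τs G := by
  obtain ⟨t, ht, h⟩ := h
  exact ⟨t, ht, fun xs hx => (hG xs hx).trans (h xs hx)⟩

theorem Rep.const (c : Ct) : Rep σs c.ty fun _ => .const c :=
  ⟨_, .const c, fun _ _ => rfl⟩

theorem Rep.ap {F G : List Tm → Tm} (hF : Rep σs (.arr σ τ) F) (hG : Rep σs σ G) :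
    Rep σs τ fun xs => .ap σ τ (F xs) (G xs) := by
  obtain ⟨s, hs, hF⟩ := hF
  obtain ⟨t, ht, hG⟩ := hG
  exact ⟨_, .ap hs ht, fun xs hx => by simp [hF xs hx, hG xs hx]⟩

theorem Rep.getD {i : ℕ} (h : σs[i]? = some σ) : Rep σs σ fun xs => xs.getD i zeroT :=
  ⟨.var i, .var h, fun _ _ => rfl⟩

theorem Rep.last : Rep (σs ++ [α]) α fun xs => xs.getD σs.length zeroT :=
  .getD (by simp)

theorem RepT.nil : RepT σs [] fun _ => [] := ⟨[], .nil, fun _ _ => rfl⟩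

theorem Rep.cons {F : List Tm → Tm} {G : List Tm → List Tm} (hF : Rep σs τ F)
    (hG : RepT σs τs G) : RepT σs (τ :: τs) fun xs => F xs :: G xs := by
  obtain ⟨t, ht, hF⟩ := hF
  obtain ⟨ts, hts, hG⟩ := hG
  exact ⟨t :: ts, .cons ht hts, fun xs hx => by simp [hF xs hx, hG xs hx]⟩

theorem RepT.of_cons {F : List Tm → List Tm} (h : RepT σs (τ :: τs) F) :
    ∃ F₁ F₂, Rep σs τ F₁ ∧ RepT σs τs F₂ ∧
      ∀ xs, xs.length = σs.length → F xs = F₁ xs :: F₂ xs := by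
  obtain ⟨ts, hts, h⟩ := h
  cases hts with
  | @cons _ t _ ts ht hts =>
    exact ⟨_, _, ⟨t, ht, fun _ _ => rfl⟩, ⟨ts, hts, fun _ _ => rfl⟩, h⟩

theorem RepT.append {F G : List Tm → List Tm} (hF : RepT σs τs F) (hG : RepT σs ρs G) :
    RepT σs (τs ++ ρs) fun xs => F xs ++ G xs := by
  obtain ⟨ts, hts, hF⟩ := hF
  obtain ⟨us, hus, hG⟩ := hG
  exact ⟨ts ++ us, List.rel_append hts hus, fun xs hx => by simp [hF xs hx, hG xs hx]⟩

theorem RepT.take {F : List Tm → List Tm} (h : RepT σs (τs ++ ρs) F) :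
    RepT σs τs fun xs => (F xs).take τs.length := by
  obtain ⟨ts, hts, h⟩ := h
  refine ⟨ts.take τs.length, ?_, fun xs hx => by simp [h xs hx]⟩
  simpa using List.forall₂_take τs.length hts

theorem RepT.drop {F : List Tm → List Tm} (h : RepT σs (τs ++ ρs) F) :
    RepT σs ρs fun xs => (F xs).drop τs.length := by
  obtain ⟨ts, hts, h⟩ := h
  refine ⟨ts.drop τs.length, ?_, fun xs hx => by simp [h xs hx]⟩
  simpa using List.forall₂_drop τs.length hts

theorem RepT.id : RepT σs σs fun xs => xs := by
  refine ⟨(List.range σs.length).map .var, ?_, fun xs hx => ?_⟩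
  · rw [List.forall₂_iff_get]
    refine ⟨by simp, fun i h₁ h₂ => ?_⟩
    simp only [List.get_eq_getElem, List.getElem_map, List.getElem_range]
    exact .var (by simp)
  · apply List.ext_getElem
    · simp [hx]
    · intro i h₁ h₂
      simp [env, h₁]

theorem Rep.comp {F : List Tm → Tm} {G : List Tm → List Tm} (hF : Rep τs ρ F)
    (hG : RepT σs τs G) : Rep σs ρ fun xs => F (G xs) := by
  obtain ⟨t, ht, hF⟩ := hF
  obtain ⟨us, hus, hG'⟩ := id hG
  refine ⟨t.subst (env us), ht.subst fun i σ hi => ?_, fun xs hx => ?_⟩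
  · clear hF ht hG hG'
    induction hus generalizing i with
    | nil => simp at hi
    | cons hu _ ih =>
      rcases i with _ | i
      · obtain rfl : _ = σ := by simpa using hi
        exact hu
      · exact ih _ (by simpa using hi)
  · show F (G xs) = _
    rw [hF _ (hG.length hx), Tm.subst_subst, hG' xs hx]
    refine ht.subst_congr fun i hi => ?_
    rw [hus.length_eq] at hi
    simp [env, hi]

theorem RepT.comp {F G : List Tm → List Tm} (hF : RepT τs ρs F)
    (hG : RepT σs τs G) : RepT σs ρs fun xs => F (G xs) := by
  induction ρs generalizing F with
  | nil =>
    refine RepT.nil.congr fun xs hx => ?_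
    exact List.length_eq_zero_iff.1 (hF.length (hG.length hx))
  | cons ρ ρs ih =>
    obtain ⟨F₁, F₂, h₁, h₂, h⟩ := hF.of_cons
    exact ((h₁.comp hG).cons (ih h₂)).congr fun xs hx => h _ (hG.length hx)

theorem RepT.fst : RepT (σs ++ τs) σs fun xs => xs.take σs.length := RepT.id.take

theorem RepT.snd : RepT (σs ++ τs) τs fun xs => xs.drop σs.length := RepT.id.drop

theorem Rep.weaken {F : List Tm → Tm} (h : Rep σs τ F) :
    Rep (σs ++ τs) τ fun xs => F (xs.take σs.length) := h.comp .fst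

theorem RepT.weaken {F : List Tm → List Tm} (h : RepT σs ρs F) :
    RepT (σs ++ τs) ρs fun xs => F (xs.take σs.length) := h.comp .fst

theorem Rep.apT {F : List Tm → Tm} {G : List Tm → List Tm} (hF : Rep σs (arrs ρs τ) F)
    (hG : RepT σs ρs G) : Rep σs τ fun xs => HDN.apT ρs τ (F xs) (G xs) := by
  induction ρs generalizing F G with
  | nil =>
    refine hF.congr fun xs hx => ?_
    simp [HDN.apT]
  | cons ρ ρs ih =>
    obtain ⟨G₁, G₂, h₁, h₂, h⟩ := hG.of_cons
    exact (ih (Rep.ap hF h₁) h₂).congr fun xs hx => by rw [h xs hx]; rfl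

theorem apTs_cons (ρs : List Ty) (τ : Ty) (τs : List Ty) (t : Tm) (ts xs : List Tm) :
    apTs ρs (τ :: τs) (t :: ts) xs = apT ρs τ t xs :: apTs ρs τs ts xs := rfl

theorem RepT.apTs {F : List Tm → List Tm} {G : List Tm → List Tm}
    (hF : RepT σs (τs.map (arrs ρs)) F) (hG : RepT σs ρs G) :
    RepT σs τs fun xs => HDN.apTs ρs τs (F xs) (G xs) := by
  induction τs generalizing F with
  | nil => exact RepT.nil
  | cons τ τs ih =>
    obtain ⟨F₁, F₂, h₁, h₂, h⟩ := hF.of_cons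
    exact ((h₁.apT hG).cons (ih h₂)).congr fun xs hx => by rw [h xs hx]; rfl

theorem Typs.apTs {fs xs : List Tm} (hf : Typs e Γ (τs.map (arrs ρs)) fs)
    (hx : Typs e Γ ρs xs) : Typs e Γ τs (HDN.apTs ρs τs fs xs) := by
  induction τs generalizing fs with
  | nil => exact .nil
  | cons τ τs ih =>
    cases hf with
    | cons hf hfs => exact .cons (hf.ty_apT hx) (ih hfs)

/-- Combinatory completeness for the last argument. The conversion is a provable equality depending
on typings, in contrast to composition of representable functions, which is syntactic. -/
theorem Rep.lam {F : List Tm → Tm} (h : Rep (σs ++ [α]) τ F) :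
    ∃ G, Rep σs (.arr α τ) G ∧ ∀ (Γ : List Fm) (xs : List Tm) (y : Tm), Typs e Γ σs xs →
      Der (NHA e) Γ (.typ α y) →
      Der (NHA e) Γ (.eq τ (.ap α τ (G xs) y) (F (xs ++ [y]))) := by
  obtain ⟨t, ht, h⟩ := h
  refine ⟨_, ⟨_, ht.lamAt, fun _ _ => rfl⟩, fun Γ xs y hx hy => ?_⟩
  rw [h _ (by simp [hx.length])]
  exact ht.lamAt_beta hx hy

/-- A ternary relation holding componentwise. -/
inductive All₃ (P : Ty → Tm → Tm → Prop) : List Ty → List Tm → List Tm → Prop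
  | nil : All₃ P [] [] []
  | cons {τ : Ty} {τs : List Ty} {x y : Tm} {xs ys : List Tm} :
      P τ x y → All₃ P τs xs ys → All₃ P (τ :: τs) (x :: xs) (y :: ys)

theorem All₃.imp {P Q : Ty → Tm → Tm → Prop} {xs ys : List Tm} (h : All₃ P τs xs ys)
    (hPQ : ∀ τ x y, P τ x y → Q τ x y) : All₃ Q τs xs ys := by
  induction h with
  | nil => exact .nil
  | cons h _ ih => exact .cons (hPQ _ _ _ h) ih

theorem All₃.append {P : Ty → Tm → Tm → Prop} {xs ys us vs : List Tm} (h : All₃ P σs xs ys)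
    (h' : All₃ P τs us vs) : All₃ P (σs ++ τs) (xs ++ us) (ys ++ vs) := by
  induction h with
  | nil => exact h'
  | cons h _ ih => exact .cons h ih

theorem All₃.of_append {P : Ty → Tm → Tm → Prop} {xs ys : List Tm}
    (h : All₃ P (σs ++ τs) xs ys) : ∃ xs₁ xs₂ ys₁ ys₂, xs = xs₁ ++ xs₂ ∧ ys = ys₁ ++ ys₂ ∧
      All₃ P σs xs₁ ys₁ ∧ All₃ P τs xs₂ ys₂ := by
  induction σs generalizing xs ys with
  | nil => exact ⟨[], xs, [], ys, rfl, rfl, .nil, h⟩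
  | cons σ σs ih =>
    cases h with
    | cons h hs =>
      obtain ⟨xs₁, xs₂, ys₁, ys₂, rfl, rfl, h₁, h₂⟩ := ih hs
      exact ⟨_ :: xs₁, xs₂, _ :: ys₁, ys₂, rfl, rfl, .cons h h₁, h₂⟩

theorem All₃.length_left {P : Ty → Tm → Tm → Prop} {xs ys : List Tm} (h : All₃ P τs xs ys) :
    xs.length = τs.length := by
  induction h <;> simp_all

theorem All₃.length_right {P : Ty → Tm → Tm → Prop} {xs ys : List Tm} (h : All₃ P τs xs ys) :
    ys.length = τs.length := by
  induction h <;> simp_all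

/-- Componentwise derivable equality. -/
def EqT (e : Bool) (Γ : List Fm) : List Ty → List Tm → List Tm → Prop :=
  All₃ fun τ x y => Der (NHA e) Γ (.eq τ x y)

theorem EqT.refl {xs : List Tm} (h : Typs e Γ τs xs) : EqT e Γ τs xs xs := by
  induction h with
  | nil => exact .nil
  | cons h _ ih => exact .cons h.refl ih

/-- The arguments are abstracted one at a time from the right; the conversions are chained through
congruence of application in the function place. -/
theorem Rep.curry {F : List Tm → Tm} (h : Rep (σs ++ ρs) τ F) :
    ∃ G, Rep σs (arrs ρs τ) G ∧ ∀ (Γ : List Fm) (xs ys : List Tm), Typs e Γ σs xs →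
      Typs e Γ ρs ys → Der (NHA e) Γ (.eq τ (HDN.apT ρs τ (G xs) ys) (F (xs ++ ys))) := by
  induction ρs generalizing σs with
  | nil =>
    rw [List.append_nil] at h
    refine ⟨F, h, fun Γ xs ys hx hy => ?_⟩
    cases hy
    rw [List.append_nil]
    exact (h.ty hx).refl
  | cons ρ ρs ih =>
    obtain ⟨G₁, hG₁, h₁⟩ := ih (σs := σs ++ [ρ]) (by simpa using h)
    obtain ⟨G, hG, h₂⟩ := hG₁.lam (e := e)
    refine ⟨G, hG, fun Γ xs ys hx hy => ?_⟩
    cases hy with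
    | @cons _ y _ ys hy hys =>
      refine ((h₂ Γ xs y hx hy).congr_apT ((hG.ty hx).ty_ap hy) hys).trans ?_
      simpa using h₁ Γ (xs ++ [y]) ys (hx.append (Typs.nil.cons hy)) hys

theorem RepT.curry {F : List Tm → List Tm} (h : RepT (σs ++ ρs) τs F) :
    ∃ G, RepT σs (τs.map (arrs ρs)) G ∧ ∀ (Γ : List Fm) (xs ys : List Tm), Typs e Γ σs xs →
      Typs e Γ ρs ys → EqT e Γ τs (HDN.apTs ρs τs (G xs) ys) (F (xs ++ ys)) := by
  induction τs generalizing F with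
  | nil =>
    refine ⟨_, .nil, fun Γ xs ys hx hy => ?_⟩
    rw [List.length_eq_zero_iff.1 (h.length (by simp [hx.length, hy.length]))]
    exact .nil
  | cons τ τs ih =>
    obtain ⟨F₁, F₂, hF₁, hF₂, hF⟩ := h.of_cons
    obtain ⟨G₁, hG₁, h₁⟩ := hF₁.curry (e := e)
    obtain ⟨G₂, hG₂, h₂⟩ := ih hF₂
    refine ⟨_, hG₁.cons hG₂, fun Γ xs ys hx hy => ?_⟩
    rw [hF _ (by simp [hx.length, hy.length])]
    exact .cons (h₁ Γ xs ys hx hy) (h₂ Γ xs ys hx hy)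

/-- Every type has a closed inhabitant. It serves wherever a realizer must be supplied whose value
does not matter, as in weakening and projections. -/
theorem Rep.exists (σs : List Ty) (τ : Ty) : ∃ F, Rep σs τ F := by
  induction τ with
  | bool => exact ⟨_, .const .tt⟩
  | nat => exact ⟨_, .const .zero⟩
  | star τ _ => exact ⟨_, .const (.nil τ)⟩
  | arr σ τ _ ih =>
    obtain ⟨F, hF⟩ := ih
    exact ⟨_, Rep.ap (.const (.K τ σ)) hF⟩

theorem RepT.exists (σs τs : List Ty) : ∃ F, RepT σs τs F := by
  induction τs with
  | nil => exact ⟨_, .nil⟩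
  | cons τ τs ih =>
    obtain ⟨F, hF⟩ := Rep.exists σs τ
    obtain ⟨G, hG⟩ := ih
    exact ⟨_, hF.cons hG⟩

/-! ## Finite sets of tuples -/

/-- `x` is a derivably typed entry of `a`. -/
def In (e : Bool) (Γ : List Fm) (τ : Ty) (x a : Tm) : Prop :=
  Der (NHA e) Γ (.typ τ x) ∧ Der (NHA e) Γ (.mem τ x a)

/-- Componentwise membership of a tuple. -/
def InT (e : Bool) (Γ : List Fm) : List Ty → List Tm → List Tm → Prop := All₃ (In e Γ)

theorem InT.mono {xs as : List Tm} (h : InT e Γ τs xs as) (hΔ : Γ ⊆ Δ) : InT e Δ τs xs as :=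
  All₃.imp h fun _ _ _ h => ⟨h.1.mono hΔ, h.2.mono hΔ⟩

theorem InT.typs {xs as : List Tm} (h : InT e Γ τs xs as) : Typs e Γ τs xs := by
  induction h with
  | nil => exact .nil
  | cons h _ ih => exact .cons h.1 ih

/-- Pointwise inclusion of set-valued functionals. -/
def Sub (e : Bool) : Ty → List Fm → Tm → Tm → Prop
  | .arr σ τ, Γ, x, y => ∀ Δ t, Γ ⊆ Δ → Der (NHA e) Δ (.typ σ t) →
      Sub e τ Δ (.ap σ τ x t) (.ap σ τ y t)
  | .star σ, Γ, x, y => ∀ Δ t, Γ ⊆ Δ → In e Δ σ t x → In e Δ σ t y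
  | _, _, _, _ => True

/-- Componentwise inclusion. -/
def SubT (e : Bool) (Γ : List Fm) : List Ty → List Tm → List Tm → Prop :=
  All₃ fun τ x y => Sub e τ Γ x y

theorem Sub.mono {x y : Tm} (h : Sub e τ Γ x y) (hΔ : Γ ⊆ Δ) : Sub e τ Δ x y := by
  cases τ with
  | arr σ τ => exact fun Δ' t hΔ' => h Δ' t (List.Subset.trans hΔ hΔ')
  | star σ => exact fun Δ' t hΔ' => h Δ' t (List.Subset.trans hΔ hΔ')
  | _ => trivial

theorem Sub.trans {x y z : Tm} (h : Sub e τ Γ x y) (h' : Sub e τ Γ y z) : Sub e τ Γ x z := by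
  induction τ generalizing Γ x y z with
  | arr σ τ _ ih => exact fun Δ t hΔ ht => ih (h Δ t hΔ ht) (h' Δ t hΔ ht)
  | star σ => exact fun Δ t hΔ ht => h' Δ t hΔ (h Δ t hΔ ht)
  | _ => trivial

theorem Sub.of_eq {x y : Tm} (h : Der (NHA e) Γ (.eq τ x y)) (hx : Der (NHA e) Γ (.typ τ x)) :
    Sub e τ Γ x y := by
  induction τ generalizing Γ x y with
  | arr σ τ _ ih =>
    exact fun Δ t hΔ ht => ih ((h.mono hΔ).congr_fun (hx.mono hΔ) ht) ((hx.mono hΔ).ty_ap ht)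
  | star σ => exact fun Δ t hΔ ht => ⟨ht.1, ht.2.mem_of_eq (h.mono hΔ)⟩
  | _ => trivial

theorem Sub.apT {f g : Tm} {xs : List Tm} (h : Sub e (arrs ρs τ) Γ f g)
    (hx : Typs e Γ ρs xs) : Sub e τ Γ (apT ρs τ f xs) (HDN.apT ρs τ g xs) := by
  induction hx generalizing f g with
  | nil => exact h
  | cons hx _ ih => exact ih (h Γ _ (List.Subset.refl _) hx)

theorem SubT.mono {xs ys : List Tm} (h : SubT e Γ τs xs ys) (hΔ : Γ ⊆ Δ) : SubT e Δ τs xs ys :=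
  All₃.imp h fun _ _ _ h => h.mono hΔ

theorem SubT.trans {xs ys zs : List Tm} (h : SubT e Γ τs xs ys) (h' : SubT e Γ τs ys zs) :
    SubT e Γ τs xs zs := by
  induction h generalizing zs with
  | nil => exact h'
  | cons h _ ih =>
    cases h' with
    | cons h' hs' => exact .cons (h.trans h') (ih hs')

theorem EqT.sub {xs ys : List Tm} (h : EqT e Γ τs xs ys) (hx : Typs e Γ τs xs) :
    SubT e Γ τs xs ys := by
  induction h with
  | nil => exact .nil
  | cons h _ ih =>
    cases hx with
    | cons hx hxs => exact .cons (.of_eq h hx) (ih hxs)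

theorem EqT.symm {xs ys : List Tm} (h : EqT e Γ τs xs ys) (hx : Typs e Γ τs xs) :
    EqT e Γ τs ys xs := by
  induction h with
  | nil => exact .nil
  | cons h _ ih =>
    cases hx with
    | cons hx hxs => exact .cons (h.symm hx) (ih hxs)

theorem SubT.refl {xs : List Tm} (h : Typs e Γ τs xs) : SubT e Γ τs xs xs := (EqT.refl h).sub h

theorem SubT.apTs {fs gs xs : List Tm} (h : SubT e Γ (τs.map (arrs ρs)) fs gs)
    (hx : Typs e Γ ρs xs) : SubT e Γ τs (apTs ρs τs fs xs) (HDN.apTs ρs τs gs xs) := by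
  induction τs generalizing fs gs with
  | nil => exact .nil
  | cons τ τs ih =>
    cases h with
    | cons h hs => exact .cons (h.apT hx) (ih hs)

theorem InT.sub {xs as bs : List Tm} (h : InT e Γ τs xs as)
    (hs : SubT e Γ (τs.map Ty.star) as bs) : InT e Γ τs xs bs := by
  induction h generalizing bs with
  | nil => cases hs; exact .nil
  | cons h _ ih =>
    cases hs with
    | cons h' hs => exact .cons (h' Γ _ (List.Subset.refl _) h) (ih hs)

theorem Rep.singleton {F : List Tm → Tm} (h : Rep σs τ F) :
    Rep σs (.star τ) fun xs => consT τ (F xs) (nilT τ) :=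
  Rep.ap (Rep.ap (.const (.cons τ)) h) (.const (.nil τ))

/-- Turns a single counter-witness into the bounding set that a hypothesis demands. -/
theorem RepT.singleton {F : List Tm → List Tm} (h : RepT σs τs F) :
    ∃ G, RepT σs (τs.map Ty.star) G ∧ ∀ (Γ : List Fm) (xs : List Tm), Typs e Γ σs xs →
      InT e Γ τs (F xs) (G xs) := by
  induction τs generalizing F with
  | nil =>
    refine ⟨_, .nil, fun Γ xs hx => ?_⟩
    rw [List.length_eq_zero_iff.1 (h.length hx.length)]
    exact .nil
  | cons τ τs ih =>
    obtain ⟨F₁, F₂, hF₁, hF₂, hF⟩ := h.of_cons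
    obtain ⟨G, hG, h⟩ := ih hF₂
    refine ⟨_, hF₁.singleton.cons hG, fun Γ xs hx => ?_⟩
    rw [hF xs hx.length]
    exact .cons ⟨hF₁.ty hx, .mem_cons_self (hF₁.ty hx) (.ty_nil τ)⟩ (h Γ xs hx)

theorem Rep.append {F G : List Tm → Tm} (hF : Rep σs (.star τ) F) (hG : Rep σs (.star τ) G) :
    Rep σs (.star τ) fun xs => appendT τ (F xs) (G xs) :=
  Rep.ap (Rep.ap (Rep.ap (.const (.L τ (.star τ))) hF) hG) (.const (.cons τ))

/-- Componentwise concatenation; this is what contraction needs, where one hypothesis is used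
against two bounding sets. -/
theorem RepT.union {F G : List Tm → List Tm} (hF : RepT σs (τs.map Ty.star) F)
    (hG : RepT σs (τs.map Ty.star) G) :
    ∃ H, RepT σs (τs.map Ty.star) H ∧ ∀ (Γ : List Fm) (xs : List Tm), Typs e Γ σs xs →
      SubT e Γ (τs.map Ty.star) (F xs) (H xs) ∧ SubT e Γ (τs.map Ty.star) (G xs) (H xs) := by
  induction τs generalizing F G with
  | nil =>
    refine ⟨_, .nil, fun Γ xs hx => ?_⟩
    rw [List.length_eq_zero_iff.1 (hF.length hx.length),
      List.length_eq_zero_iff.1 (hG.length hx.length)]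
    exact ⟨.nil, .nil⟩
  | cons τ τs ih =>
    obtain ⟨F₁, F₂, hF₁, hF₂, hF⟩ := hF.of_cons
    obtain ⟨G₁, G₂, hG₁, hG₂, hG⟩ := hG.of_cons
    obtain ⟨H, hH, h⟩ := ih hF₂ hG₂
    refine ⟨_, (hF₁.append hG₁).cons hH, fun Γ xs hx => ?_⟩
    rw [hF xs hx.length, hG xs hx.length]
    refine ⟨.cons ?_ (h Γ xs hx).1, .cons ?_ (h Γ xs hx).2⟩
    · exact fun Δ t hΔ ht => ⟨ht.1, .mem_append_left ht.1 (hF₁.ty (hx.mono hΔ))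
        (hG₁.ty (hx.mono hΔ)) ht.2⟩
    · exact fun Δ t hΔ ht => ⟨ht.1, .mem_append_right ht.1 (hF₁.ty (hx.mono hΔ))
        (hG₁.ty (hx.mono hΔ)) ht.2⟩

/-- The union of the values `F (xs, y)` over all `y` in `Y xs`, by recursion on the type of values:
pointwise at function types, and at sequence types a fold of concatenation along `Y xs`. At `𝔹` and
`ℕ` inclusion carries no information and any constant will do. -/
theorem Rep.bigUnion {F Y : List Tm → Tm} (hF : Rep (σs ++ [ρ]) τ F) (hY : Rep σs (.star ρ) Y) :
    ∃ G, Rep σs τ G ∧ ∀ (Γ : List Fm) (xs : List Tm) (y : Tm), Typs e Γ σs xs →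
      In e Γ ρ y (Y xs) → Sub e τ Γ (F (xs ++ [y])) (G xs) := by
  induction τ generalizing σs F Y with
  | bool => exact ⟨_, .const .tt, fun _ _ _ _ _ => trivial⟩
  | nat => exact ⟨_, .const .zero, fun _ _ _ _ _ => trivial⟩
  | arr σ τ _ ih =>
    -- The argument `t` of the functional is put before `y`, so that `y`, at position `σs.length +
    -- 1`, is still the last variable and the induction hypothesis forms the union over it.
    let F' : List Tm → Tm := fun zs =>
      .ap σ τ (F (zs.take σs.length ++ [zs.getD (σs.length + 1) zeroT])) (zs.getD σs.length zeroT)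
    have hF' : Rep (σs ++ [σ] ++ [ρ]) τ F' := by
      refine Rep.ap (hF.comp ?_) (.getD (by simp))
      refine RepT.append ?_ (Rep.cons (.getD (by simp)) .nil)
      simpa using (RepT.fst (σs := σs) (τs := [σ] ++ [ρ]))
    obtain ⟨G', hG', h'⟩ := ih hF' (hY.weaken (τs := [σ]))
    obtain ⟨G, hG, h⟩ := hG'.lam (e := e)
    refine ⟨G, hG, fun Γ xs y hx hy Δ t hΔ ht => ?_⟩
    have hx := hx.mono hΔ
    have hxt := hx.append (Typs.nil.cons ht)
    have h₁ := h' Δ (xs ++ [t]) y hxt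
      ⟨hy.1.mono hΔ, by simpa [← hx.length] using hy.2.mono hΔ⟩
    have h₂ : F' (xs ++ [t] ++ [y]) = .ap σ τ (F (xs ++ [y])) t := by
      simp [F', ← hx.length]
    rw [h₂] at h₁
    exact h₁.trans (.of_eq ((h Δ xs t hx ht).symm ((hG.ty hx).ty_ap ht)) (hG'.ty hxt))
  | star θ _ =>
    -- The step of the fold sends an entry `z` and the accumulated sequence to the concatenation of
    -- `F (xs, z)` with the latter.
    have hS : Rep (σs ++ [ρ] ++ [.star θ]) (.star θ) fun zs =>
        appendT θ (F (zs.take (σs ++ [ρ]).length)) (zs.getD (σs ++ [ρ]).length zeroT) :=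
      hF.weaken.append .last
    obtain ⟨S₁, hS₁, h₁⟩ := hS.lam (e := e)
    obtain ⟨S, hS, h₂⟩ := hS₁.lam (e := e)
    refine ⟨fun xs => seqRecT ρ (.star θ) (Y xs) (nilT θ) (S xs),
      Rep.ap (Rep.ap (Rep.ap (.const (.L ρ (.star θ))) hY) (.const (.nil θ))) hS,
      fun Γ xs y hx hy Δ t hΔ ht => ⟨ht.1, ?_⟩⟩
    have hx := hx.mono hΔ
    have key : ∀ a, (Fm.mem θ (t.wk 1)
        (seqRecT ρ (.star θ) (.var 0) (nilT θ) ((S xs).wk 1))).inst a =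
        .mem θ t (seqRecT ρ (.star θ) a (nilT θ) (S xs)) := by
      intro a; simp [Fm.inst]
    have hrec : ∀ {Δ' z u}, Δ ⊆ Δ' → Der (NHA e) Δ' (.typ ρ z) →
        Der (NHA e) Δ' (.typ (.star ρ) u) →
        Der (NHA e) Δ' (.typ (.star θ) (seqRecT ρ (.star θ) u (nilT θ) (S xs))) ∧
        Der (NHA e) Δ' (.typ (.star θ) (F (xs ++ [z]))) ∧
        Der (NHA e) Δ' (.eq (.star θ)
          (appendT θ (F (xs ++ [z])) (seqRecT ρ (.star θ) u (nilT θ) (S xs)))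
          (seqRecT ρ (.star θ) (consT ρ z u) (nilT θ) (S xs))) := by
      intro Δ' z u hΔ' hz hu
      have hx := hx.mono hΔ'
      have hxz := hx.append (Typs.nil.cons hz)
      have hr := hu.ty_seqRec (.ty_nil θ) (hS.ty hx)
      have hSz := (hS.ty hx).ty_ap hz
      refine ⟨hr, hF.ty hxz, ?_⟩
      refine Der.symm (((hz.seqRec_cons hu (.ty_nil θ) (hS.ty hx)).trans
        ((h₂ Δ' xs z hx hz).congr_fun hSz hr)).trans ?_)
        ((hz.ty_cons hu).ty_seqRec (.ty_nil θ) (hS.ty hx))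
      have h := h₁ Δ' (xs ++ [z]) _ hxz hr
      have hl : (σs ++ [ρ]).length = (xs ++ [z]).length := hxz.length.symm
      simp only [hl, List.take_left'] at h
      simpa using h
    rw [← key]
    -- The element enters the fold at the entry `y` of `Y xs`, and is kept as further entries are
    -- prefixed.
    refine Der.mem_ind _ (hy.1.mono hΔ) (hy.2.mono hΔ) (hY.ty hx) ?_ ?_
    · intro Δ' v hΔ' hv
      obtain ⟨hr, hFz, heq⟩ := hrec hΔ' (hy.1.mono (List.Subset.trans hΔ hΔ')) hv
      rw [key]
      exact (Der.mem_append_left (ht.1.mono hΔ') hFz hr (ht.2.mono hΔ')).mem_of_eq heq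
    · intro Δ' z u hΔ' hz hu h
      obtain ⟨hr, hFz, heq⟩ := hrec hΔ' hz hu
      rw [key] at h ⊢
      exact (Der.mem_append_right (ht.1.mono hΔ') hFz hr h).mem_of_eq heq

theorem RepT.bigUnion₁ {F : List Tm → List Tm} {Y : List Tm → Tm} (hF : RepT (σs ++ [ρ]) τs F)
    (hY : Rep σs (.star ρ) Y) :
    ∃ G, RepT σs τs G ∧ ∀ (Γ : List Fm) (xs : List Tm) (y : Tm), Typs e Γ σs xs →
      In e Γ ρ y (Y xs) → SubT e Γ τs (F (xs ++ [y])) (G xs) := by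
  induction τs generalizing F with
  | nil =>
    refine ⟨_, .nil, fun Γ xs y hx hy => ?_⟩
    rw [List.length_eq_zero_iff.1 (hF.length (by simp [hx.length]))]
    exact .nil
  | cons τ τs ih =>
    obtain ⟨F₁, F₂, hF₁, hF₂, hF⟩ := hF.of_cons
    obtain ⟨G₁, hG₁, h₁⟩ := hF₁.bigUnion (e := e) hY
    obtain ⟨G₂, hG₂, h₂⟩ := ih hF₂
    refine ⟨_, hG₁.cons hG₂, fun Γ xs y hx hy => ?_⟩
    rw [hF _ (by simp [hx.length])]
    exact .cons (h₁ Γ xs y hx hy) (h₂ Γ xs y hx hy)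

/-- One coordinate at a time: with the first coordinate as a parameter the union over the remaining
ones is formed, and then the union over the first. Transitivity of inclusion joins the two. -/
theorem RepT.bigUnion {F Y : List Tm → List Tm} (hF : RepT (σs ++ ρs) τs F)
    (hY : RepT σs (ρs.map Ty.star) Y) :
    ∃ G, RepT σs τs G ∧ ∀ (Γ : List Fm) (xs ys : List Tm), Typs e Γ σs xs →
      InT e Γ ρs ys (Y xs) → SubT e Γ τs (F (xs ++ ys)) (G xs) := by
  induction ρs generalizing σs F Y with
  | nil =>
    rw [List.append_nil] at hF
    refine ⟨F, hF, fun Γ xs ys hx hy => ?_⟩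
    rw [List.length_eq_zero_iff.1 hy.length_left, List.append_nil]
    exact .refl (hF.ty hx)
  | cons ρ ρs ih =>
    obtain ⟨Y₁, Y₂, hY₁, hY₂, hY⟩ := hY.of_cons
    obtain ⟨G', hG', h'⟩ := ih (σs := σs ++ [ρ]) (by simpa using hF) hY₂.weaken
    obtain ⟨G, hG, h⟩ := hG'.bigUnion₁ (e := e) hY₁
    refine ⟨G, hG, fun Γ xs ys hx hy => ?_⟩
    rw [hY xs hx.length] at hy
    cases hy with
    | @cons _ _ y _ ys _ hy hys =>
      have := h' Γ (xs ++ [y]) ys (hx.append (Typs.nil.cons hy.1))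
        (by simpa [InT, ← hx.length] using hys)
      rw [List.append_assoc] at this
      exact this.trans (h Γ xs y hx hy)

end

/-! ## Tuples of bound variables -/

theorem up_iterate (n : ℕ) (θ : ℕ → Tm) (i : ℕ) :
    up^[n] θ i = if i < n then .var i else (θ (i - n)).wk n := by
  induction n generalizing i with
  | zero => simp
  | succ n ih =>
    rw [Function.iterate_succ_apply']
    rcases i with _ | i
    · simp
    · rw [up_succ, ih]
      by_cases h : i < n
      · rw [if_pos h, if_pos (by omega)]; rfl
      · rw [if_neg h, if_neg (by omega), Tm.wk_wk, Nat.add_sub_add_right]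

theorem Tm.wk_subst_up_iterate (n : ℕ) (t : Tm) (θ : ℕ → Tm) :
    (t.wk n).subst (up^[n] θ) = (t.subst θ).wk n := by
  rw [Tm.wk_subst, Tm.subst_wk]
  congr 1
  funext i
  simp [up_iterate]

theorem bvs_length (n : ℕ) : (bvs n).length = n := by simp [bvs]

theorem bvs_subst_up_iterate (n : ℕ) (θ : ℕ → Tm) :
    (bvs n).map (Tm.subst (up^[n] θ)) = bvs n := by
  rw [bvs, List.map_map]
  refine List.map_congr_left fun i hi => ?_
  have : i < n := by simpa using hi
  simp [up_iterate, this]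

/-- The simultaneous substitution of the tuple `ys` for the innermost bound variables. -/
def insts (ys : List Tm) : ℕ → Tm := fun i =>
  -- Tuples are bound outermost first, so the head of `ys` belongs to the largest of the bound
  -- indices.
  if i < ys.length then ys.getD (ys.length - 1 - i) zeroT else .var (i - ys.length)

theorem Tm.wk_subst_insts (t : Tm) (ys : List Tm) : (t.wk ys.length).subst (insts ys) = t := by
  rw [Tm.wk_subst]
  conv_rhs => rw [← t.subst_var]
  congr 1
  funext i
  simp [insts]

theorem map_wk_subst_insts (xs ys : List Tm) :
    (xs.map (Tm.wk ys.length)).map (Tm.subst (insts ys)) = xs := by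
  simp [Tm.wk_subst_insts, Function.comp_def]

theorem bvs_subst_insts (ys : List Tm) : (bvs ys.length).map (Tm.subst (insts ys)) = ys := by
  apply List.ext_getElem
  · simp [bvs]
  · intro i h₁ h₂
    simp only [bvs, List.getElem_map, List.getElem_reverse, List.length_range,
      List.getElem_range, Tm.var_subst, insts]
    rw [if_pos (by omega), show ys.length - 1 - (ys.length - 1 - i) = i by omega]
    simp [h₂]

theorem insts_nil : insts [] = Tm.var := by
  funext i; simp [insts]

theorem insts_cons (y : Tm) (ys : List Tm) :
    (fun i => (up^[ys.length] (single y) i).subst (insts ys)) = insts (y :: ys) := by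
  funext i
  rw [up_iterate]
  by_cases h : i < ys.length
  · rw [if_pos h, Tm.var_subst, insts, insts, if_pos h, if_pos (by simp; omega),
      List.length_cons, show ys.length + 1 - 1 - i = ys.length - 1 - i + 1 by omega]
    simp
  · rw [if_neg h, Tm.wk_subst_insts]
    obtain ⟨j, rfl⟩ := Nat.exists_eq_add_of_le (not_lt.1 h)
    rcases j with _ | j
    · simp [insts]
    · simp [insts, show ¬ ys.length + (j + 1) < ys.length + 1 by omega,
        show ys.length + (j + 1) - (ys.length + 1) = j by omega]

section
variable {τs σs ρs : List Ty} {Γ Δ : List Fm}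

theorem memAll_subst {as : List Tm} (h : as.length = τs.length) (F : Fm) (θ : ℕ → Tm) :
    (memAll τs as F).subst θ =
      memAll τs (as.map (Tm.subst θ)) (F.subst (up^[τs.length] θ)) := by
  induction τs generalizing as θ with
  | nil => rw [List.length_eq_zero_iff.1 h]; rfl
  | cons τ τs ih =>
    rcases as with _ | ⟨a, as⟩
    · simp at h
    · simp only [memAll, Fm.allT_subst, Fm.imp_subst, Fm.mem_subst, Tm.var_subst, up_zero,
        Tm.wk_subst_up, List.map_cons, List.length_cons, Function.iterate_succ_apply]
      rw [ih (by simpa using h)]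
      simp [Function.comp_def]

/-- The forcing clause of the bounded quantifier. The length condition matters, because `memAll`
stops binding as soon as either list is exhausted. -/
theorem memAll_iff {as : List Tm} (h : as.length = τs.length) (F : Fm) :
    Der (NHA e) Γ (memAll τs as F) ↔
      ∀ Δ ys, Γ ⊆ Δ → InT e Δ τs ys as → Der (NHA e) Δ (F.subst (insts ys)) := by
  induction τs generalizing as F Γ with
  | nil =>
    rw [List.length_eq_zero_iff.1 h]
    refine ⟨fun h Δ ys hΔ hy => ?_, fun h => ?_⟩
    · cases hy
      rw [insts_nil, Fm.subst_var]
      exact Der.mono h hΔ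
    · have := h Γ [] (List.Subset.refl _) .nil
      rwa [insts_nil, Fm.subst_var] at this
  | cons τ τs ih =>
    rcases as with _ | ⟨a, as⟩
    · simp at h
    have h' : as.length = τs.length := by simpa using h
    have key : ∀ t, (Fm.imp (.mem τ (.var 0) (a.wk 1)) (memAll τs (as.map (Tm.wk 1)) F)).inst t =
        .imp (.mem τ t a) (memAll τs as (F.subst (up^[τs.length] (single t)))) := by
      intro t
      simp only [Fm.inst, Fm.imp_subst, Fm.mem_subst, Tm.var_subst, single_zero,
        Tm.wk_subst_single]
      rw [memAll_subst (by simpa using h')]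
      simp [Function.comp_def]
    simp only [memAll, Der.allT_iff, key, Der.imp_iff, ih h']
    constructor
    · intro h Δ ys hΔ hy
      cases hy with
      | @cons _ _ y _ ys _ hy hys =>
        have := h Δ y hΔ hy.1 Δ (List.Subset.refl _) hy.2 Δ ys (List.Subset.refl _) hys
        rwa [Fm.subst_subst, ← hys.length_left, insts_cons] at this
    · intro h Δ t hΔ ht Δ' hΔ' hm Δ'' ys hΔ'' hys
      have := h Δ'' (t :: ys) (List.Subset.trans hΔ (List.Subset.trans hΔ' hΔ''))
        (.cons ⟨ht.mono (List.Subset.trans hΔ' hΔ''), hm.mono hΔ''⟩ hys)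
      rwa [Fm.subst_subst, ← hys.length_left, insts_cons]

/-- Typed universal quantification over a tuple. -/
def allTs : List Ty → Fm → Fm
  | [], A => A
  | τ :: τs, A => .allT τ (allTs τs A)

theorem allTs_subst (F : Fm) (θ : ℕ → Tm) :
    (allTs τs F).subst θ = allTs τs (F.subst (up^[τs.length] θ)) := by
  induction τs generalizing θ with
  | nil => rfl
  | cons τ τs ih => simp [allTs, ih]

theorem allTs_iff (F : Fm) :
    Der (NHA e) Γ (allTs τs F) ↔
      ∀ Δ ys, Γ ⊆ Δ → Typs e Δ τs ys → Der (NHA e) Δ (F.subst (insts ys)) := by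
  induction τs generalizing F Γ with
  | nil =>
    refine ⟨fun h Δ ys hΔ hy => ?_, fun h => ?_⟩
    · cases hy
      rw [insts_nil, Fm.subst_var]
      exact Der.mono h hΔ
    · have := h Γ [] (List.Subset.refl _) .nil
      rwa [insts_nil, Fm.subst_var] at this
  | cons τ τs ih =>
    simp only [allTs, Der.allT_iff, Fm.inst, allTs_subst, ih]
    constructor
    · intro h Δ ys hΔ hy
      cases hy with
      | @cons _ y _ ys hy hys =>
        have := h Δ y hΔ hy Δ ys (List.Subset.refl _) hys
        rwa [Fm.subst_subst, ← Typs.length hys, insts_cons] at this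
    · intro h Δ t hΔ ht Δ' ys hΔ' hys
      have := h Δ' (t :: ys) (List.Subset.trans hΔ hΔ') (.cons (ht.mono hΔ') hys)
      rwa [Fm.subst_subst, ← hys.length, insts_cons]

theorem apTs_map_subst {fs xs : List Tm} (θ : ℕ → Tm) :
    (apTs ρs τs fs xs).map (Tm.subst θ) =
      apTs ρs τs (fs.map (Tm.subst θ)) (xs.map (Tm.subst θ)) := by
  induction τs generalizing fs with
  | nil => rfl
  | cons τ τs ih =>
    rcases fs with _ | ⟨f, fs⟩
    · rfl
    · simp [apTs_cons, ih]

theorem apTs_length {fs xs : List Tm} (h : fs.length = τs.length) :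
    (apTs ρs τs fs xs).length = τs.length := by
  simp [apTs, h]

theorem apTs_star_length {fs xs : List Tm} (h : fs.length = τs.length) :
    (apTs ρs (τs.map Ty.star) fs xs).length = τs.length := by
  simp [apTs, h]

/-! ## The interpretation -/

/-- The bounds enter affine logic through the Girard translation and are forgotten again. This
cancellation removes the affine detour and gives the recursive clauses of `J` below. -/
theorem Fm.forget_girard (A : Fm) : A.girard.forget = A := by
  induction A <;> simp_all [Fm.girard, ALFm.forget]

/-- The interpretation of `A[θ]`. -/
def J (A : Fm) (θ : ℕ → Tm) (x y : List Tm) : Fm := (hdn.toAL.inter A.girard θ x y).forget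

/-- The interpretation of `A[θ]`, quantified over a tuple of sets of counter-witnesses. -/
def JB (A : Fm) (θ : ℕ → Tm) (x S : List Tm) : Fm :=
  memAll (hdn.neg A) S (J A (fun i => (θ i).wk (hdn.neg A).length)
    (x.map (Tm.wk (hdn.neg A).length)) (bvs (hdn.neg A).length))

theorem inter_eq_J (A : Fm) (x y : List Tm) : hdn.inter A x y = J A Tm.var x y := rfl

theorem J_typ (τ : Ty) (t : Tm) (θ : ℕ → Tm) (x y : List Tm) :
    J (.typ τ t) θ x y =
      .and (.typ τ (t.subst θ)) (.mem τ (t.subst θ) (x.headD zeroT)) := by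
  simp only [J, Fm.girard, ALParams.inter, ILParams.toAL, ALFm.forget, Fm.forget_girard, hdn]

theorem J_eq (τ : Ty) (s t : Tm) (θ : ℕ → Tm) (x y : List Tm) :
    J (.eq τ s t) θ x y = .eq τ (s.subst θ) (t.subst θ) := rfl

theorem J_and (A B : Fm) (θ : ℕ → Tm) (x y : List Tm) :
    J (.and A B) θ x y =
      .and (J A θ (x.take (hdn.pos A).length) (y.take (hdn.neg A).length))
        (J B θ (x.drop (hdn.pos A).length) (y.drop (hdn.neg A).length)) := rfl

theorem J_imp (A B : Fm) (θ : ℕ → Tm) (fg xw : List Tm) :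
    J (.imp A B) θ fg xw =
      .imp (JB A θ (xw.take (hdn.pos A).length)
          (apTs (hdn.pos A ++ hdn.neg B) ((hdn.neg A).map Ty.star)
            (fg.drop (hdn.pos B).length) xw))
        (J B θ (apTs (hdn.pos A) (hdn.pos B) (fg.take (hdn.pos B).length)
          (xw.take (hdn.pos A).length)) (xw.drop (hdn.pos A).length)) := by
  simp only [J, JB, Fm.girard, ALParams.inter, ALFm.forget, ILParams.toAL, Fm.forget_girard, hdn]
  rfl

theorem J_all (A : Fm) (θ : ℕ → Tm) (x y : List Tm) :
    J (.all A) θ x y = .all (J A (up θ) (x.map (Tm.wk 1)) (y.map (Tm.wk 1))) := rfl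

theorem J_ex (A : Fm) (θ : ℕ → Tm) (x y : List Tm) :
    J (.ex A) θ x y = .ex (JB A (up θ) (x.map (Tm.wk 1)) (y.map (Tm.wk 1))) := by
  simp only [J, JB, Fm.girard, ALParams.inter, ALFm.forget, ILParams.toAL, Fm.forget_girard, hdn]
  rfl

theorem types_subst (A : Fm) (θ : ℕ → Tm) :
    hdn.toAL.types (A.subst θ).girard = hdn.toAL.types A.girard := by
  induction A generalizing θ <;> simp_all [Fm.girard, ALParams.types]

@[simp] theorem pos_subst (A : Fm) (θ : ℕ → Tm) : hdn.pos (A.subst θ) = hdn.pos A :=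
  congrArg Prod.fst (types_subst A θ)

@[simp] theorem neg_subst (A : Fm) (θ : ℕ → Tm) : hdn.neg (A.subst θ) = hdn.neg A :=
  congrArg Prod.snd (types_subst A θ)

@[simp] theorem pos_wk (A : Fm) (n : ℕ) : hdn.pos (A.wk n) = hdn.pos A := pos_subst _ _

@[simp] theorem neg_wk (A : Fm) (n : ℕ) : hdn.neg (A.wk n) = hdn.neg A := neg_subst _ _

@[simp] theorem pos_inst (A : Fm) (t : Tm) : hdn.pos (A.inst t) = hdn.pos A := pos_subst _ _

@[simp] theorem neg_inst (A : Fm) (t : Tm) : hdn.neg (A.inst t) = hdn.neg A := neg_subst _ _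

/-- Witness types do not depend on terms, so a substitution in the formula can be absorbed into the
environment `θ`. This is what makes instances and weakenings tractable. -/
theorem J_of_subst (A : Fm) (η θ : ℕ → Tm) (x y : List Tm) :
    J (A.subst η) θ x y = J A (fun i => (η i).subst θ) x y := by
  induction A generalizing η θ x y with
  | typ τ t => simp [J_typ]
  | eq τ s t => simp [J_eq]
  | bot => rfl
  | and A B ihA ihB => simp [J_and, ihA, ihB]
  | imp A B ihA ihB => simp [J_imp, JB, ihA, ihB, Tm.subst_wk]
  | all A ih => simp [J_all, ih, up_up]
  | ex A ih =>
    simp only [Fm.ex_subst, J_ex, JB, ih, neg_subst]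
    congr 3
    funext i
    rw [← up_up]
    simp [Tm.subst_wk]

theorem JB_of_subst (A : Fm) (η θ : ℕ → Tm) (x y : List Tm) :
    JB (A.subst η) θ x y = JB A (fun i => (η i).subst θ) x y := by
  simp [JB, J_of_subst, Tm.subst_wk]

theorem binter_eq_JB (A : Fm) (x S : List Tm) : hdn.binter A x S = JB A Tm.var x S := by
  rw [ILParams.binter, inter_eq_J, Fm.wk, J_of_subst, JB]
  rfl

theorem memInter_eq_JB (A : Fm) (x S : List Tm) : memInter A x S = JB A Tm.var x S :=
  binter_eq_JB A x S

@[simp] theorem pos_typ (τ : Ty) (t : Tm) : hdn.pos (.typ τ t) = [.star τ] := rfl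

@[simp] theorem neg_typ (τ : Ty) (t : Tm) : hdn.neg (.typ τ t) = [] := rfl

@[simp] theorem pos_eq (τ : Ty) (s t : Tm) : hdn.pos (.eq τ s t) = [] := rfl

@[simp] theorem neg_eq (τ : Ty) (s t : Tm) : hdn.neg (.eq τ s t) = [] := rfl

@[simp] theorem bneg_eq (A : Fm) : hdn.bneg A = (hdn.neg A).map Ty.star := rfl

@[simp] theorem pos_imp (A B : Fm) : hdn.pos (.imp A B) = (hdn.pos B).map (arrs (hdn.pos A)) ++
    ((hdn.neg A).map Ty.star).map (arrs (hdn.pos A ++ hdn.neg B)) := rfl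

@[simp] theorem neg_imp (A B : Fm) : hdn.neg (.imp A B) = hdn.pos A ++ hdn.neg B := rfl

@[simp] theorem pos_and (A B : Fm) : hdn.pos (.and A B) = hdn.pos A ++ hdn.pos B := rfl

@[simp] theorem neg_and (A B : Fm) : hdn.neg (.and A B) = hdn.neg A ++ hdn.neg B := rfl

@[simp] theorem pos_all (A : Fm) : hdn.pos (.all A) = hdn.pos A := rfl

@[simp] theorem neg_all (A : Fm) : hdn.neg (.all A) = hdn.neg A := rfl

@[simp] theorem pos_ex (A : Fm) : hdn.pos (.ex A) = hdn.pos A := rfl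

@[simp] theorem neg_ex (A : Fm) : hdn.neg (.ex A) = (hdn.neg A).map Ty.star := rfl

theorem J_JB_subst (A : Fm) :
    (∀ (θ η : ℕ → Tm) (x y : List Tm), x.length = (hdn.pos A).length →
      y.length = (hdn.neg A).length →
      (J A θ x y).subst η =
        J A (fun i => (θ i).subst η) (x.map (Tm.subst η)) (y.map (Tm.subst η))) ∧
    ∀ (θ η : ℕ → Tm) (x S : List Tm), x.length = (hdn.pos A).length →
      S.length = (hdn.neg A).length →
      (JB A θ x S).subst η =
        JB A (fun i => (θ i).subst η) (x.map (Tm.subst η)) (S.map (Tm.subst η)) := by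
  -- The bounded form for a formula follows from the plain form for the same formula, so it is
  -- available for subformulas during the induction, where implication and existence need it.
  have hB : ∀ A, (∀ (θ η : ℕ → Tm) (x y : List Tm), x.length = (hdn.pos A).length →
      y.length = (hdn.neg A).length →
      (J A θ x y).subst η =
        J A (fun i => (θ i).subst η) (x.map (Tm.subst η)) (y.map (Tm.subst η))) →
      ∀ (θ η : ℕ → Tm) (x S : List Tm), x.length = (hdn.pos A).length →
      S.length = (hdn.neg A).length →
      (JB A θ x S).subst η =
        JB A (fun i => (θ i).subst η) (x.map (Tm.subst η)) (S.map (Tm.subst η)) := by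
    intro A hA θ η x S hx hS
    rw [JB, memAll_subst hS, hA _ _ _ _ (by simpa using hx) (bvs_length _),
      bvs_subst_up_iterate, JB]
    simp [Tm.wk_subst_up_iterate, Function.comp_def]
  refine ⟨?_, hB A ?_⟩ <;>
  · induction A with
    | typ τ t =>
      intro θ η x y hx hy
      obtain ⟨a, rfl⟩ := List.length_eq_one_iff.1 hx
      simp [J_typ]
    | eq τ s t => intros; simp [J_eq]
    | bot => intros; rfl
    | and A B ihA ihB =>
      intro θ η x y hx hy
      rw [pos_and, List.length_append] at hx
      rw [neg_and, List.length_append] at hy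
      rw [J_and, J_and, Fm.and_subst, ihA _ _ _ _ (by simp; omega) (by simp; omega),
        ihB _ _ _ _ (by simp; omega) (by simp; omega)]
      simp
    | imp A B ihA ihB =>
      intro θ η x y hx hy
      rw [pos_imp, List.length_append, List.length_map, List.length_map, List.length_map] at hx
      rw [neg_imp, List.length_append] at hy
      rw [J_imp, J_imp, Fm.imp_subst, hB A ihA _ _ _ _ (by simp; omega)
        (by rw [apTs_length (by simp; omega)]; simp),
        ihB _ _ _ _ (by rw [apTs_length (by simp; omega)]) (by simp; omega)]
      simp [apTs_map_subst]
    | all A ih =>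
      intro θ η x y hx hy
      rw [pos_all] at hx
      rw [neg_all] at hy
      rw [J_all, J_all, Fm.all_subst, ih _ _ _ _ (by simpa using hx) (by simpa using hy), up_up]
      simp [Function.comp_def]
    | ex A ih =>
      intro θ η x y hx hy
      rw [pos_ex] at hx
      rw [neg_ex, List.length_map] at hy
      rw [J_ex, J_ex, Fm.ex_subst, hB A ih _ _ _ _ (by simpa using hx) (by simpa using hy), up_up]
      simp [Function.comp_def]

theorem J_subst {A : Fm} {x y : List Tm} (hx : x.length = (hdn.pos A).length)
    (hy : y.length = (hdn.neg A).length) (θ η : ℕ → Tm) :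
    (J A θ x y).subst η =
      J A (fun i => (θ i).subst η) (x.map (Tm.subst η)) (y.map (Tm.subst η)) :=
  (J_JB_subst A).1 θ η x y hx hy

theorem JB_subst {A : Fm} {x S : List Tm} (hx : x.length = (hdn.pos A).length)
    (hS : S.length = (hdn.neg A).length) (θ η : ℕ → Tm) :
    (JB A θ x S).subst η =
      JB A (fun i => (θ i).subst η) (x.map (Tm.subst η)) (S.map (Tm.subst η)) :=
  (J_JB_subst A).2 θ η x S hx hS

theorem JB_iff {A : Fm} {θ : ℕ → Tm} {x S : List Tm} (hx : x.length = (hdn.pos A).length)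
    (hS : S.length = (hdn.neg A).length) :
    Der (NHA e) Γ (JB A θ x S) ↔
      ∀ Δ y, Γ ⊆ Δ → InT e Δ (hdn.neg A) y S → Der (NHA e) Δ (J A θ x y) := by
  rw [JB, memAll_iff hS]
  refine forall₂_congr fun Δ y => forall₂_congr fun hΔ hy => ?_
  rw [J_subst (by simpa using hx) (bvs_length _), ← hy.length_left, map_wk_subst_insts,
    bvs_subst_insts]
  simp [Tm.wk_subst_insts]

theorem J_all_inst {A : Fm} {θ : ℕ → Tm} {x y : List Tm} (hx : x.length = (hdn.pos A).length)
    (hy : y.length = (hdn.neg A).length) (t : Tm) :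
    (J A (up θ) (x.map (Tm.wk 1)) (y.map (Tm.wk 1))).inst t = J A (scons t θ) x y := by
  rw [Fm.inst, J_subst (by simpa using hx) (by simpa using hy), up_scons]
  simp [Function.comp_def]

theorem JB_all_inst {A : Fm} {θ : ℕ → Tm} {x y : List Tm} (hx : x.length = (hdn.pos A).length)
    (hy : y.length = (hdn.neg A).length) (t : Tm) :
    (JB A (up θ) (x.map (Tm.wk 1)) (y.map (Tm.wk 1))).inst t = JB A (scons t θ) x y := by
  rw [Fm.inst, JB_subst (by simpa using hx) (by simpa using hy), up_scons]
  simp [Function.comp_def]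

theorem J_all_iff {A : Fm} {θ : ℕ → Tm} {x y : List Tm} (hx : x.length = (hdn.pos A).length)
    (hy : y.length = (hdn.neg A).length) :
    Der (NHA e) Γ (J (.all A) θ x y) ↔ ∀ t, Der (NHA e) Γ (J A (scons t θ) x y) := by
  simp only [J_all, Der.all_iff, J_all_inst hx hy]

theorem J_and_iff {A B : Fm} {θ : ℕ → Tm} {x v y w : List Tm}
    (hx : x.length = (hdn.pos A).length) (hy : y.length = (hdn.neg A).length) :
    Der (NHA e) Γ (J (.and A B) θ (x ++ v) (y ++ w)) ↔
      Der (NHA e) Γ (J A θ x y) ∧ Der (NHA e) Γ (J B θ v w) := by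
  rw [J_and, Der.and_iff, List.take_left' hx, List.take_left' hy, List.drop_left' hx,
    List.drop_left' hy]

theorem J_imp_append {A B : Fm} {θ : ℕ → Tm} {f g x w : List Tm}
    (hf : f.length = (hdn.pos B).length) (hx : x.length = (hdn.pos A).length) :
    J (.imp A B) θ (f ++ g) (x ++ w) =
      .imp (JB A θ x (apTs (hdn.pos A ++ hdn.neg B) ((hdn.neg A).map Ty.star) g (x ++ w)))
        (J B θ (apTs (hdn.pos A) (hdn.pos B) f x) w) := by
  rw [J_imp, List.take_left' hf, List.take_left' hx, List.drop_left' hf, List.drop_left' hx]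

theorem J_imp_iff {A B : Fm} {θ : ℕ → Tm} {f g x w : List Tm}
    (hf : f.length = (hdn.pos B).length) (hx : x.length = (hdn.pos A).length) :
    Der (NHA e) Γ (J (.imp A B) θ (f ++ g) (x ++ w)) ↔
      ∀ Δ, Γ ⊆ Δ →
        Der (NHA e) Δ (JB A θ x
          (apTs (hdn.pos A ++ hdn.neg B) ((hdn.neg A).map Ty.star) g (x ++ w))) →
        Der (NHA e) Δ (J B θ (apTs (hdn.pos A) (hdn.pos B) f x) w) := by
  rw [J_imp_append hf hx, Der.imp_iff]

/-- Witnesses occur only through membership of a typed object in a set. In an implication, enlarging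
the bounds `g` strengthens the premise, since more counter-witnesses are tested, while enlarging `f`
weakens the conclusion by induction; both act in the required direction. -/
theorem J_mono {A : Fm} {θ : ℕ → Tm} {x x' y : List Tm} (h : Der (NHA e) Γ (J A θ x y))
    (hy : Typs e Γ (hdn.neg A) y) (hx : SubT e Γ (hdn.pos A) x x') :
    Der (NHA e) Γ (J A θ x' y) := by
  induction A generalizing Γ θ x x' y with
  | typ τ t =>
    rcases hx with _ | ⟨hx, _ | _⟩
    rw [J_typ, Der.and_iff] at h ⊢
    exact ⟨h.1, (hx Γ _ (List.Subset.refl _) h).2⟩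
  | eq τ s t => exact h
  | bot => exact h
  | and A B ihA ihB =>
    rw [pos_and] at hx
    rw [neg_and] at hy
    obtain ⟨x₁, x₂, x₁', x₂', rfl, rfl, h₁, h₂⟩ := All₃.of_append hx
    obtain ⟨y₁, y₂, rfl, hy₁, hy₂⟩ := Typs.of_append hy
    rw [J_and_iff h₁.length_left hy₁.length] at h
    rw [J_and_iff h₁.length_right hy₁.length]
    exact ⟨ihA h.1 hy₁ h₁, ihB h.2 hy₂ h₂⟩
  | imp A B ihA ihB =>
    rw [pos_imp] at hx
    rw [neg_imp] at hy
    obtain ⟨f, g, f', g', rfl, rfl, hf, hg⟩ := All₃.of_append hx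
    obtain ⟨x, w, rfl, hx, hw⟩ := Typs.of_append hy
    rw [J_imp_iff (by simpa using hf.length_left) hx.length] at h
    rw [J_imp_iff (by simpa using hf.length_right) hx.length]
    intro Δ hΔ hA
    refine ihB (h Δ hΔ ?_) (hw.mono hΔ) (SubT.apTs (SubT.mono hf hΔ) (hx.mono hΔ))
    rw [JB_iff hx.length (apTs_star_length (by simpa using hg.length_left))]
    rw [JB_iff hx.length (apTs_star_length (by simpa using hg.length_right))] at hA
    exact fun Δ' y hΔ' hy => hA Δ' y hΔ' (hy.sub (SubT.apTs
      (SubT.mono hg (List.Subset.trans hΔ hΔ')) ((hx.append hw).mono (List.Subset.trans hΔ hΔ'))))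
  | all A ih =>
    rw [pos_all] at hx
    rw [neg_all] at hy
    rw [J_all_iff hx.length_left hy.length] at h
    rw [J_all_iff hx.length_right hy.length]
    exact fun t => ih (h t) hy hx
  | ex A ih =>
    rw [pos_ex] at hx
    rw [neg_ex] at hy
    have hy' : y.length = (hdn.neg A).length := by simpa using hy.length
    rw [J_ex] at h ⊢
    refine h.exE' fun Δ t hΔ h => .exI t ?_
    rw [JB_all_inst hx.length_left hy', JB_iff hx.length_left hy'] at h
    rw [JB_all_inst hx.length_right hy', JB_iff hx.length_right hy']
    exact fun Δ' z hΔ' hz => ih (h Δ' z hΔ' hz) hz.typs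
      (SubT.mono hx (List.Subset.trans hΔ hΔ'))

theorem J_ex_intro {A : Fm} {θ : ℕ → Tm} {x S : List Tm} (hx : x.length = (hdn.pos A).length)
    (hS : S.length = (hdn.neg A).length) (t : Tm) (h : Der (NHA e) Γ (JB A (scons t θ) x S)) :
    Der (NHA e) Γ (J (.ex A) θ x S) := by
  rw [J_ex]
  exact .exI t (by rwa [JB_all_inst hx hS])

theorem J_ex_elim {A C : Fm} {θ : ℕ → Tm} {x S : List Tm} (hx : x.length = (hdn.pos A).length)
    (hS : S.length = (hdn.neg A).length) (h : Der (NHA e) Γ (J (.ex A) θ x S))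
    (hC : ∀ Δ t, Γ ⊆ Δ → Der (NHA e) Δ (JB A (scons t θ) x S) → Der (NHA e) Δ C) :
    Der (NHA e) Γ C := by
  rw [J_ex] at h
  exact h.exE' fun Δ t hΔ h => hC Δ t hΔ (by rwa [JB_all_inst hx hS] at h)

/-- Bounded interpretations are antitone in the bounding sets, which lets hypotheses be tested
against larger sets than necessary. -/
theorem JB_sub {A : Fm} {θ : ℕ → Tm} {x S S' : List Tm} (h : Der (NHA e) Γ (JB A θ x S'))
    (hx : x.length = (hdn.pos A).length)
    (hS : SubT e Γ ((hdn.neg A).map Ty.star) S S') : Der (NHA e) Γ (JB A θ x S) := by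
  rw [JB_iff hx (by simpa using hS.length_right)] at h
  rw [JB_iff hx (by simpa using hS.length_left)]
  exact fun Δ y hΔ hy => h Δ y hΔ (hy.sub (hS.mono hΔ))

end

/-! ## Witnessable sequents -/

section
variable {Γ Δ : List Fm} {A B : Fm} {θ : ℕ → Tm}

theorem RepT.curry_sub {σs ρs τs : List Ty} {F : List Tm → List Tm}
    (h : RepT (σs ++ ρs) τs F) :
    ∃ G, RepT σs (τs.map (arrs ρs)) G ∧ ∀ (Γ : List Fm) (xs ys : List Tm), Typs e Γ σs xs →
      Typs e Γ ρs ys → SubT e Γ τs (F (xs ++ ys)) (HDN.apTs ρs τs (G xs) ys) ∧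
        SubT e Γ τs (HDN.apTs ρs τs (G xs) ys) (F (xs ++ ys)) := by
  obtain ⟨G, hG, h'⟩ := h.curry (e := e)
  refine ⟨G, hG, fun Γ xs ys hx hy => ?_⟩
  have ht := (hG.ty hx).apTs hy
  exact ⟨((h' Γ xs ys hx hy).symm ht).sub (h.ty (hx.append hy)), (h' Γ xs ys hx hy).sub ht⟩

/-- The types of the witnesses of a context. -/
def posC (Γ : List Fm) : List Ty := Γ.flatMap hdn.pos

/-- The types of the bounds for the counter-witnesses of a context. -/
def bnegC (Γ : List Fm) : List Ty := Γ.flatMap hdn.bneg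

/-- The bounded interpretations of the formulas of a context are derivable. -/
def BC (e : Bool) (Δ : List Fm) (θ : ℕ → Tm) : List Fm → List Tm → List Tm → Prop
  | [], _, _ => True
  | A :: Γ, x, S =>
      Der (NHA e) Δ (JB A θ (x.take (hdn.pos A).length) (S.take (hdn.neg A).length)) ∧
        BC e Δ θ Γ (x.drop (hdn.pos A).length) (S.drop (hdn.neg A).length)

theorem BC.mono {Γ' : List Fm} {x S : List Tm} (h : BC e Γ θ Γ' x S) (hΔ : Γ ⊆ Δ) :
    BC e Δ θ Γ' x S := by
  induction Γ' generalizing x S with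
  | nil => trivial
  | cons A Γ' ih => exact ⟨h.1.mono hΔ, ih h.2⟩

theorem BC_cons {x S xs Ss : List Tm} (hx : x.length = (hdn.pos A).length)
    (hS : S.length = (hdn.neg A).length) :
    BC e Δ θ (A :: Γ) (x ++ xs) (S ++ Ss) ↔ Der (NHA e) Δ (JB A θ x S) ∧ BC e Δ θ Γ xs Ss := by
  rw [BC, List.take_left' hx, List.take_left' hS, List.drop_left' hx, List.drop_left' hS]

theorem BC_sub {x S S' : List Tm} (h : BC e Δ θ Γ x S')
    (hx : Typs e Δ (posC Γ) x) (hS : SubT e Δ (bnegC Γ) S S') : BC e Δ θ Γ x S := by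
  induction Γ generalizing x S S' with
  | nil => trivial
  | cons A Γ ih =>
    obtain ⟨S₁, S₂, S₁', S₂', rfl, rfl, h₁, h₂⟩ :=
      All₃.of_append (σs := (hdn.neg A).map Ty.star) (τs := bnegC Γ) hS
    obtain ⟨x₁, x₂, rfl, hx₁, hx₂⟩ := Typs.of_append (σs := hdn.pos A) (τs := posC Γ) hx
    rw [BC_cons hx₁.length (by simpa using h₁.length_right)] at h
    rw [BC_cons hx₁.length (by simpa using h₁.length_left)]
    exact ⟨JB_sub h.1 hx₁.length h₁, ih h.2 hx₂ h₂⟩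

theorem BC_map_subst (η : ℕ → Tm) (x S : List Tm) :
    BC e Δ θ (Γ.map fun B => B.subst η) x S ↔ BC e Δ (fun i => (η i).subst θ) Γ x S := by
  induction Γ generalizing x S with
  | nil => rfl
  | cons A Γ ih => simp [BC, ih, JB_of_subst]

/-- The sequent `Γ ⊢ A` has definable realizers. -/
def Wit (e : Bool) (Γ : List Fm) (A : Fm) : Prop :=
  ∃ γ a : List Tm → List Tm, RepT (posC Γ ++ hdn.neg A) (bnegC Γ) γ ∧
    RepT (posC Γ) (hdn.pos A) a ∧
    ∀ (Δ : List Fm) (θ : ℕ → Tm) (x w : List Tm), Typs e Δ (posC Γ) x →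
      Typs e Δ (hdn.neg A) w → BC e Δ θ Γ x (γ (x ++ w)) → Der (NHA e) Δ (J A θ (a x) w)

theorem posC_cons : posC (A :: Γ) = hdn.pos A ++ posC Γ := rfl

theorem bnegC_cons : bnegC (A :: Γ) = (hdn.neg A).map Ty.star ++ bnegC Γ := rfl

theorem JB_elim {x y S : List Tm} (h : Der (NHA e) Γ (JB A θ x S))
    (hx : x.length = (hdn.pos A).length) (hy : InT e Γ (hdn.neg A) y S) :
    Der (NHA e) Γ (J A θ x y) :=
  (JB_iff hx hy.length_right).1 h Γ y (List.Subset.refl _) hy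

/-- The witness is copied, and the hypothesis is tested against the singleton of the given
counter-witness. The other hypotheses receive arbitrary bounds. -/
theorem Wit.hyp_head : Wit e (A :: Γ) A := by
  obtain ⟨G, hG, h⟩ := RepT.singleton (e := e) (RepT.snd (σs := posC (A :: Γ)) (τs := hdn.neg A))
  obtain ⟨D, hD⟩ := RepT.exists (posC (A :: Γ) ++ hdn.neg A) (bnegC Γ)
  refine ⟨_, _, hG.append hD, RepT.fst (σs := hdn.pos A) (τs := posC Γ),
    fun Δ θ x w hx hw hB => ?_⟩
  have hxw := hx.append hw
  have hin := h Δ (x ++ w) hxw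
  rw [List.drop_left' hx.length] at hin
  obtain ⟨x₁, x₂, rfl, hx₁, hx₂⟩ := Typs.of_append (σs := hdn.pos A) (τs := posC Γ) hx
  rw [BC_cons hx₁.length hin.length_right] at hB
  rw [List.take_left' hx₁.length]
  exact JB_elim hB.1 hx₁.length hin

theorem Wit.weaken (h : Wit e Γ A) (B : Fm) : Wit e (B :: Γ) A := by
  obtain ⟨γ, a, hγ, ha, h⟩ := h
  obtain ⟨D, hD⟩ := RepT.exists (posC (B :: Γ) ++ hdn.neg A) ((hdn.neg B).map Ty.star)
  have hs : RepT (posC (B :: Γ) ++ hdn.neg A) (posC Γ ++ hdn.neg A)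
      fun z => z.drop (hdn.pos B).length := by
    rw [posC_cons, List.append_assoc]
    exact .snd
  refine ⟨_, _, hD.append (hγ.comp hs), ha.comp (RepT.snd (σs := hdn.pos B) (τs := posC Γ)),
    fun Δ θ x w hx hw hB => ?_⟩
  have hl := hD.ty (hx.append hw) |>.length
  obtain ⟨x₁, x₂, rfl, hx₁, hx₂⟩ := Typs.of_append (σs := hdn.pos B) (τs := posC Γ) hx
  rw [BC_cons hx₁.length (by simpa using hl), List.append_assoc,
    List.drop_left' hx₁.length] at hB
  rw [List.drop_left' hx₁.length]
  exact h Δ θ x₂ w hx₂ hw hB.2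

theorem Wit.hyp (h : A ∈ Γ) : Wit e Γ A := by
  induction Γ with
  | nil => simp at h
  | cons B Γ ih =>
    rcases List.mem_cons.1 h with rfl | h
    · exact .hyp_head
    · exact (ih h).weaken B

theorem Wit.of_nil (h : Wit e [] A) : Wit e Γ A := by
  induction Γ with
  | nil => exact h
  | cons B Γ ih => exact ih.weaken B

/-- Currying in the witness of `A` gives `f`; the part of the bounds that concerns `A` is curried
into `g`, and the rest remains the bound for `Γ`. Curried and original values differ by provable
equality only, hence include each other. -/
theorem Wit.impI (h : Wit e (A :: Γ) B) : Wit e Γ (.imp A B) := by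
  obtain ⟨γ, b, hγ, hb, h⟩ := h
  let n := (posC Γ).length
  let m := (hdn.pos A).length
  -- The context lists the witness of `A` first, whereas currying abstracts trailing arguments.
  have hsw : RepT (posC Γ ++ hdn.pos A) (posC (A :: Γ)) fun z => z.drop n ++ z.take n :=
    RepT.snd.append .fst
  obtain ⟨f, hf, hf'⟩ := (hb.comp hsw).curry_sub (e := e)
  have hsw' : RepT (posC Γ ++ (hdn.pos A ++ hdn.neg B)) (posC (A :: Γ) ++ hdn.neg B)
      fun z => (z.drop n).take m ++ z.take n ++ (z.drop n).drop m :=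
    ((RepT.fst.comp .snd).append .fst).append (RepT.snd.comp .snd)
  have hγ' := hγ.comp hsw'
  rw [bnegC_cons] at hγ'
  obtain ⟨g, hg, hg'⟩ := hγ'.take.curry_sub (e := e)
  refine ⟨_, _, hγ'.drop, hf.append hg, fun Δ θ x xw hx hxw hB => ?_⟩
  obtain ⟨xA, w, rfl, hxA, hw⟩ := Typs.of_append (σs := hdn.pos A) (τs := hdn.neg B) hxw
  have hfx := hf.ty hx
  rw [J_imp_iff (by simpa using hfx.length) hxA.length]
  intro Δ' hΔ hA
  have hx := hx.mono hΔ
  have hxA := hxA.mono hΔ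
  have hw := hw.mono hΔ
  have hf' := hf' Δ' x xA hx hxA
  have hg' := hg' Δ' x (xA ++ w) hx (hxA.append hw)
  have hl := (hγ'.ty (hx.append (hxA.append hw))).length
  simp only [List.take_left' hx.length, List.drop_left' hx.length, n] at hf' hg' hB hl
  simp only [m, List.take_left' hxA.length, List.drop_left' hxA.length] at hg' hB hl
  refine J_mono (h Δ' θ (xA ++ x) w (hxA.append hx) hw ?_) hw hf'.1
  rw [← List.take_append_drop ((hdn.neg A).map Ty.star).length (γ (xA ++ x ++ w)),
    BC_cons hxA.length (by rw [List.length_take, hl]; simp)]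
  exact ⟨JB_sub hA hxA.length hg'.1, hB.mono hΔ⟩

/-- The witness is `f` applied to the witness `a` of `A`. The context must withstand the first
premise at `a, w`, and the second premise at every counter-witness in the finite set `g a w`; the
bound is the union of the former with the union over the latter. -/
theorem Wit.impE (h₁ : Wit e Γ (.imp A B)) (h₂ : Wit e Γ A) : Wit e Γ B := by
  obtain ⟨γ₁, f, hγ₁, hf, h₁⟩ := h₁
  obtain ⟨γ₂, a, hγ₂, ha, h₂⟩ := h₂
  rw [neg_imp] at hγ₁
  rw [pos_imp] at hf
  have hx : RepT (posC Γ ++ hdn.neg B) (posC Γ) _ := .fst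
  have haw : RepT (posC Γ ++ hdn.neg B) (hdn.pos A ++ hdn.neg B)
      fun z => a (z.take (posC Γ).length) ++ z.drop (posC Γ).length := ha.weaken.append .snd
  have hg : RepT (posC Γ ++ hdn.neg B) ((hdn.neg A).map Ty.star) _ :=
    hf.drop.weaken.apTs haw
  have hG : RepT (posC Γ ++ hdn.neg B ++ hdn.neg A) (bnegC Γ) fun z =>
      γ₂ ((z.take (posC Γ ++ hdn.neg B).length).take (posC Γ).length ++
        z.drop (posC Γ ++ hdn.neg B).length) :=
    hγ₂.comp (hx.weaken.append .snd)
  obtain ⟨U, hU, hU'⟩ := hG.bigUnion (e := e) hg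
  have hγ₁' := hγ₁.comp (hx.append haw)
  -- Concatenation requires the bounds to be displayed as sequence types.
  have hbn : bnegC Γ = (Γ.flatMap hdn.neg).map Ty.star := by
    rw [List.map_flatMap]; rfl
  obtain ⟨γ, hγ, hγ'⟩ := RepT.union (e := e) (by rw [← hbn]; exact hγ₁') (by rw [← hbn]; exact hU)
  rw [← hbn] at hγ hγ'
  refine ⟨γ, _, hγ, hf.take.apTs ha, fun Δ θ x w hx hw hB => ?_⟩
  have hxw := hx.append hw
  have hγ' := hγ' Δ _ hxw
  simp only [List.take_left' hx.length, List.drop_left' hx.length] at hγ'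
  have hax := ha.ty hx
  have hfx := hf.ty hx
  have hBf := h₁ Δ θ x (a x ++ w) hx (hax.append hw) (BC_sub hB hx hγ'.1)
  rw [← List.take_append_drop ((hdn.pos B).map (arrs (hdn.pos A))).length (f x),
    J_imp_iff (by rw [List.length_take, hfx.length]; simp) hax.length] at hBf
  have hl := (hg.ty hxw).length
  simp only [List.take_left' hx.length, List.drop_left' hx.length] at hl
  refine hBf Δ (List.Subset.refl _) ?_
  rw [JB_iff hax.length (by simpa using hl)]
  intro Δ' y hΔ hy
  refine h₂ Δ' θ x y (hx.mono hΔ) hy.typs ?_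
  refine BC_sub (hB.mono hΔ) (hx.mono hΔ) ?_
  have := hU' Δ' (x ++ w) y (hxw.mono hΔ)
    (by simpa only [List.take_left' hx.length, List.drop_left' hx.length] using hy)
  simp only [List.take_left' hxw.length, List.drop_left' hxw.length,
    List.take_left' hx.length] at this
  exact this.trans (hγ'.2.mono hΔ)

/-- All of `Δ` is discharged into implications and modus ponens is applied in `Γ`. Rules and axioms
may therefore be realized as sequents with only their own premises as context. -/
theorem Wit.cut (h : Wit e Δ A) (hΓ : ∀ B ∈ Δ, Wit e Γ B) : Wit e Γ A := by
  induction Δ generalizing A with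
  | nil => exact h.of_nil
  | cons B Δ ih =>
    exact (ih h.impI fun C hC => hΓ C (List.mem_cons_of_mem _ hC)).impE (hΓ B List.mem_cons_self)

theorem posC_map_wk (n : ℕ) : posC (Γ.map (Fm.wk n)) = posC Γ := by
  simp [posC, List.flatMap_map]

theorem bnegC_map_wk (n : ℕ) : bnegC (Γ.map (Fm.wk n)) = bnegC Γ := by
  simp [bnegC, List.flatMap_map]
  rfl

/-- Realizers do not depend on the environment, so the same ones serve for every value `t` of the
eigenvariable; the weakened context does not see that value. -/
theorem Wit.allI (h : Wit e (Γ.map (Fm.wk 1)) A) : Wit e Γ (.all A) := by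
  obtain ⟨γ, a, hγ, ha, h⟩ := h
  rw [posC_map_wk, bnegC_map_wk] at hγ
  rw [posC_map_wk] at ha h
  refine ⟨γ, a, hγ, ha, fun Δ θ x w hx hw hB => ?_⟩
  rw [J_all_iff (ha.ty hx).length hw.length]
  refine fun t => h Δ (scons t θ) x w hx hw ?_
  exact (BC_map_subst _ _ _).2 hB

/-! ### Sequents with one or two premises -/

theorem Wit.of_one {γ a : List Tm → List Tm}
    (hγ : RepT (hdn.pos B ++ hdn.neg A) ((hdn.neg B).map Ty.star) γ)
    (ha : RepT (hdn.pos B) (hdn.pos A) a)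
    (h : ∀ (Δ : List Fm) (θ : ℕ → Tm) (x w : List Tm), Typs e Δ (hdn.pos B) x →
      Typs e Δ (hdn.neg A) w → Der (NHA e) Δ (JB B θ x (γ (x ++ w))) →
      Der (NHA e) Δ (J A θ (a x) w)) : Wit e [B] A := by
  refine ⟨γ, a, by simpa [posC, bnegC] using hγ, by simpa [posC] using ha,
    fun Δ θ x w hx hw hB => ?_⟩
  have hx : Typs e Δ (hdn.pos B) x := by simpa [posC] using hx
  have hl := (hγ.ty (hx.append hw)).length
  rw [← List.append_nil x, ← List.append_nil (γ _), BC_cons hx.length (by simpa using hl)] at hB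
  exact h Δ θ x w hx hw (by simpa using hB.1)

theorem Wit.of_two {B₁ B₂ : Fm} {γ₁ γ₂ a : List Tm → List Tm}
    (hγ₁ : RepT (hdn.pos B₁ ++ hdn.pos B₂ ++ hdn.neg A) ((hdn.neg B₁).map Ty.star) γ₁)
    (hγ₂ : RepT (hdn.pos B₁ ++ hdn.pos B₂ ++ hdn.neg A) ((hdn.neg B₂).map Ty.star) γ₂)
    (ha : RepT (hdn.pos B₁ ++ hdn.pos B₂) (hdn.pos A) a)
    (h : ∀ (Δ : List Fm) (θ : ℕ → Tm) (x₁ x₂ w : List Tm), Typs e Δ (hdn.pos B₁) x₁ →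
      Typs e Δ (hdn.pos B₂) x₂ →
      Typs e Δ (hdn.neg A) w → Der (NHA e) Δ (JB B₁ θ x₁ (γ₁ (x₁ ++ x₂ ++ w))) →
      Der (NHA e) Δ (JB B₂ θ x₂ (γ₂ (x₁ ++ x₂ ++ w))) →
      Der (NHA e) Δ (J A θ (a (x₁ ++ x₂)) w)) : Wit e [B₁, B₂] A := by
  refine ⟨_, a, by simpa [posC, bnegC] using hγ₁.append hγ₂, by simpa [posC] using ha,
    fun Δ θ x w hx hw hB => ?_⟩
  have hx : Typs e Δ (hdn.pos B₁ ++ hdn.pos B₂) x := by simpa [posC] using hx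
  have hl₁ := (hγ₁.ty (hx.append hw)).length
  have hl₂ := (hγ₂.ty (hx.append hw)).length
  obtain ⟨x₁, x₂, rfl, hx₁, hx₂⟩ := hx.of_append
  rw [BC_cons hx₁.length (by simpa using hl₁), ← List.append_nil x₂, ← List.append_nil (γ₂ _),
    BC_cons hx₂.length (by simpa using hl₂)] at hB
  exact h Δ θ x₁ x₂ w hx₁ hx₂ hw (by simpa using hB.1) (by simpa using hB.2.1)

theorem Wit.botE (A : Fm) : Wit e [.bot] A := by
  obtain ⟨a, ha⟩ := RepT.exists (hdn.pos .bot) (hdn.pos A)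
  refine .of_one (γ := fun _ => []) .nil ha fun Δ θ x w hx hw hB => ?_
  exact (JB_elim hB hx.length .nil).exfalso

theorem Wit.andI (A B : Fm) : Wit e [A, B] (.and A B) := by
  obtain ⟨G₁, hG₁, h₁⟩ := RepT.singleton (e := e)
    (RepT.fst.comp (RepT.snd (σs := hdn.pos A ++ hdn.pos B) (τs := hdn.neg A ++ hdn.neg B)))
  obtain ⟨G₂, hG₂, h₂⟩ := RepT.singleton (e := e)
    (RepT.snd.comp (RepT.snd (σs := hdn.pos A ++ hdn.pos B) (τs := hdn.neg A ++ hdn.neg B)))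
  refine .of_two hG₁ hG₂ .id fun Δ θ x v yw hx hv hyw hA hB => ?_
  obtain ⟨y, w, rfl, hy, hw⟩ := Typs.of_append (σs := hdn.neg A) (τs := hdn.neg B) hyw
  have hxv := hx.append hv
  have h₁ := h₁ Δ _ (hxv.append (hy.append hw))
  have h₂ := h₂ Δ _ (hxv.append (hy.append hw))
  rw [List.drop_left' hxv.length, List.take_left' hy.length] at h₁
  rw [List.drop_left' hxv.length, List.drop_left' hy.length] at h₂
  rw [J_and_iff hx.length hy.length]
  exact ⟨JB_elim hA hx.length h₁, JB_elim hB hv.length h₂⟩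

theorem Wit.andE₁ (A B : Fm) : Wit e [.and A B] A := by
  obtain ⟨d, hd⟩ := RepT.exists (hdn.pos A ++ hdn.pos B ++ hdn.neg A) (hdn.neg B)
  obtain ⟨G, hG, h⟩ := RepT.singleton (e := e) (RepT.snd.append hd)
  refine .of_one (B := .and A B) hG .fst fun Δ θ xv w hxv hw hB => ?_
  rw [pos_and] at hxv
  have hd := hd.ty (hxv.append hw)
  have h := h Δ _ (hxv.append hw)
  rw [List.drop_left' hxv.length] at h
  have hB := JB_elim hB hxv.length h
  obtain ⟨x, v, rfl, hx, hv⟩ := Typs.of_append (σs := hdn.pos A) (τs := hdn.pos B) hxv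
  rw [J_and_iff hx.length hw.length] at hB
  exact (List.take_left' hx.length).symm ▸ hB.1

theorem Wit.andE₂ (A B : Fm) : Wit e [.and A B] B := by
  obtain ⟨d, hd⟩ := RepT.exists (hdn.pos A ++ hdn.pos B ++ hdn.neg B) (hdn.neg A)
  obtain ⟨G, hG, h⟩ := RepT.singleton (e := e) (hd.append RepT.snd)
  refine .of_one (B := .and A B) hG .snd fun Δ θ xv w hxv hw hB => ?_
  rw [pos_and] at hxv
  have hd := hd.ty (hxv.append hw)
  have h := h Δ _ (hxv.append hw)
  rw [List.drop_left' hxv.length] at h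
  have hB := JB_elim hB hxv.length h
  obtain ⟨x, v, rfl, hx, hv⟩ := Typs.of_append (σs := hdn.pos A) (τs := hdn.pos B) hxv
  rw [J_and_iff hx.length hd.length] at hB
  exact (List.drop_left' hx.length).symm ▸ hB.2

theorem J_inst (A : Fm) (t : Tm) (θ : ℕ → Tm) (x y : List Tm) :
    J (A.inst t) θ x y = J A (scons (t.subst θ) θ) x y := by
  rw [Fm.inst, J_of_subst, single_subst]

theorem JB_inst (A : Fm) (t : Tm) (θ : ℕ → Tm) (x y : List Tm) :
    JB (A.inst t) θ x y = JB A (scons (t.subst θ) θ) x y := by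
  rw [Fm.inst, JB_of_subst, single_subst]

theorem Wit.allE (A : Fm) (t : Tm) : Wit e [.all A] (A.inst t) := by
  obtain ⟨G, hG, h⟩ := RepT.singleton (e := e) (RepT.snd (σs := hdn.pos A) (τs := hdn.neg A))
  refine .of_one (by simpa using hG) (by simpa using (.id : RepT (hdn.pos A) (hdn.pos A) _))
    fun Δ θ x w hx hw hB => ?_
  rw [neg_inst] at hw
  rw [pos_all] at hx
  have h := h Δ _ (hx.append hw)
  rw [List.drop_left' (Typs.length hx)] at h
  have hB := JB_elim hB hx.length h
  rw [J_all_iff hx.length hw.length] at hB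
  rw [J_inst]
  exact hB _

/-- A counter-witness of the existential formula already is a tuple of bounding sets for the
instance, so it is handed on without forming singletons. -/
theorem Wit.exI (A : Fm) (t : Tm) : Wit e [A.inst t] (.ex A) := by
  have hγ : RepT (hdn.pos A ++ (hdn.neg A).map Ty.star) ((hdn.neg A).map Ty.star) _ := .snd
  refine .of_one (by simpa using hγ) (by simpa using (.id : RepT (hdn.pos A) (hdn.pos A) _))
    fun Δ θ x w hx hw hB => ?_
  rw [pos_inst] at hx
  rw [List.drop_left' hx.length, JB_inst] at hB
  exact J_ex_intro hx.length (by simpa [neg_ex] using hw.length) _ hB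

/-- The implication is tested at the single counter-witness `x, w`. The existential is tested at the
singleton of the tuple of sets `g x w`, which is exactly the bound the implication demands of `A`.
-/
theorem Wit.exE (A B : Fm) : Wit e [.all (.imp A (B.wk 1)), .ex A] B := by
  have hfg : RepT (hdn.pos (.imp A B) ++ hdn.pos A ++ hdn.neg B) (hdn.pos (.imp A B)) _ :=
    RepT.fst.weaken
  have hxw : RepT (hdn.pos (.imp A B) ++ hdn.pos A ++ hdn.neg B) (hdn.pos A ++ hdn.neg B) _ :=
    RepT.snd.weaken.append .snd
  obtain ⟨G₁, hG₁, h₁⟩ := RepT.singleton (e := e) hxw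
  have hg : RepT (hdn.pos (.imp A B) ++ hdn.pos A ++ hdn.neg B) ((hdn.neg A).map Ty.star) _ :=
    (hfg.drop (τs := (hdn.pos B).map (arrs (hdn.pos A)))
      (ρs := ((hdn.neg A).map Ty.star).map (arrs (hdn.pos A ++ hdn.neg B)))).apTs hxw
  obtain ⟨G₂, hG₂, h₂⟩ := RepT.singleton (e := e) hg
  have ha : RepT (hdn.pos (.imp A B) ++ hdn.pos A) (hdn.pos B) _ :=
    ((RepT.fst (σs := hdn.pos (.imp A B)) (τs := hdn.pos A)).take
      (τs := (hdn.pos B).map (arrs (hdn.pos A)))).apTs .snd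
  refine .of_two (by simpa [pos_all, pos_imp, neg_all, neg_imp] using hG₁)
    (by simpa [pos_all, pos_ex, neg_ex, pos_imp] using hG₂)
    (a := fun z => apTs (hdn.pos A) (hdn.pos B)
      ((z.take (hdn.pos (.imp A B)).length).take ((hdn.pos B).map (arrs (hdn.pos A))).length)
      (z.drop (hdn.pos (.imp A B)).length)) (by simpa using ha) fun Δ θ fg x w hfg hx hw hA hE => ?_
  have hfg : Typs e Δ (hdn.pos (.imp A B)) fg := by simpa [pos_all, pos_imp] using hfg
  rw [pos_ex] at hx
  have hfgx := hfg.append hx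
  have h₁ := h₁ Δ _ (hfgx.append hw)
  have h₂ := h₂ Δ _ (hfgx.append hw)
  simp only [List.take_left' hfgx.length, List.drop_left' hfgx.length,
    List.take_left' hfg.length, List.drop_left' hfg.length] at h₁ h₂ ⊢
  have hE := JB_elim hE hx.length h₂
  have hA := JB_elim hA (by simpa [pos_all, pos_imp] using hfg.length)
    (by simpa [neg_all, neg_imp] using h₁)
  rw [J_all_iff (by simpa [pos_imp] using hfg.length)
    (by simpa [neg_imp] using (hx.append hw).length)] at hA
  refine J_ex_elim hx.length (by simpa using h₂.typs.length) hE fun Δ' t hΔ hE => ?_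
  have hA := (hA t).mono hΔ
  rw [pos_imp] at hfg
  rw [← List.take_append_drop ((hdn.pos B).map (arrs (hdn.pos A))).length fg,
    J_imp_iff (by simp [hfg.length]) hx.length] at hA
  have := hA Δ' (List.Subset.refl _) (by simpa using hE)
  rw [Fm.wk, J_of_subst] at this
  simpa using this

end

section
variable {Γ Δ : List Fm} {A B : Fm} {θ : ℕ → Tm}

/-! ### The axioms -/

theorem J_repl {τ : Ty} {s t : Tm} {x y : List Tm} (h : Der (NHA e) Γ (.eq τ s t))
    (hx : x.length = (hdn.pos A).length) (hy : y.length = (hdn.neg A).length)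
    (hs : Der (NHA e) Γ (J A (scons s θ) x y)) : Der (NHA e) Γ (J A (scons t θ) x y) := by
  rw [← J_all_inst hx hy] at hs ⊢
  exact h.repl _ hs

theorem JB_of_neg_nil (h : hdn.neg A = []) (x S : List Tm) : JB A θ x S = J A θ x [] := by
  rw [JB, h]
  simp [memAll, bvs, show Tm.wk 0 = id from funext Tm.wk_zero]

theorem BC_mem {x S : List Tm} (h : BC e Δ θ Γ x S) (hx : x.length = (posC Γ).length)
    (hB : B ∈ Γ) (hn : hdn.neg B = []) :
    ∃ xB : List Tm, xB.length = (hdn.pos B).length ∧ Der (NHA e) Δ (J B θ xB []) := by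
  induction Γ generalizing x S with
  | nil => simp at hB
  | cons A Γ ih =>
    rw [posC_cons, List.length_append] at hx
    rcases List.mem_cons.1 hB with rfl | hB
    · refine ⟨_, ?_, by simpa only [JB_of_neg_nil hn] using h.1⟩
      rw [List.length_take]
      omega
    · exact ih h.2 (by rw [List.length_drop]; omega) hB

/-- For a sequent with hypotheses free of counter-witnesses and a conclusion free of witnesses there
is nothing to construct; only provability of the interpretations remains. -/
theorem Wit.of_neg_nil (hΓ : ∀ B ∈ Γ, hdn.neg B = []) (hA : hdn.pos A = [])
    (h : ∀ (Δ : List Fm) (θ : ℕ → Tm) (w : List Tm),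
      (∀ B ∈ Γ, ∃ xB : List Tm, xB.length = (hdn.pos B).length ∧
        Der (NHA e) Δ (J B θ xB [])) →
      Typs e Δ (hdn.neg A) w → Der (NHA e) Δ (J A θ [] w)) : Wit e Γ A := by
  have hb : bnegC Γ = [] := by
    rw [bnegC, List.flatMap_eq_nil_iff]
    intro B hB
    simp [hΓ B hB]
  refine ⟨fun _ => [], fun _ => [], hb ▸ .nil, hA ▸ .nil, fun Δ θ x w hx hw hB => ?_⟩
  exact h Δ θ w (fun B hB' => BC_mem hB hx.length hB' (hΓ B hB')) hw

/-- Quantifier-free formulas and typings, which are implied by their interpretations. -/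
def Fm.Simple (A : Fm) : Prop := A.QF ∨ ∃ τ t, A = .typ τ t

theorem Fm.QF.types (h : A.QF) : hdn.pos A = [] ∧ hdn.neg A = [] := by
  induction A with
  | eq | bot => exact ⟨rfl, rfl⟩
  | and A B ihA ihB => simp [ihA h.1, ihB h.2]
  | imp A B ihA ihB => simp [ihA h.1, ihB h.2]
  | _ => exact h.elim

/-- Equality is non-computational, so formulas built from equations by propositional connectives
carry no data. -/
theorem Fm.QF.J_eq (h : A.QF) (θ : ℕ → Tm) (x y : List Tm) : J A θ x y = A.subst θ := by
  induction A generalizing x y with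
  | eq | bot => rfl
  | and A B ihA ihB => rw [J_and, ihA h.1, ihB h.2]; rfl
  | imp A B ihA ihB =>
    rw [J_imp, JB_of_neg_nil (Fm.QF.types h.1).2, ihA h.1, ihB h.2]
    rfl
  | _ => exact h.elim

theorem Fm.Simple.neg_nil (h : A.Simple) : hdn.neg A = [] := by
  rcases h with h | ⟨τ, t, rfl⟩
  · exact h.types.2
  · rfl

theorem Fm.Simple.of_J (h : A.Simple) {x y : List Tm} (hA : Der (NHA e) Γ (J A θ x y)) :
    Der (NHA e) Γ (A.subst θ) := by
  rcases h with h | ⟨τ, t, rfl⟩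
  · rwa [h.J_eq] at hA
  · rw [J_typ] at hA
    exact hA.andE₁

theorem J_allT_iff {τ : Ty} {b : Tm} {f y : List Tm} (hf : f.length = (hdn.pos A).length)
    (hy : y.length = (hdn.neg A).length) :
    Der (NHA e) Γ (J (.allT τ A) θ f (b :: y)) ↔
      ∀ Δ t, Γ ⊆ Δ → In e Δ τ t b →
        Der (NHA e) Δ (J A (scons t θ) (apTs [.star τ] (hdn.pos A) f [b]) y) := by
  rw [Fm.allT, J_all_iff (by simpa using hf) (by simpa using hy)]
  have key : ∀ t, Der (NHA e) Γ (J (.imp (.typ τ (.var 0)) A) (scons t θ) f (b :: y)) ↔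
      ∀ Δ, Γ ⊆ Δ → In e Δ τ t b →
        Der (NHA e) Δ (J A (scons t θ) (apTs [.star τ] (hdn.pos A) f [b]) y) := by
    intro t
    have := J_imp_iff (e := e) (Γ := Γ) (A := .typ τ (.var 0)) (B := A) (θ := scons t θ) (g := [])
      (x := [b]) (w := y) hf rfl
    rw [List.append_nil] at this
    simp only [JB_of_neg_nil (neg_typ _ _), J_typ, Der.and_iff] at this
    exact this
  simp only [key]
  exact ⟨fun h Δ t hΔ ht => h t Δ hΔ ht, fun h t Δ hΔ ht => h Δ t hΔ ht⟩

/-! ### Extensional equality and the equational axioms -/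

theorem pos_extEq (τ : Ty) (s t : Tm) : hdn.pos (extEq τ s t) = [] := by
  induction τ generalizing s t with
  | arr σ τ _ ih => simp [extEq, Fm.allT, ih]
  | _ => rfl

/-- The interpretation merely relativises each argument quantifier to an arbitrary finite set.
Relativising loses nothing, as every typed object is an entry of its singleton. -/
theorem J_extEq_iff {τ : Ty} {s t : Tm} :
    Der (NHA e) Γ ((extEq τ s t).subst θ) ↔
      ∀ Δ w, Γ ⊆ Δ → Typs e Δ (hdn.neg (extEq τ s t)) w →
        Der (NHA e) Δ (J (extEq τ s t) θ [] w) := by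
  have hbase : ∀ {σ : Ty}, Der (NHA e) Γ ((Fm.eq σ s t).subst θ) ↔
      ∀ Δ w, Γ ⊆ Δ → Typs e Δ (hdn.neg (Fm.eq σ s t)) w →
        Der (NHA e) Δ (J (.eq σ s t) θ [] w) :=
    ⟨fun h Δ w hΔ _ => h.mono hΔ, fun h => h Γ [] (List.Subset.refl _) .nil⟩
  induction τ generalizing Γ s t θ with
  | bool => exact hbase
  | nat => exact hbase
  | star τ => exact hbase
  | arr σ τ _ ih =>
    clear hbase
    have ih := fun Γ θ => @ih Γ θ (.ap σ τ (s.wk 1) (.var 0)) (.ap σ τ (t.wk 1) (.var 0))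
      ⟨fun h Δ w hΔ _ => h.mono hΔ, fun h => h Γ [] (List.Subset.refl _) .nil⟩
    set E := extEq τ (.ap σ τ (s.wk 1) (.var 0)) (.ap σ τ (t.wk 1) (.var 0)) with hE
    have hpos : hdn.pos E = [] := pos_extEq _ _ _
    rw [extEq, ← hE, Fm.allT_subst, Der.allT_iff]
    simp only [Fm.subst_up_inst, ih]
    constructor
    · intro h Δ w hΔ hw
      replace hw : Typs e Δ (.star σ :: hdn.neg E) w := hw
      cases hw with
      | cons hb hw =>
        rw [J_allT_iff (A := E) (by simp [hpos]) (Typs.length hw), hpos]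
        intro Δ' u hΔ' hu
        exact h Δ' u (List.Subset.trans hΔ hΔ') hu.1 Δ' _ (List.Subset.refl _) (Typs.mono hw hΔ')
    · intro h Δ u hΔ hu Δ' w hΔ' hw
      have hu := hu.mono hΔ'
      have := h Δ' (consT σ u (nilT σ) :: w) (List.Subset.trans hΔ hΔ')
        (.cons (hu.ty_cons (.ty_nil σ)) hw)
      rw [J_allT_iff (A := E) (by simp [hpos]) hw.length, hpos] at this
      exact this Δ' u (List.Subset.refl _) ⟨hu, .mem_cons_self hu (.ty_nil σ)⟩

theorem Der.extEq {τ : Ty} {s t : Tm} (h : Der (NHA e) Γ (.eq τ s t))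
    (hs : Der (NHA e) Γ (.typ τ s)) : Der (NHA e) Γ (extEq τ s t) := by
  induction τ generalizing Γ s t with
  | arr σ τ _ ih =>
    rw [HDN.extEq, Der.allT_iff]
    intro Δ u hΔ hu
    simpa [Fm.inst] using ih ((h.mono hΔ).congr_fun (hs.mono hΔ) hu) ((hs.mono hΔ).ty_ap hu)
  | _ => exact h

theorem Wit.of_extEq {τ : Ty} {s t : Tm} (hΓ : ∀ B ∈ Γ, B.Simple)
    (h : ∀ (Δ : List Fm) (θ : ℕ → Tm), (∀ B ∈ Γ, Der (NHA e) Δ (B.subst θ)) →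
      Der (NHA e) Δ ((extEq τ s t).subst θ)) : Wit e Γ (extEq τ s t) := by
  refine .of_neg_nil (fun B hB => (hΓ B hB).neg_nil) (pos_extEq _ _ _) fun Δ θ w hB hw => ?_
  refine J_extEq_iff.1 (h Δ θ fun B hB' => ?_) Δ w (List.Subset.refl _) hw
  obtain ⟨x, _, hx⟩ := hB B hB'
  exact (hΓ B hB').of_J hx

theorem Wit.of_eq {τ : Ty} {s t : Tm} (hΓ : ∀ B ∈ Γ, B.Simple)
    (h : ∀ (Δ : List Fm) (θ : ℕ → Tm), (∀ B ∈ Γ, Der (NHA e) Δ (B.subst θ)) →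
      Der (NHA e) Δ (.eq τ (s.subst θ) (t.subst θ)) ∧ Der (NHA e) Δ (.typ τ (s.subst θ))) :
    Wit e Γ (extEq τ s t) :=
  .of_extEq hΓ fun Δ θ hB => by
    rw [extEq_subst]
    exact (h Δ θ hB).1.extEq (h Δ θ hB).2

theorem Wit.of_QF (hΓ : ∀ B ∈ Γ, B.Simple) (hA : A.QF)
    (h : ∀ (Δ : List Fm) (θ : ℕ → Tm), (∀ B ∈ Γ, Der (NHA e) Δ (B.subst θ)) →
      Der (NHA e) Δ (A.subst θ)) : Wit e Γ A := by
  refine .of_neg_nil (fun B hB => (hΓ B hB).neg_nil) hA.types.1 fun Δ θ w hB hw => ?_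
  rw [hA.J_eq]
  refine h Δ θ fun B hB' => ?_
  obtain ⟨x, _, hx⟩ := hB B hB'
  exact (hΓ B hB').of_J hx

theorem Wit.of_ax (hΓ : ∀ B ∈ Γ, B.Simple) (hA : A.QF) (h : Ax Fm.eq Γ A) : Wit e Γ A :=
  .of_QF hΓ hA fun _ θ hB => .ax (h.subst θ) (by simpa using hB)

theorem Wit.eqRefl (τ : Ty) (x : Tm) : Wit e [.typ τ x] (.eq τ x x) := by
  refine .of_neg_nil (by simp) rfl fun Δ θ w hB _ => ?_
  obtain ⟨x, _, hx⟩ := hB _ List.mem_cons_self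
  rw [J_typ] at hx
  exact hx.andE₁.refl

theorem simple_typ (τ : Ty) (t : Tm) : (Fm.typ τ t).Simple := .inr ⟨τ, t, rfl⟩

theorem Wit.tyConst (c : Ct) : Wit e [] (.typ c.ty (.const c)) := by
  refine ⟨fun _ => [], _, .nil, Rep.cons (Rep.const c).singleton .nil, fun Δ θ x w _ _ _ => ?_⟩
  rw [J_typ]
  exact .andI (.ty_const c) (.mem_cons_self (.ty_const c) (.ty_nil _))

/-- The witness is the set of all applications of entries of `F` to entries of `X`, a union of
singletons over both sets. The actual `f` and `x` are among them without having to be identified. -/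
theorem Wit.tyAp (σ τ : Ty) (f x : Tm) :
    Wit e [.typ (.arr σ τ) f, .typ σ x] (.typ τ (.ap σ τ f x)) := by
  -- Positions 0 and 1 hold the two sets, positions 2 and 3 entries of them.
  have hF : Rep ([.star (.arr σ τ), .star σ] ++ [.arr σ τ, σ]) τ fun z =>
      .ap σ τ (z.getD 2 zeroT) (z.getD 3 zeroT) := Rep.ap (.getD rfl) (.getD rfl)
  obtain ⟨G, hG, h⟩ := (Rep.cons hF.singleton .nil).bigUnion (e := e)
    (RepT.id : RepT ([Ty.arr σ τ, σ].map Ty.star) _ _)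
  refine .of_two (γ₁ := fun _ => []) (γ₂ := fun _ => []) .nil .nil hG
    fun Δ θ F X w hF hX _ h₁ h₂ => ?_
  have hFX := hF.append hX
  rcases hF with _ | ⟨hF, _ | _⟩
  rcases hX with _ | ⟨hX, _ | _⟩
  rw [JB_of_neg_nil rfl, J_typ, Der.and_iff] at h₁ h₂
  have hfx := h₁.1.ty_ap h₂.1
  have h := h Δ _ _ hFX (.cons h₁ (.cons h₂ .nil))
  have hG := hG.ty hFX
  rw [J_typ]
  generalize hg : G _ = g at h
  rcases h with _ | ⟨h, _ | _⟩
  refine .andI hfx ?_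
  have h := h Δ _ (List.Subset.refl _) ⟨hfx, .mem_cons_self hfx (.ty_nil τ)⟩
  exact h.2

theorem Wit.eqRepl (τ : Ty) (s t : Tm) (A : Fm) : Wit e [.eq τ s t, A.inst s] (A.inst t) := by
  obtain ⟨G, hG, h⟩ := RepT.singleton (e := e) (RepT.snd (σs := hdn.pos A) (τs := hdn.neg A))
  refine .of_two (B₁ := .eq τ s t) (γ₁ := fun _ => []) .nil (by simpa using hG)
    (by simpa using (.id : RepT (hdn.pos A) (hdn.pos A) _)) fun Δ θ x₁ x w hx₁ hx hw he hA => ?_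
  rw [pos_inst] at hx
  rw [neg_inst] at hw
  cases hx₁
  have h := h Δ _ (hx.append hw)
  rw [List.drop_left' hx.length] at h
  have hA := JB_elim hA (by simpa using hx.length) (by simpa using h)
  rw [J_inst] at hA ⊢
  rw [JB_of_neg_nil rfl] at he
  exact J_repl he hx.length hw.length hA

theorem Der.ty_cond {σ : Ty} {b x y : Tm} (hb : Der (NHA e) Γ (.typ .bool b))
    (hx : Der (NHA e) Γ (.typ σ x)) (hy : Der (NHA e) Γ (.typ σ y)) :
    Der (NHA e) Γ (.typ σ (condT σ b x y)) :=
  (((Der.ty_const (.cond σ)).ty_ap hb).ty_ap hx).ty_ap hy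

/-- Componentwise definition by cases. Inclusion of the selected branch is all that is recorded, in
the form in which monotonicity uses it. -/
theorem RepT.cond {σs τs : List Ty} {b : List Tm → Tm} {F G : List Tm → List Tm}
    (hb : Rep σs .bool b) (hF : RepT σs τs F) (hG : RepT σs τs G) :
    ∃ H, RepT σs τs H ∧ ∀ (Γ : List Fm) (xs : List Tm), Typs e Γ σs xs →
      (Der (NHA e) Γ (.eq .bool (b xs) (.const .tt)) → SubT e Γ τs (F xs) (H xs)) ∧
      (Der (NHA e) Γ (.eq .bool (b xs) (.const .ff)) → SubT e Γ τs (G xs) (H xs)) := by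
  induction τs generalizing F G with
  | nil =>
    refine ⟨_, .nil, fun Γ xs hx => ?_⟩
    rw [List.length_eq_zero_iff.1 (hF.length hx.length),
      List.length_eq_zero_iff.1 (hG.length hx.length)]
    exact ⟨fun _ => .nil, fun _ => .nil⟩
  | cons τ τs ih =>
    obtain ⟨F₁, F₂, hF₁, hF₂, hF⟩ := hF.of_cons
    obtain ⟨G₁, G₂, hG₁, hG₂, hG⟩ := hG.of_cons
    obtain ⟨H, hH, h⟩ := ih hF₂ hG₂
    refine ⟨_, Rep.cons (Rep.ap (Rep.ap (Rep.ap (.const (.cond τ)) hb) hF₁) hG₁) hH,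
      fun Γ xs hx => ?_⟩
    rw [hF xs hx.length, hG xs hx.length]
    have ht : ∀ {c}, Der (NHA e) Γ (.typ .bool c) →
        Der (NHA e) Γ (.typ τ (condT τ c (F₁ xs) (G₁ xs))) :=
      fun hc => hc.ty_cond (hF₁.ty hx) (hG₁.ty hx)
    have hc : ∀ {c}, Der (NHA e) Γ (.eq .bool (b xs) c) →
        Der (NHA e) Γ (.eq τ (condT τ c (F₁ xs) (G₁ xs)) (condT τ (b xs) (F₁ xs) (G₁ xs))) := by
      intro c h
      have := h.congr_tm (τ := τ) (condT τ (.var 0) ((F₁ xs).wk 1) ((G₁ xs).wk 1))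
        (by simpa using ht (hb.ty hx))
      simpa using this.symm (by simpa using ht (hb.ty hx))
    refine ⟨fun hb' => .cons ?_ ((h Γ xs hx).1 hb'), fun hb' => .cons ?_ ((h Γ xs hx).2 hb')⟩
    · refine .of_eq (Der.trans (Der.symm ?_ (ht .ty_tt)) (hc hb')) (hF₁.ty hx)
      exact .ax (.condTrue τ _ _) (by simp [hF₁.ty hx, hG₁.ty hx])
    · refine .of_eq (Der.trans (Der.symm ?_ (ht .ty_ff)) (hc hb')) (hG₁.ty hx)
      exact .ax (.condFalse τ _ _) (by simp [hF₁.ty hx, hG₁.ty hx])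

/-- The witness of `𝔹(z)` is only a set `b` of candidates. The union over all `c` in `b` of "if `c`
then the first witness else the second" includes the branch belonging to `z`. The last two premises
are conjoined so that the format with two hypotheses applies. -/
theorem Wit.boolCases (A : Fm) (z : Tm) :
    Wit e [A.inst (.const .tt), .and (A.inst (.const .ff)) (.typ .bool z)] (A.inst z) := by
  let σs := hdn.pos A ++ (hdn.pos A ++ [Ty.star .bool])
  obtain ⟨H, hH, hH'⟩ := RepT.cond (e := e) (σs := σs ++ [.bool]) Rep.last
    (RepT.fst.weaken) (RepT.fst.comp (RepT.snd.weaken))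
  obtain ⟨a, ha, ha'⟩ := hH.bigUnion (e := e) (ρs := [.bool])
    (RepT.snd.comp .snd : RepT σs [.star .bool] _)
  obtain ⟨G, hG, h⟩ := RepT.singleton (e := e) (RepT.snd (σs := σs) (τs := hdn.neg A))
  refine .of_two (γ₁ := G) (γ₂ := G) (a := a) (by simpa [σs] using hG) (by simpa [σs] using hG)
    (by simpa [σs] using ha) fun Δ θ x vb w hx hvb hw h₁ h₂ => ?_
  rw [pos_inst] at hx
  rw [neg_inst] at hw
  have hvb : Typs e Δ (hdn.pos A ++ [Ty.star .bool]) vb := by simpa using hvb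
  have hxvb := hx.append hvb
  have h := h Δ _ (hxvb.append hw)
  rw [List.drop_left' hxvb.length] at h
  have h₁' := JB_elim h₁ (by simpa using hx.length) (by simpa using h)
  have h₂' := JB_elim h₂ (by simpa using hvb.length) (by simpa using h)
  clear h₁ h₂
  obtain ⟨v, b, rfl, hv, hb⟩ := hvb.of_append
  rw [← List.append_nil w, J_and_iff (by simpa using hv.length) (by simpa using hw.length),
    J_typ, Der.and_iff] at h₂'
  have hz : InT e Δ [.bool] [z.subst θ] b := by
    rcases hb with _ | ⟨hb, _ | _⟩
    exact .cons h₂'.2 .nil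
  have ha' := ha' Δ _ [z.subst θ] hxvb
    (by simpa only [List.drop_left' hx.length, List.drop_left' hv.length] using hz)
  have hH' : ∀ {Δ'}, Δ ⊆ Δ' → _ := fun {Δ'} hΔ =>
    hH' Δ' (x ++ (v ++ b) ++ [z.subst θ]) ((hxvb.append hz.typs).mono hΔ)
  have hl : σs.length = (x ++ (v ++ b)).length := hxvb.length.symm
  simp only [List.take_left' hxvb.length, List.drop_left' hx.length, List.take_left' hv.length,
    List.take_left' hx.length, hl, List.getD_append_right _ _ _ _ (le_refl _), Nat.sub_self,
    List.getD_cons_zero] at hH'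
  rw [J_inst] at h₁' ⊢
  rw [J_inst] at h₂'
  have hlen := (hH.ty (hxvb.append hz.typs)).length
  refine h₂'.2.1.bool_cases (fun Δ' hΔ hzt => ?_) (fun Δ' hΔ hzf => ?_)
  · refine J_repl (s := .const .tt) (hzt.symm (h₂'.2.1.mono hΔ))
      (ha.ty hxvb).length hw.length ?_
    exact J_mono (h₁'.mono hΔ) (hw.mono hΔ) (((hH' hΔ).1 hzt).trans (ha'.mono hΔ))
  · refine J_repl (s := .const .ff) (hzf.symm (h₂'.2.1.mono hΔ))
      (ha.ty hxvb).length hw.length ?_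
    exact J_mono (h₂'.1.mono hΔ) (hw.mono hΔ) (((hH' hΔ).2 hzf).trans (ha'.mono hΔ))

/-- The premises in `Γ₀` are implied by their interpretations and the extensional equations are
equivalent to theirs. So the realized premise becomes a derivation of the equation itself from `Γ₀`,
and the extensionality rule of the target theory applies. -/
theorem Wit.qfER {Γ₀ : List Fm} {ρ τ : Ty} {s t r : Tm} (he : e = true)
    (hΓ₀ : ∀ B ∈ Γ₀, B.QF ∨ ∃ σ i, B = .typ σ (.var i))
    (hs : HasTy Γ₀ s ρ) (ht : HasTy Γ₀ t ρ)
    (hr : HasTy (.typ ρ (.var 0) :: Γ₀.map (Fm.wk 1)) r τ) (h : Wit e Γ₀ (extEq ρ s t)) :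
    Wit e Γ₀ (extEq τ (r.subst (single s)) (r.subst (single t))) := by
  have hsimple : ∀ B ∈ Γ₀, B.Simple := fun B hB =>
    (hΓ₀ B hB).imp_right fun ⟨σ, i, h⟩ => ⟨σ, .var i, h⟩
  -- The rule has to be applied to `Γ₀` as it stands, with declarations of variables only; the
  -- substitution is made in its conclusion.
  refine .of_extEq hsimple fun Δ θ hB => Der.subst ?_ θ hB
  refine .qfER he hΓ₀ hs ht hr (NHA.lang _ _) ?_ fun B hB => .hyp hB
  obtain ⟨γ, a, hγ, ha, h⟩ := h
  rw [← Fm.subst_var (HDN.extEq ρ s t), J_extEq_iff]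
  intro Δ w hΔ hw
  -- Conversely, `Γ₀` yields its own interpretation: each declared variable is witnessed by its
  -- singleton, and quantifier-free formulas need no witness.
  have hx : ∀ Γ : List Fm, Γ ⊆ Δ → (∀ B ∈ Γ, B.QF ∨ ∃ σ i, B = .typ σ (.var i)) →
      ∃ x, Typs e Δ (posC Γ) x ∧ ∀ S, BC e Δ Tm.var Γ x S := by
    intro Γ hΓΔ hΓ
    induction Γ with
    | nil => exact ⟨[], .nil, fun _ => trivial⟩
    | cons B Γ ih =>
      obtain ⟨x, hx, hBC⟩ := ih (fun C hC => hΓΔ (List.mem_cons_of_mem _ hC))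
        fun C hC => hΓ C (List.mem_cons_of_mem _ hC)
      have hB : Der (NHA e) Δ B := .hyp (hΓΔ List.mem_cons_self)
      rcases hΓ B List.mem_cons_self with hQ | ⟨σ, i, rfl⟩
      · refine ⟨x, by rwa [posC_cons, hQ.types.1], fun S => ?_⟩
        rw [BC, JB_of_neg_nil hQ.types.2, hQ.J_eq, Fm.subst_var, hQ.types.1]
        exact ⟨hB, hBC _⟩
      · refine ⟨consT σ (.var i) (nilT σ) :: x, .cons (hB.ty_cons (.ty_nil σ)) hx, fun S => ?_⟩
        rw [BC, JB_of_neg_nil rfl, J_typ, Tm.subst_var]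
        exact ⟨.andI hB (.mem_cons_self hB (.ty_nil σ)), hBC _⟩
  obtain ⟨x, hx, hBC⟩ := hx Γ₀ hΔ hΓ₀
  have := h Δ Tm.var x w hx hw (hBC _)
  rwa [List.length_eq_zero_iff.1 ((ha.ty hx).length.trans (by rw [pos_extEq]; rfl))] at this

end

section
variable {σs τs ρs : List Ty} {τ : Ty} {Γ Δ : List Fm} {A B : Fm} {θ : ℕ → Tm}

/-! ## Simultaneous recursion -/

theorem Rep.subst {F : List Tm → Tm} (h : Rep σs τ F) {xs : List Tm}
    (hx : xs.length = σs.length) (η : ℕ → Tm) : (F xs).subst η = F (xs.map (Tm.subst η)) := by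
  obtain ⟨t, ht, h⟩ := h
  rw [h xs hx, h _ (by simpa using hx), Tm.subst_subst]
  refine ht.subst_congr fun i hi => ?_
  rw [← hx] at hi
  simp [env, hi]

theorem RepT.subst {F : List Tm → List Tm} (h : RepT σs τs F) {xs : List Tm}
    (hx : xs.length = σs.length) (η : ℕ → Tm) :
    (F xs).map (Tm.subst η) = F (xs.map (Tm.subst η)) := by
  induction τs generalizing F with
  | nil =>
    rw [List.length_eq_zero_iff.1 (h.length hx),
      List.length_eq_zero_iff.1 (h.length (by simpa using hx))]
    rfl
  | cons τ τs ih =>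
    obtain ⟨F₁, F₂, h₁, h₂, h⟩ := h.of_cons
    rw [h xs hx, h _ (by simpa using hx), List.map_cons, h₁.subst hx, ih h₂]

/-- Representable functions respect provable equality since they are terms. For arbitrary functions
on terms this would fail. -/
theorem Rep.congr_args {F : List Tm → Tm} (h : Rep σs τ F) {xs ys : List Tm}
    (hx : Typs e Γ σs xs) (hxy : EqT e Γ σs xs ys) : Der (NHA e) Γ (.eq τ (F xs) (F ys)) := by
  obtain ⟨t, ht, h⟩ := h
  rw [h xs hx.length, h ys hxy.length_right]
  have hy : Typs e Γ σs ys := by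
    clear h ht
    induction hxy with
    | nil => exact .nil
    | cons h _ ih =>
      cases hx with
      | cons hx hxs => exact .cons (h.ty_of_eq hx) (ih hxs)
  clear h
  induction ht with
  | @var i σ hi =>
    clear hy
    rw [Tm.var_subst, Tm.var_subst]
    induction hxy generalizing i with
    | nil => simp at hi
    | cons h _ ih =>
      cases hx with
      | cons hx hxs =>
        rcases i with _ | i
        · obtain rfl : _ = σ := by simpa using hi
          exact h
        · exact ih hxs (by simpa using hi)
  | const c => exact (Der.ty_const c).refl
  | ap hs ht ih₁ ih₂ =>
    exact (ih₁.congr_fun (hs.ty hx) (ht.ty hx)).trans (ih₂.congr_arg (hs.ty hy) (ht.ty hx))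

theorem RepT.congr_args {F : List Tm → List Tm} (h : RepT σs τs F) {xs ys : List Tm}
    (hx : Typs e Γ σs xs) (hxy : EqT e Γ σs xs ys) : EqT e Γ τs (F xs) (F ys) := by
  induction τs generalizing F with
  | nil =>
    rw [List.length_eq_zero_iff.1 (h.length hx.length),
      List.length_eq_zero_iff.1 (h.length hxy.length_right)]
    exact .nil
  | cons τ τs ih =>
    obtain ⟨F₁, F₂, h₁, h₂, h⟩ := h.of_cons
    rw [h xs hx.length, h ys hxy.length_right]
    exact .cons (h₁.congr_args hx hxy) (ih h₂)

theorem EqT.trans {xs ys zs : List Tm} (h : EqT e Γ τs xs ys) (h' : EqT e Γ τs ys zs) :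
    EqT e Γ τs xs zs := by
  induction h generalizing zs with
  | nil => exact h'
  | cons h _ ih =>
    cases h' with
    | cons h' hs' => exact .cons (h.trans h') (ih hs')

theorem bvs_succ (n : ℕ) : bvs (n + 1) = .var n :: bvs n := by
  simp [bvs, List.range_succ]

/-- Induction on `n` for a formula that is universally quantified over a tuple. -/
theorem Der.nat_ind_tuple (F : Fm)
    (h₀ : ∀ Δ ys, Γ ⊆ Δ → Typs e Δ τs ys → Der (NHA e) Δ (F.subst (insts (zeroT :: ys))))
    (hs : ∀ Δ n, Γ ⊆ Δ → Der (NHA e) Δ (.typ .nat n) →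
      (∀ Δ' ys, Δ ⊆ Δ' → Typs e Δ' τs ys → Der (NHA e) Δ' (F.subst (insts (n :: ys)))) →
      ∀ Δ' ys, Δ ⊆ Δ' → Typs e Δ' τs ys → Der (NHA e) Δ' (F.subst (insts (sucT n :: ys))))
    {n : Tm} {ys : List Tm} (hn : Der (NHA e) Γ (.typ .nat n)) (hy : Typs e Γ τs ys) :
    Der (NHA e) Γ (F.subst (insts (n :: ys))) := by
  have key : ∀ Γ n, Der (NHA e) Γ ((allTs τs F).inst n) ↔
      ∀ Δ ys, Γ ⊆ Δ → Typs e Δ τs ys → Der (NHA e) Δ (F.subst (insts (n :: ys))) := by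
    intro Γ n
    rw [Fm.inst, allTs_subst, allTs_iff]
    refine forall₂_congr fun Δ ys => forall₂_congr fun _ hy => ?_
    rw [Fm.subst_subst, ← hy.length, insts_cons]
  refine (key Γ n).1 (Der.nat_ind _ ?_ ?_ hn) Γ ys (List.Subset.refl _) hy
  · exact (key _ _).2 h₀
  · intro Δ n hΔ hn h
    exact (key _ _).2 (hs Δ n hΔ hn ((key _ _).1 h))

/-- Iteration of `s` on tuples, observed through `F`, starting from the inside. -/
theorem Rep.iterate_inside {s : List Tm → List Tm} {F : List Tm → Tm} (hs : RepT ρs ρs s)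
    (hF : Rep ρs τ F) : ∃ M, Rep (.nat :: ρs) τ M ∧ ∀ (Γ : List Fm) (z : List Tm),
      Typs e Γ ρs z → Der (NHA e) Γ (.eq τ (M (zeroT :: z)) (F z)) ∧
      ∀ n, Der (NHA e) Γ (.typ .nat n) →
        Der (NHA e) Γ (.eq τ (M (sucT n :: z)) (M (n :: s z))) := by
  -- The recursor is used at the functional type `α`: the `n`-th value takes a tuple, and its
  -- successor first applies `s` to that tuple. A single recursor thus handles the mutual dependence
  -- inside `s`.
  let α := arrs ρs τ
  obtain ⟨p, hp, hp'⟩ := Rep.curry (e := e) (σs := []) (ρs := ρs) hF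
  have hstep : Rep ([] ++ [.nat, α] ++ ρs) τ fun zs => HDN.apT ρs τ (zs.getD 1 zeroT) (s (zs.drop 2)) :=
    Rep.apT (ρs := ρs) (F := fun zs => zs.getD 1 zeroT) (τ := τ) (.getD (by simp [α])) (hs.comp (RepT.snd (σs := [.nat, α])))
  obtain ⟨q, hq, hq'⟩ := hstep.curry (e := e)
  obtain ⟨r, hr, hr'⟩ := hq.curry (e := e)
  have hfst : Rep (.nat :: ρs) .nat fun zs => zs.getD 0 zeroT := .getD rfl
  have hsnd : RepT (.nat :: ρs) ρs _ := RepT.snd (σs := [.nat])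
  have hM : Rep (.nat :: ρs) α fun zs => recT α (zs.getD 0 zeroT) (p []) (r []) :=
    Rep.ap (Rep.ap (Rep.ap (.const (.R α)) hfst) (hp.comp .nil)) (hr.comp .nil)
  refine ⟨_, hM.apT hsnd, fun Γ z hz => ⟨?_, fun n hn => ?_⟩⟩
  all_goals
    have hp := hp.ty (Typs.nil (e := e) (Γ := Γ))
    have hr := hr.ty (Typs.nil (e := e) (Γ := Γ))
    have ht : ∀ {n}, Der (NHA e) Γ (.typ .nat n) →
        Der (NHA e) Γ (.typ α (recT α n (p []) (r []))) := fun hn => hn.ty_rec hp hr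
  · have h₁ : Der (NHA e) Γ (.eq α (recT α zeroT (p []) (r [])) (p [])) :=
      .ax (.recZero α _ _) (by simpa using ⟨hp, hr⟩)
    exact (h₁.congr_apT (ht .ty_zero) hz).trans (hp' Γ [] z .nil hz)
  · have h₁ : Der (NHA e) Γ (.eq α (recT α (sucT n) (p []) (r []))
        (HDN.apT [.nat, α] α (r []) [n, recT α n (p []) (r [])])) :=
      .ax (.recSuc α _ _ _) (by simpa using ⟨hn, hp, hr⟩)
    have hnr : Typs e Γ [.nat, α] [n, recT α n (p []) (r [])] := .cons hn (.cons (ht hn) .nil)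
    exact (h₁.congr_apT (ht hn.ty_suc) hz).trans
      (((hr' Γ [] _ .nil hnr).congr_apT (hr.ty_apT hnr) hz).trans (hq' Γ _ z hnr hz))

/-- Each output component is obtained by its own recursion, and since `s` acts on the argument side
the components never refer to one another. -/
theorem RepT.iterate_inside {s F : List Tm → List Tm} (hs : RepT ρs ρs s)
    (hF : RepT ρs τs F) : ∃ M, RepT (.nat :: ρs) τs M ∧ ∀ (Γ : List Fm) (z : List Tm),
      Typs e Γ ρs z → EqT e Γ τs (M (zeroT :: z)) (F z) ∧
      ∀ n, Der (NHA e) Γ (.typ .nat n) → EqT e Γ τs (M (sucT n :: z)) (M (n :: s z)) := by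
  induction τs generalizing F with
  | nil =>
    refine ⟨_, .nil, fun Γ z hz => ?_⟩
    rw [List.length_eq_zero_iff.1 (hF.length hz.length)]
    exact ⟨.nil, fun _ _ => .nil⟩
  | cons τ τs ih =>
    obtain ⟨F₁, F₂, hF₁, hF₂, hF⟩ := hF.of_cons
    obtain ⟨M₁, hM₁, h₁⟩ := hF₁.iterate_inside (e := e) hs
    obtain ⟨M₂, hM₂, h₂⟩ := ih hF₂
    refine ⟨_, Rep.cons hM₁ hM₂, fun Γ z hz => ?_⟩
    rw [hF _ hz.length]
    exact ⟨.cons (h₁ Γ z hz).1 (h₂ Γ z hz).1,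
      fun n hn => .cons ((h₁ Γ z hz).2 n hn) ((h₂ Γ z hz).2 n hn)⟩

theorem EqT.of_getD {σs : List Ty} {xs ys : List Tm} (hx : xs.length = σs.length)
    (hy : ys.length = σs.length)
    (h : ∀ i τ, σs[i]? = some τ → Der (NHA e) Γ (.eq τ (env xs i) (env ys i))) :
    EqT e Γ σs xs ys := by
  induction σs generalizing xs ys with
  | nil =>
    rw [List.length_eq_zero_iff.1 hx, List.length_eq_zero_iff.1 hy]
    exact .nil
  | cons σ σs ih =>
    rcases xs with _ | ⟨x, xs⟩
    · simp at hx
    rcases ys with _ | ⟨y, ys⟩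
    · simp at hy
    exact .cons (h 0 σ rfl) (ih (by simpa using hx) (by simpa using hy)
      fun i τ hi => h (i + 1) τ (by simpa using hi))

theorem EqT.env {σs : List Ty} {xs ys : List Tm} (h : EqT e Γ σs xs ys) {i : ℕ} {τ : Ty}
    (hi : σs[i]? = some τ) : Der (NHA e) Γ (.eq τ (env xs i) (HDN.env ys i)) := by
  induction h generalizing i with
  | nil => simp at hi
  | cons h _ ih =>
    rcases i with _ | i
    · obtain rfl : _ = τ := by simpa using hi
      exact h
    · exact ih (by simpa using hi)

/-- Moves the step to the outside, from `M (n + 1, z) = M (n, s z)` to `M (n + 1, z) = s (M (n,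
z))`, by induction on `n` for all `z` at once: the hypothesis is used at `s z`. -/
theorem RepT.iterate {s : List Tm → List Tm} (hs : RepT ρs ρs s) :
    ∃ M, RepT (.nat :: ρs) ρs M ∧ ∀ (Γ : List Fm) (z : List Tm),
      Typs e Γ ρs z → EqT e Γ ρs (M (zeroT :: z)) z ∧
      ∀ n, Der (NHA e) Γ (.typ .nat n) → EqT e Γ ρs (M (sucT n :: z)) (s (M (n :: z))) := by
  obtain ⟨M, hM, h⟩ := hs.iterate_inside (e := e) .id
  refine ⟨M, hM, fun Γ z hz => ⟨(h Γ z hz).1, fun n hn => ?_⟩⟩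
  have hMt : ∀ {Δ n z}, Der (NHA e) Δ (.typ .nat n) → Typs e Δ ρs z →
      Typs e Δ ρs (M (n :: z)) := fun hn hz => hM.ty (.cons hn hz)
  refine EqT.of_getD (hMt hn.ty_suc hz).length (hs.ty (hMt hn hz)).length fun i τ hi => ?_
  -- The induction formula must be a single object-level formula, so one component `i` is fixed and
  -- the equation is written for generic variables. The number has index `ρs.length`, followed by
  -- those of the tuple.
  let v : List Tm := bvs (ρs.length + 1)
  have hv : v.length = (Ty.nat :: ρs).length := by simp [v, bvs_length]
  let v' : List Tm := sucT (.var ρs.length) :: bvs ρs.length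
  have hv' : v'.length = (Ty.nat :: ρs).length := by simp [v', bvs_length]
  let F : Fm := .eq τ (HDN.env (M v') i) (HDN.env (s (M v)) i)
  have henv : ∀ {xs : List Tm} {η : ℕ → Tm}, i < xs.length →
      (HDN.env xs i).subst η = HDN.env (xs.map (Tm.subst η)) i := by
    intro xs η hi
    simp [HDN.env, hi]
  have hi' : i < ρs.length := (List.getElem?_eq_some_iff.1 hi).1
  have key : ∀ {n ys}, ys.length = ρs.length → F.subst (insts (n :: ys)) =
      .eq τ (HDN.env (M (sucT n :: ys)) i) (HDN.env (s (M (n :: ys))) i) := by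
    intro n ys hys
    have h₁ : v.map (Tm.subst (insts (n :: ys))) = n :: ys := by
      have := bvs_subst_insts (n :: ys)
      rwa [List.length_cons, hys] at this
    have h₂ : v'.map (Tm.subst (insts (n :: ys))) = sucT n :: ys := by
      simp only [v, bvs_succ, List.map_cons, List.cons.injEq] at h₁
      simp only [v', List.map_cons, sucT_subst, h₁]
    simp only [F, Fm.eq_subst]
    rw [henv (by rw [hM.length hv']; exact hi'),
      henv (by rw [hs.length (hM.length hv)]; exact hi'), hM.subst hv', hs.subst (hM.length hv),
      hM.subst hv, h₁, h₂]
  have := Der.nat_ind_tuple (e := e) (Γ := Γ) (τs := ρs) F ?_ ?_ hn hz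
  · rwa [key hz.length] at this
  · intro Δ ys _ hy
    rw [key hy.length]
    have h₁ := (h Δ ys hy).2 _ .ty_zero
    have h₂ := hs.congr_args (hMt .ty_zero hy) (h Δ ys hy).1
    have h₃ := (h Δ _ (hs.ty hy)).1
    exact ((h₁.trans h₃).trans (h₂.symm (hs.ty (hMt .ty_zero hy)))).env hi
  · intro Δ n _ hn ih Δ' ys hΔ' hy
    have hn := hn.mono hΔ'
    rw [key hy.length]
    have h₁ := (h Δ' ys hy).2 _ hn.ty_suc
    have h₂ := ih Δ' (s ys) hΔ' (hs.ty hy)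
    rw [key (hs.ty hy).length] at h₂
    have h₃ := hs.congr_args (hMt hn.ty_suc hy) ((h Δ' ys hy).2 _ hn)
    exact ((h₁.env hi).trans h₂).trans ((h₃.symm (hs.ty (hMt hn.ty_suc hy))).env hi)

/-- Recursion is iteration of `(n, y) ↦ (n + 1, d (n, y))` with a counter carried along. That the
counter after `n` steps equals `n` is proved by a separate induction. -/
theorem RepT.simRec {d₀ d : List Tm → List Tm} (hd₀ : RepT [] ρs d₀)
    (hd : RepT (.nat :: ρs) ρs d) :
    ∃ H, RepT [.nat] ρs H ∧ ∀ Γ : List Fm, EqT e Γ ρs (H [zeroT]) (d₀ []) ∧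
      ∀ n, Der (NHA e) Γ (.typ .nat n) → EqT e Γ ρs (H [sucT n]) (d (n :: H [n])) := by
  have hs : RepT (.nat :: ρs) (.nat :: ρs) fun z => sucT (z.getD 0 zeroT) :: d z :=
    Rep.cons (Rep.ap (.const .suc) (.getD rfl)) hd
  obtain ⟨M, hM, h⟩ := hs.iterate (e := e)
  have hz : RepT [.nat] (.nat :: .nat :: ρs) fun z => z.getD 0 zeroT :: zeroT :: d₀ [] :=
    Rep.cons (.getD rfl) (Rep.cons (.const .zero) (hd₀.comp .nil))
  obtain ⟨c, H, hc, hH, hcH⟩ := (hM.comp hz).of_cons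
  refine ⟨H, hH, fun Γ => ?_⟩
  have hcH' : ∀ n, M (n :: zeroT :: d₀ []) = c [n] :: H [n] := fun n => hcH [n] rfl
  have hz : Typs e Γ (.nat :: ρs) (zeroT :: d₀ []) := .cons .ty_zero (hd₀.ty .nil)
  have h₀ := (h Γ _ hz).1
  rw [hcH'] at h₀
  cases h₀ with
  | cons hc₀ hH₀ =>
    refine ⟨hH₀, fun n hn => ?_⟩
    have hcn : ∀ n, Der (NHA e) Γ (.typ .nat n) → Der (NHA e) Γ (.eq .nat (c [n]) n) := by
      intro n hn
      have key : ∀ n, (Fm.eq .nat (c [.var 0]) (.var 0)).inst n = .eq .nat (c [n]) n := by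
        intro n
        rw [Fm.inst, Fm.eq_subst, hc.subst rfl]
        rfl
      rw [← key]
      refine Der.nat_ind _ (by rw [key]; exact hc₀) (fun Δ n hΔ hn ih => ?_) hn
      rw [key] at ih ⊢
      have hs := (h Δ _ (hz.mono hΔ)).2 n hn
      rw [hcH', hcH'] at hs
      cases hs with
      | cons hs _ =>
        exact hs.trans (ih.congr_arg (.ty_const .suc) (hc.ty (.cons hn .nil)))
    have hn' : Typs e Γ [.nat] [n] := .cons hn .nil
    have hs := (h Γ _ hz).2 n hn
    rw [hcH', hcH'] at hs
    cases hs with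
    | cons _ hs =>
      exact EqT.trans hs (hd.congr_args (.cons (hc.ty hn') (hH.ty hn'))
        (.cons (hcn n hn) (EqT.refl (hH.ty hn'))))

/-! ## Induction -/

/-- Recursion gives a witness `H n` for each number, and the union of `H n` over the candidate set
`b` answers the quantifier. The object-level induction quantifies over all counter-witnesses, so the
bounds demanded by the step are met whatever they are. -/
theorem Wit.ind_rule (h₀ : Wit e [] (A.inst zeroT))
    (hs : Wit e [.typ .nat (.var 0), A] (A.subst sucSub)) : Wit e [] (.allT .nat A) := by
  obtain ⟨_, a₀, _, ha₀, h₀⟩ := h₀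
  obtain ⟨γ, d, hγ, hd, hs⟩ := hs
  rw [pos_inst] at ha₀
  rw [pos_subst] at hd
  have hposC : posC [.typ .nat (.var 0), A] = .star .nat :: hdn.pos A := by simp [posC]
  have hbnegC : bnegC [.typ .nat (.var 0), A] = (hdn.neg A).map Ty.star := by simp [bnegC]
  rw [hposC] at hd
  rw [hposC, neg_subst, hbnegC] at hγ
  -- The step realizer expects a set of numbers as the witness for the typing of `n`; it is given
  -- the singleton.
  have hd' : RepT (.nat :: hdn.pos A) (hdn.pos A) fun z =>
      d (consT .nat (z.getD 0 zeroT) (nilT .nat) :: z.drop 1) :=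
    hd.comp (Rep.cons (Rep.singleton (.getD rfl)) (RepT.snd (σs := [.nat])))
  obtain ⟨H, hH, hH'⟩ := ha₀.simRec (e := e) hd'
  obtain ⟨G, hG, hG'⟩ := (hH.comp (RepT.snd (σs := [.star .nat]))).bigUnion (e := e)
    (ρs := [.nat]) (RepT.id : RepT [Ty.star .nat] _ _)
  obtain ⟨a, ha, ha'⟩ := RepT.curry_sub (e := e) (σs := []) (ρs := [.star .nat]) hG
  refine ⟨fun _ => [], a, .nil, by simpa [Fm.allT, posC] using ha, fun Δ θ x w₀ hx hw₀ _ => ?_⟩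
  have hx : x = [] := List.length_eq_zero_iff.1 hx.length
  subst hx
  have hw₀ : Typs e Δ (.star .nat :: hdn.neg A) w₀ := hw₀
  obtain ⟨b, w, hb, hw, rfl⟩ := List.forall₂_cons_left_iff.1 hw₀
  replace hw : Typs e Δ (hdn.neg A) w := hw
  have hal := (ha.ty (Typs.nil (e := e) (Γ := Δ))).length
  rw [J_allT_iff (by simpa using hal) hw.length]
  intro Δ' t hΔ ht
  have hb' : Typs e Δ' [.star .nat] [b] := .cons (hb.mono hΔ) .nil
  have hsub := (hG' Δ' [b] [t] hb' (.cons ht .nil)).trans (ha' Δ' [] [b] .nil hb').1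
  refine J_mono ?_ (hw.mono hΔ) hsub
  let m := (hdn.neg A).length
  have hv : ([.var m] : List Tm).length = [Ty.nat].length := rfl
  -- The induction formula: the `m` innermost variables are the counter-witnesses, and index `m` is
  -- the number.
  let F : Fm := J A (scons (.var m) fun i => (θ i).wk (m + 1)) (H [.var m]) (bvs m)
  have key : ∀ {n ys}, ys.length = m → F.subst (insts (n :: ys)) = J A (scons n θ) (H [n]) ys := by
    intro n ys hys
    have h₁ := bvs_subst_insts (n :: ys)
    rw [List.length_cons, hys, bvs_succ, List.map_cons, List.cons.injEq] at h₁
    rw [J_subst (hH.length hv) (bvs_length m), hH.subst hv, h₁.2, List.map_singleton, h₁.1]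
    congr 1
    funext i
    rcases i with _ | i
    · exact h₁.1
    · have := (θ i).wk_subst_insts (n :: ys)
      rwa [List.length_cons, hys] at this
  have := Der.nat_ind_tuple (e := e) (Γ := Δ') (τs := hdn.neg A) F ?_ ?_ ht.1 (hw.mono hΔ)
  · rwa [key hw.length] at this
  · intro Δ ys _ hy
    rw [key hy.length]
    have := h₀ Δ θ [] ys .nil (by simpa using hy) trivial
    rw [J_inst] at this
    exact J_mono this hy (((hH' Δ).1.symm (hH.ty (.cons .ty_zero .nil))).sub (ha₀.ty .nil))
  · intro Δ n _ hn ih Δ' ys hΔ' hy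
    have hn := hn.mono hΔ'
    have hn' : Typs e Δ' [.nat] [n] := .cons hn .nil
    rw [key hy.length]
    have hHn := hH.ty hn'
    have hnn : In e Δ' .nat n (consT .nat n (nilT .nat)) :=
      ⟨hn, .mem_cons_self hn (.ty_nil .nat)⟩
    have hnH : Typs e Δ' (.star .nat :: hdn.pos A) (consT .nat n (nilT .nat) :: H [n]) :=
      .cons (hn.ty_cons (.ty_nil .nat)) hHn
    have hdt := hd.ty hnH
    have := hs Δ' (scons n θ) _ ys (by rw [hposC]; exact hnH) (by simpa using hy) ?_
    · rw [J_of_subst] at this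
      have hθ : (fun i => (sucSub i).subst (scons n θ)) = scons (sucT n) θ := by
        funext i; cases i <;> rfl
      rw [hθ] at this
      exact J_mono this hy ((((hH' Δ').2 n hn).symm (hH.ty (.cons hn.ty_suc .nil))).sub hdt)
    · have hγt := (hγ.ty (Typs.append hnH hy)).length
      refine ⟨?_, ?_, trivial⟩
      · rw [JB_of_neg_nil rfl, J_typ]
        exact .andI hnn.1 hnn.2
      · show Der (NHA e) Δ' (JB A (scons n θ) ((H [n]).take _) ((γ _).take _))
        rw [List.take_of_length_le hHn.length.le,
          List.take_of_length_le (by rw [← List.length_map (f := Ty.star)]; exact hγt.le),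
          JB_iff hHn.length (by simpa using hγt)]
        -- The induction hypothesis covers every typed counter-witness, in particular those in the
        -- sets asked for.
        intro Δ'' z hΔ'' hz
        have := ih Δ'' z (List.Subset.trans hΔ' hΔ'') hz.typs
        rwa [key hz.length_left] at this

end

theorem Wit.all_elim {Γ : List Fm} {A : Fm} (t : Tm) (h : Wit e Γ (.all A)) :
    Wit e Γ (A.inst t) :=
  (Wit.allE A t).cut (by simpa using h)

/-- The base and step assumptions are moved into the induction formula `D`, that is `A(0) → S → A`.
Both premises of the rule for `D` then need no side context. -/
theorem Wit.ind {A : Fm} :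
    Wit e [A.inst zeroT, .allT .nat (.imp A (A.subst sucSub))] (.allT .nat A) := by
  let A₀ := A.inst zeroT
  let S : Fm := .allT .nat (.imp A (A.subst sucSub))
  let D : Fm := .imp (A₀.wk 1) (.imp (S.wk 1) A)
  have hinst : ∀ C : Fm, (C.subst (up fun i => .var (i + 1))).inst (.var 0) = C := by
    intro C
    rw [Fm.subst_up_inst]
    refine (congrArg C.subst ?_).trans C.subst_var
    funext i
    cases i <;> rfl
  have key : ∀ {Γ C}, Wit e Γ ((Fm.allT .nat C).wk 1) →
      Wit e Γ (.typ .nat (.var 0)) → Wit e Γ C := by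
    intro Γ C h ht
    have := Wit.all_elim (.var 0) h
    rw [hinst] at this
    exact this.impE ht
  have hD : Wit e [] (.allT .nat D) := by
    refine .ind_rule ?_ ?_
    · have : D.inst zeroT = .imp A₀ (.imp S A₀) := by
        change Fm.imp ((A₀.wk 1).inst zeroT) (.imp ((S.wk 1).inst zeroT) A₀) = _
        rw [Fm.wk_inst, Fm.wk_inst]
      rw [this]
      exact .impI (.impI (.hyp (by simp)))
    · have hwk : ∀ B : Fm, (B.wk 1).subst sucSub = B.wk 1 := by
        intro B
        rw [Fm.wk, Fm.subst_subst]
        rfl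
      have : D.subst sucSub = .imp (A₀.wk 1) (.imp (S.wk 1) (A.subst sucSub)) := by
        simp [D, hwk]
      rw [this]
      refine .impI (.impI ?_)
      have h₁ : Wit e [S.wk 1, A₀.wk 1, .typ .nat (.var 0), D] A :=
        ((Wit.hyp (A := D) (by simp)).impE (.hyp (by simp))).impE (.hyp (by simp))
      exact (key (C := .imp A (A.subst sucSub)) (.hyp (by simp [S])) (.hyp (by simp))).impE h₁
  refine Wit.cut (Δ := [A₀, S, .allT .nat D]) (.allI (.impI ?_)) ?_
  · have h := key (C := D) (Γ := [.typ .nat (.var 0), A₀.wk 1, S.wk 1, (Fm.allT .nat D).wk 1])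
      (.hyp (by simp)) (.hyp (by simp))
    exact (h.impE (.hyp (by simp))).impE (.hyp (by simp))
  · intro B hB
    simp only [List.mem_cons, List.not_mem_nil, or_false] at hB
    rcases hB with rfl | rfl | rfl
    · exact .hyp (by simp [A₀])
    · exact .hyp (by simp [S])
    · exact hD.of_nil

/-! ## Soundness -/

section
variable {Γ Δ : List Fm} {A : Fm} {θ : ℕ → Tm}

theorem Wit.of_eq_ax {τ : Ty} {s t : Tm} (hΓ : ∀ B ∈ Γ, B.Simple)
    (h : ∀ θ, Ax Fm.eq (Γ.map fun B => B.subst θ) (.eq τ (s.subst θ) (t.subst θ)))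
    (ht : ∀ (Δ : List Fm) (θ : ℕ → Tm), (∀ B ∈ Γ, Der (NHA e) Δ (B.subst θ)) →
      Der (NHA e) Δ (.typ τ (s.subst θ))) : Wit e Γ (extEq τ s t) :=
  .of_eq hΓ fun Δ θ hB => ⟨.ax (h θ) (by simpa using hB), ht Δ θ hB⟩

theorem Wit.nonlog (h : Ax extEq Γ A) (hA : (WEHA e).Lang A) : Wit e Γ A := by
  cases h with
  | tyConst c => exact .tyConst c
  | tyAp σ τ f x => exact .tyAp σ τ f x
  | eqRefl τ x => exact .eqRefl τ x
  | eqRepl τ x y A => exact .eqRepl τ x y A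
  | boolNe => exact .of_ax (by simp) ⟨trivial, trivial⟩ .boolNe
  | boolCases A z =>
    refine (Wit.boolCases A z).cut fun B hB => ?_
    rcases List.mem_cons.1 hB with rfl | hB
    · exact .hyp (by simp)
    · obtain rfl : B = _ := by simpa using hB
      exact (Wit.andI _ _).cut (fun C hC => .hyp (List.mem_cons_of_mem _ hC))
  | condTrue σ x y =>
    refine .of_eq_ax (by simp [simple_typ]) (fun θ => .condTrue σ _ _) fun Δ θ h => ?_
    simp only [List.mem_cons, List.not_mem_nil, or_false, forall_eq_or_imp, forall_eq] at h
    exact Der.ty_tt.ty_cond h.1 h.2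
  | condFalse σ x y =>
    refine .of_eq_ax (by simp [simple_typ]) (fun θ => .condFalse σ _ _) fun Δ θ h => ?_
    simp only [List.mem_cons, List.not_mem_nil, or_false, forall_eq_or_imp, forall_eq] at h
    exact Der.ty_ff.ty_cond h.1 h.2
  | combK σ τ x y =>
    refine .of_eq_ax (by simp [simple_typ]) (fun θ => .combK σ τ _ _) fun Δ θ h => ?_
    simp only [List.mem_cons, List.not_mem_nil, or_false, forall_eq_or_imp, forall_eq] at h
    exact (Der.ty_K τ h.1).ty_ap h.2
  | combS σ τ ρ x y z =>
    refine .of_eq_ax (by simp [simple_typ]) (fun θ => .combS σ τ ρ _ _ _) fun Δ θ h => ?_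
    simp only [List.mem_cons, List.not_mem_nil, or_false, forall_eq_or_imp, forall_eq] at h
    exact (((Der.ty_const (.S σ τ ρ)).ty_ap h.1).ty_ap h.2.1).ty_ap h.2.2
  | sucNe x => exact .of_ax (by simp [simple_typ]) ⟨trivial, trivial⟩ (.sucNe x)
  | sucInj x y => exact .of_ax (by simp [Fm.Simple, Fm.QF, Ty.IsBase]) trivial (.sucInj x y)
  | recZero σ y z =>
    refine .of_eq_ax (by simp [simple_typ]) (fun θ => .recZero σ _ _) fun Δ θ h => ?_
    simp only [List.mem_cons, List.not_mem_nil, or_false, forall_eq_or_imp, forall_eq] at h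
    exact Der.ty_zero.ty_rec h.1 h.2
  | recSuc σ n y z =>
    refine .of_eq_ax (by simp [simple_typ]) (fun θ => .recSuc σ _ _ _) fun Δ θ h => ?_
    simp only [List.mem_cons, List.not_mem_nil, or_false, forall_eq_or_imp, forall_eq] at h
    exact h.1.ty_suc.ty_rec h.2.1 h.2.2
  | ind A =>
    convert Wit.ind (A := A) using 6
    funext i
    cases i <;> rfl
  | seqRecNil σ ρ y z =>
    refine .of_eq_ax (by simp [simple_typ]) (fun θ => .seqRecNil σ ρ _ _) fun Δ θ h => ?_
    simp only [List.mem_cons, List.not_mem_nil, or_false, forall_eq_or_imp, forall_eq] at h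
    exact (Der.ty_nil σ).ty_seqRec h.1 h.2
  | seqRecCons σ ρ x u y z =>
    refine .of_eq_ax (by simp [simple_typ]) (fun θ => .seqRecCons σ ρ _ _ _ _) fun Δ θ h => ?_
    simp only [List.mem_cons, List.not_mem_nil, or_false, forall_eq_or_imp, forall_eq] at h
    exact (h.1.ty_cons h.2.1).ty_seqRec h.2.2.1 h.2.2.2
  -- Sequence induction mentions a sequence type and is not in the source language.
  | seqInd σ A => exact hA.1.1.elim

theorem Wit.of_der (h : Der (WEHA e) Γ A) : Wit e Γ A := by
  induction h with
  | hyp h => exact .hyp h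
  | nonlog h hA _ ih => exact (Wit.nonlog h hA).cut ih
  | botE _ _ ih => exact (Wit.botE _).cut (by simpa using ih)
  | andI _ _ ih₁ ih₂ => exact (Wit.andI _ _).cut (by simp [ih₁, ih₂])
  | andE₁ _ ih => exact (Wit.andE₁ _ _).cut (by simpa using ih)
  | andE₂ _ ih => exact (Wit.andE₂ _ _).cut (by simpa using ih)
  | impI _ _ ih => exact ih.impI
  | impE _ _ ih₁ ih₂ => exact ih₁.impE ih₂
  | allI _ ih => exact ih.allI
  | allE t _ _ ih => exact ih.all_elim t
  | exI t _ ih => exact (Wit.exI _ t).cut (by simpa using ih)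
  | exE _ _ ih₁ ih₂ => exact (Wit.exE _ _).cut (by simpa using ⟨ih₂.impI.allI, ih₁⟩)
  | qfER hw hΓ₀ hs ht hr _ _ _ ih ihΓ => exact (Wit.qfER hw hΓ₀ hs ht hr ih).cut ihΓ

theorem RepT.closed {τs : List Ty} {F : List Tm → List Tm} (h : RepT [] τs F) :
    ∀ t ∈ F [], t.Closed := by
  obtain ⟨ts, hts, h⟩ := h
  rw [h [] rfl]
  clear h
  induction hts with
  | nil => simp
  | cons ht _ ih =>
    rw [List.map_cons, List.forall_mem_cons]
    exact ⟨by rw [ht.subst_nil]; exact ht.closed, ih⟩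

theorem Typs.of_hyp {τs : List Ty} {xs : List Tm} (hx : xs.length = τs.length)
    (h : typs τs xs ⊆ Γ) : Typs e Γ τs xs := by
  induction τs generalizing xs with
  | nil =>
    rw [List.length_eq_zero_iff.1 hx]
    exact .nil
  | cons τ τs ih =>
    rcases xs with _ | ⟨x, xs⟩
    · simp at hx
    · have h : Fm.typ τ x :: typs τs xs ⊆ Γ := h
      exact .cons (.hyp (h List.mem_cons_self))
        (ih (by simpa using hx) fun B hB => h (List.mem_cons_of_mem _ hB))

theorem BC.of_hyp {x S : List Tm} (h : hdn.binters Γ x S ⊆ Δ) : BC e Δ Tm.var Γ x S := by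
  induction Γ generalizing x S with
  | nil => trivial
  | cons A Γ ih =>
    refine ⟨.hyp (h ?_), ih fun B hB => h (List.mem_cons_of_mem _ ?_)⟩
    · rw [ILParams.binters, binter_eq_JB, bneg_eq, List.length_map]
      exact List.mem_cons_self
    · rwa [bneg_eq, List.length_map]

/-- Currying all arguments leaves terms in no variables. The bounds are included in the curried ones
and the witnesses in theirs, so antitonicity and monotonicity carry the statement over. -/
theorem Wit.witnessable (h : Wit e Γ A) : hdn.Witnessable (NHA e) Γ A := by
  obtain ⟨γ, a, hγ, ha, h⟩ := h
  obtain ⟨γ', hγ', hγs⟩ := RepT.curry_sub (e := e) (σs := []) (ρs := posC Γ ++ hdn.neg A) hγ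
  obtain ⟨a', ha', has⟩ := RepT.curry_sub (e := e) (σs := []) (ρs := posC Γ) ha
  have hW : ∀ {τs : List Ty} {F : List Tm → List Tm}, RepT [] τs F →
      List.Forall₂ (fun τ t => Der (NHA e) [] (.typ τ t) ∧ Der (NHA e) [] (hdn.W τ t)) τs (F []) :=
    fun hF => List.Forall₂.imp (fun _ _ h => ⟨h, .impI' (.hyp List.mem_cons_self)⟩)
      (hF.ty (Typs.nil (e := e) (Γ := [])))
  refine ⟨γ' [], a' [], fun t ht => ⟨hγ'.closed t ht, NHA.langT _ _⟩,
    fun t ht => ⟨ha'.closed t ht, NHA.langT _ _⟩, hW hγ', hW ha', fun x w hx hw _ _ => ?_⟩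
  generalize hΔ : typs _ x ++ typs _ w ++ _ ++ _ ++ _ = Δ
  have hx : Typs e Δ (posC Γ) x := .of_hyp hx fun B hB => by
    rw [← hΔ]
    simp only [List.mem_append]
    exact .inl (.inl (.inl (.inl hB)))
  have hw : Typs e Δ (hdn.neg A) w := .of_hyp hw fun B hB => by
    rw [← hΔ]
    simp only [List.mem_append]
    exact .inl (.inl (.inl (.inr hB)))
  have hB : BC e Δ Tm.var Γ x (apTs (posC Γ ++ hdn.neg A) (bnegC Γ) (γ' []) (x ++ w)) :=
    .of_hyp (by rw [← hΔ]; exact List.subset_append_right _ _)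
  rw [inter_eq_J]
  exact J_mono (h Δ Tm.var x w hx hw (BC_sub hB hx (hγs Δ [] _ .nil (hx.append hw)).1)) hw
    (has Δ [] x .nil hx).1

theorem hdn_sound (e : Bool) : hdn.Sound (WEHA e) (NHA e) :=
  fun _ _ h => (Wit.of_der h.2).witnessable

end

/-! ## The interpretation of the connectives -/

section
variable {Γ Δ : List Fm} {A B C : Fm} {θ : ℕ → Tm} {τ : Ty} {τs : List Ty} {t b : Tm}
  {x v y w ys S : List Tm}

theorem Der.iff_intro (h : ∀ Δ, Γ ⊆ Δ → (Der (NHA e) Δ A ↔ Der (NHA e) Δ B)) :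
    Der (NHA e) Γ (.iff A B) :=
  .andI (Der.imp_iff.2 fun Δ hΔ => (h Δ hΔ).1) (Der.imp_iff.2 fun Δ hΔ => (h Δ hΔ).2)

theorem InT.exists_of_inh (hy : ys.length = τs.length)
    (h : List.zipWith Fm.inh τs ys ⊆ Γ)
    (hC : ∀ Δ zs, Γ ⊆ Δ → InT e Δ τs zs ys → Der (NHA e) Δ C) : Der (NHA e) Γ C := by
  induction τs generalizing Γ ys with
  | nil =>
    obtain rfl := List.length_eq_zero_iff.1 hy
    exact hC Γ [] (List.Subset.refl _) .nil
  | cons τ τs ih =>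
    rcases ys with _ | ⟨y, ys⟩
    · simp at hy
    have h : Fm.inh τ y :: List.zipWith Fm.inh τs ys ⊆ Γ := h
    have hin : Der (NHA e) Γ (.inh τ y) := .hyp (h List.mem_cons_self)
    refine hin.exT_elim fun Δ t hΔ ht hty => ?_
    have hty : Der (NHA e) Δ (.mem τ t y) := by simpa [Fm.inst] using hty
    refine ih (by simpa using hy) (fun B hB => hΔ (h (List.mem_cons_of_mem _ hB)))
      fun Δ' zs hΔ' hz => hC Δ' (t :: zs) (List.Subset.trans hΔ hΔ') (.cons ?_ hz)
    exact ⟨ht.mono hΔ', hty.mono hΔ'⟩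

/-- Either all sets of a tuple are inhabited, or one of them is empty. -/
theorem Typs.inh_cases (hy : Typs e Γ (τs.map Ty.star) ys)
    (h₁ : ∀ Δ zs, Γ ⊆ Δ → InT e Δ τs zs ys → Der (NHA e) Δ C)
    (h₂ : ∀ Δ, Γ ⊆ Δ → (∀ Δ' zs, Δ ⊆ Δ' → InT e Δ' τs zs ys → Der (NHA e) Δ' .bot) →
      Der (NHA e) Δ C) : Der (NHA e) Γ C := by
  induction τs generalizing Γ ys with
  | nil =>
    cases hy
    exact h₁ Γ [] (List.Subset.refl _) .nil
  | cons τ τs ih =>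
    rcases hy with _ | ⟨hy, hys⟩
    refine Der.star_cases hy (fun Δ hΔ hn => h₂ Δ hΔ fun Δ' zs hΔ' hz => ?_)
      fun Δ t u hΔ ht hu hc => ?_
    · cases hz with
      | cons hz _ =>
        exact .not_mem_nil hz.1 (hz.2.mem_of_eq (hn.mono hΔ'))
    · have ht' : In e Δ τ t _ := ⟨ht, (Der.mem_cons_self ht hu).mem_of_eq (hc.symm (hy.mono hΔ))⟩
      refine ih (Typs.mono hys hΔ) (fun Δ' zs hΔ' hz => ?_) fun Δ' hΔ' h => ?_
      · exact h₁ Δ' (t :: zs) (List.Subset.trans hΔ hΔ')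
          (.cons ⟨ht'.1.mono hΔ', ht'.2.mono hΔ'⟩ hz)
      · refine h₂ Δ' (List.Subset.trans hΔ hΔ') fun Δ'' zs hΔ'' hz => ?_
        cases hz with
        | cons _ hz => exact h Δ'' _ hΔ'' hz

/-! ### Typed quantifiers, implication and conjunction -/

theorem JB_of_empty (hx : x.length = (hdn.pos A).length) (hy : y.length = (hdn.neg A).length)
    (h : ∀ Δ zs, Γ ⊆ Δ → InT e Δ (hdn.neg A) zs y → Der (NHA e) Δ .bot) :
    Der (NHA e) Γ (JB A θ x y) :=
  (JB_iff hx hy).2 fun Δ zs hΔ hz => (h Δ zs hΔ hz).exfalso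

theorem exT_mem_inst (hx : x.length = (hdn.pos A).length) (hy : y.length = (hdn.neg A).length)
    (c t : Tm) :
    (Fm.and (.mem τ (.var 0) (c.wk 1)) (memInter A (x.map (Tm.wk 1)) (y.map (Tm.wk 1)))).inst t =
      .and (.mem τ t c) (JB A (scons t Tm.var) x y) := by
  rw [memInter_eq_JB, ← JB_all_inst hx hy, up_var]
  simp [Fm.inst]

/-- The membership claim for `s` sits under the quantifier over `y`, although it does not depend on
it. If some set in `y` is empty it says nothing; this is why inhabitedness enters the clauses for
existence and disjunction. -/
theorem JB_typ_and_iff {s c : Tm} (hx : x.length = (hdn.pos A).length)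
    (hy : y.length = (hdn.neg A).length) :
    Der (NHA e) Γ (JB (.and (.typ τ s) A) θ (c :: x) y) ↔
      ∀ Δ zs, Γ ⊆ Δ → InT e Δ (hdn.neg A) zs y →
        In e Δ τ (s.subst θ) c ∧ Der (NHA e) Δ (J A θ x zs) := by
  rw [JB_iff (by simpa using hx) (by simpa using hy)]
  refine forall₂_congr fun Δ zs => forall₂_congr fun hΔ hz => ?_
  have := J_and_iff (e := e) (Γ := Δ) (A := .typ τ s) (B := A) (θ := θ) (x := [c]) (v := x)
    (y := []) (w := zs) rfl rfl
  rw [J_typ, Der.and_iff] at this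
  exact this

theorem J_exT_of_mem {c : Tm} (hx : x.length = (hdn.pos A).length)
    (hy : y.length = (hdn.neg A).length)
    (h : Der (NHA e) Γ (.exT τ (.and (.mem τ (.var 0) (c.wk 1))
      (memInter A (x.map (Tm.wk 1)) (y.map (Tm.wk 1)))))) :
    Der (NHA e) Γ (J (.exT τ A) Tm.var (c :: x) y) := by
  refine h.exT_elim fun Δ t hΔ ht h => ?_
  rw [exT_mem_inst hx hy, Der.and_iff, JB_iff hx hy] at h
  refine J_ex_intro (by simpa using hx) (by simpa using hy) t ((JB_typ_and_iff hx hy).2 ?_)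
  exact fun Δ' zs hΔ' hz => ⟨⟨ht.mono hΔ', h.1.mono hΔ'⟩, h.2 Δ' zs hΔ' hz⟩

theorem mem_of_JB {c : Tm} (hx : x.length = (hdn.pos A).length)
    (hy : y.length = (hdn.neg A).length) {zs : List Tm} (hz : InT e Γ (hdn.neg A) zs y)
    (h : Der (NHA e) Γ (JB (.and (.typ τ (.var 0)) A) (scons t Tm.var) (c :: x) y)) :
    Der (NHA e) Γ (.exT τ (.and (.mem τ (.var 0) (c.wk 1))
      (memInter A (x.map (Tm.wk 1)) (y.map (Tm.wk 1))))) := by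
  rw [JB_typ_and_iff hx hy] at h
  have ht := (h Γ zs (List.Subset.refl _) hz).1
  refine .exT_intro t ht.1 ?_
  rw [exT_mem_inst hx hy, Der.and_iff, JB_iff hx hy]
  exact ⟨ht.2, fun Δ zs hΔ hz => (h Δ zs hΔ hz).2⟩

theorem inter_exT_of_mem {c : Tm} (hx : x.length = (hdn.pos A).length)
    (hy : y.length = (hdn.neg A).length) :
    Der (NHA e) Γ (.imp (.exT τ (.and (.mem τ (.var 0) (c.wk 1))
      (memInter A (x.map (Tm.wk 1)) (y.map (Tm.wk 1))))) (hdn.inter (.exT τ A) (c :: x) y)) :=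
  Der.imp_iff.2 fun _ _ h => J_exT_of_mem hx hy h

theorem inter_exT_iff_of_inh {c : Tm} (hx : x.length = (hdn.pos A).length)
    (hy : y.length = (hdn.neg A).length) :
    Der (NHA e) (List.zipWith Fm.inh (hdn.neg A) y) (.iff (hdn.inter (.exT τ A) (c :: x) y)
      (.exT τ (.and (.mem τ (.var 0) (c.wk 1))
        (memInter A (x.map (Tm.wk 1)) (y.map (Tm.wk 1)))))) := by
  refine .iff_intro fun Δ hΔ => ⟨fun h => ?_, J_exT_of_mem hx hy⟩
  refine InT.exists_of_inh hy hΔ fun Δ' zs hΔ' hz => ?_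
  refine J_ex_elim (by simpa using hx) (by simpa using hy) (h.mono hΔ') fun Δ'' t hΔ'' h => ?_
  exact mem_of_JB hx hy (hz.mono hΔ'') h

theorem inter_exT_iff_of_typs {c : Tm} (hx : x.length = (hdn.pos A).length)
    (hy : y.length = (hdn.neg A).length) :
    Der (NHA e) (.inh τ c :: typs ((hdn.neg A).map Ty.star) y)
      (.iff (hdn.inter (.exT τ A) (c :: x) y)
      (.exT τ (.and (.mem τ (.var 0) (c.wk 1))
        (memInter A (x.map (Tm.wk 1)) (y.map (Tm.wk 1)))))) := by
  refine .iff_intro fun Δ hΔ => ⟨fun h => ?_, J_exT_of_mem hx hy⟩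
  have hty : Typs e Δ ((hdn.neg A).map Ty.star) y :=
    .of_hyp (by simpa using hy) fun B hB => hΔ (List.mem_cons_of_mem _ hB)
  refine J_ex_elim (by simpa using hx) (by simpa using hy) h fun Δ₁ t hΔ₁ h => ?_
  refine (hty.mono hΔ₁).inh_cases (fun Δ₂ zs hΔ₂ hz => mem_of_JB hx hy hz (h.mono hΔ₂))
    fun Δ₂ hΔ₂ hem => ?_
  have hin : Der (NHA e) Δ₂ (.inh τ c) :=
    -- With an empty set among `y` the matrix is vacuous, and any entry of `c` is a witness.
    .hyp (hΔ₂ (hΔ₁ (hΔ List.mem_cons_self)))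
  refine hin.exT_elim fun Δ₃ u hΔ₃ hu huc => .exT_intro u hu ?_
  rw [exT_mem_inst hx hy, Der.and_iff]
  refine ⟨by simpa [Fm.inst] using huc, JB_of_empty hx hy fun Δ₄ zs hΔ₄ => ?_⟩
  exact hem Δ₄ zs (List.Subset.trans hΔ₃ hΔ₄)

theorem inter_allT_iff {f : List Tm} (hf : f.length = (hdn.pos A).length)
    (hy : y.length = (hdn.neg A).length) :
    Der (NHA e) Γ (.iff (hdn.inter (.allT τ A) f (b :: y))
      (.allT τ (.imp (.mem τ (.var 0) (b.wk 1))
        (hdn.inter A ((apTs [.star τ] (hdn.pos A) f [b]).map (Tm.wk 1)) (y.map (Tm.wk 1)))))) := by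
  refine .iff_intro fun Δ _ => ?_
  have hl := apTs_length (ρs := [.star τ]) (xs := [b]) hf
  rw [inter_eq_J, inter_eq_J, J_allT_iff hf hy, Der.allT_iff]
  have key : ∀ t, (Fm.imp (.mem τ (.var 0) (b.wk 1))
      (J A Tm.var ((apTs [.star τ] (hdn.pos A) f [b]).map (Tm.wk 1)) (y.map (Tm.wk 1)))).inst t =
      .imp (.mem τ t b) (J A (scons t Tm.var) (apTs [.star τ] (hdn.pos A) f [b]) y) := by
    intro t
    rw [← J_all_inst hl hy, up_var]
    simp [Fm.inst]
  simp only [key, Der.imp_iff]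
  exact ⟨fun h Δ₁ t h₁ ht Δ₂ h₂ hb => h Δ₂ t (List.Subset.trans h₁ h₂) ⟨ht.mono h₂, hb⟩,
    fun h Δ₁ t h₁ ht => h Δ₁ t h₁ ht.1 Δ₁ (List.Subset.refl _) ht.2⟩

theorem inter_imp_iff {f g : List Tm} (hf : f.length = (hdn.pos B).length)
    (hx : x.length = (hdn.pos A).length) :
    Der (NHA e) Γ (.iff (hdn.inter (.imp A B) (f ++ g) (x ++ w))
      (.imp (memInter A x (apTs (hdn.pos A ++ hdn.neg B) ((hdn.neg A).map Ty.star) g (x ++ w)))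
        (hdn.inter B (apTs (hdn.pos A) (hdn.pos B) f x) w))) := by
  rw [inter_eq_J, J_imp_append hf hx, memInter_eq_JB]
  exact .iff_intro fun _ _ => .rfl

theorem inter_and_iff (hx : x.length = (hdn.pos A).length) (hy : y.length = (hdn.neg A).length) :
    Der (NHA e) Γ (.iff (hdn.inter (.and A B) (x ++ v) (y ++ w))
      (.and (hdn.inter A x y) (hdn.inter B v w))) := by
  refine .iff_intro fun _ _ => ?_
  rw [inter_eq_J, J_and_iff hx hy, Der.and_iff]
  exact .rfl

/-! ### Disjunction -/

theorem apTs_nil_args {σs : List Ty} {xs : List Tm} (h : xs.length = σs.length) (zs : List Tm) :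
    apTs [] σs xs zs = xs := by
  induction σs generalizing xs with
  | nil => exact (List.length_eq_zero_iff.1 h).symm
  | cons σ σs ih =>
    rcases xs with _ | ⟨x, xs⟩
    · simp at h
    · rw [apTs_cons, ih (by simpa using h)]
      cases zs <;> rfl

theorem arrs_nil : arrs [] = id := rfl

theorem J_eq_imp_wk_iff {c : Ct} (hx : x.length = (hdn.pos A).length) :
    Der (NHA e) Γ (J (.imp (.eq τ (.var 0) (.const c)) (A.wk 1)) (scons t θ) x y) ↔
      ∀ Δ, Γ ⊆ Δ → Der (NHA e) Δ (.eq τ t (.const c)) → Der (NHA e) Δ (J A θ x y) := by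
  have := J_imp_iff (e := e) (Γ := Γ) (A := .eq τ (.var 0) (.const c)) (B := A.wk 1)
    (θ := scons t θ) (f := x) (g := []) (x := []) (w := y) (by simpa using hx) rfl
  rw [List.append_nil, List.nil_append, JB_of_neg_nil rfl, pos_eq, pos_wk, apTs_nil_args hx,
    Fm.wk, J_of_subst] at this
  exact this

/-- The matrix of a disjunction. -/
def orBody (A B : Fm) : Fm :=
  .and (.imp (.eq .bool (.var 0) (.const .tt)) (A.wk 1))
    (.imp (.eq .bool (.var 0) (.const .ff)) (B.wk 1))

theorem pos_orBody (A B : Fm) : hdn.pos (orBody A B) = hdn.pos A ++ hdn.pos B := by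
  simp [orBody, arrs_nil]

theorem neg_orBody (A B : Fm) : hdn.neg (orBody A B) = hdn.neg A ++ hdn.neg B := by
  simp [orBody]

theorem JB_orBody_iff (hx : x.length = (hdn.pos A).length) (hv : v.length = (hdn.pos B).length)
    (hy : y.length = (hdn.neg A).length) (hw : w.length = (hdn.neg B).length) :
    Der (NHA e) Γ (JB (.and (.typ .bool (.var 0)) (orBody A B)) (scons t θ) (b :: (x ++ v))
      (y ++ w)) ↔ ∀ Δ y' w', Γ ⊆ Δ → InT e Δ (hdn.neg A) y' y → InT e Δ (hdn.neg B) w' w →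
        In e Δ .bool t b ∧
        (Der (NHA e) Δ (.eq .bool t (.const .tt)) → Der (NHA e) Δ (J A θ x y')) ∧
        (Der (NHA e) Δ (.eq .bool t (.const .ff)) → Der (NHA e) Δ (J B θ v w')) := by
  rw [JB_typ_and_iff (by simp [pos_orBody, hx, hv]) (by simp [neg_orBody, hy, hw]), neg_orBody]
  have key : ∀ {Δ y' w'}, InT e Δ (hdn.neg A) y' y →
      (Der (NHA e) Δ (J (orBody A B) (scons t θ) (x ++ v) (y' ++ w')) ↔ _) := fun {Δ y' w'} hy' =>
    J_and_iff (by simpa [arrs_nil] using hx) (by simpa using hy'.length_left)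
  simp only [J_eq_imp_wk_iff hx, J_eq_imp_wk_iff hv] at key
  constructor
  · intro h Δ y' w' hΔ hy' hw'
    have h := h Δ _ hΔ (hy'.append hw')
    rw [key hy'] at h
    exact ⟨h.1, h.2.1 Δ (List.Subset.refl _), h.2.2 Δ (List.Subset.refl _)⟩
  · intro h Δ zs hΔ hz
    obtain ⟨y', w', y'', w'', rfl, hyw, hy', hw'⟩ := All₃.of_append hz
    obtain ⟨rfl, rfl⟩ := List.append_inj hyw (hy.trans hy'.length_right.symm)
    rw [key hy']
    refine ⟨(h Δ y' w' hΔ hy' hw').1, fun Δ' hΔ' ht => ?_, fun Δ' hΔ' ht => ?_⟩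
    · exact (h Δ' y' w' (List.Subset.trans hΔ hΔ') (InT.mono hy' hΔ') (InT.mono hw' hΔ')).2.1 ht
    · exact (h Δ' y' w' (List.Subset.trans hΔ hΔ') (InT.mono hy' hΔ') (InT.mono hw' hΔ')).2.2 ht

theorem Der.or_intro (ht : Der (NHA e) Γ (.typ .bool t))
    (hA : ∀ Δ, Γ ⊆ Δ → Der (NHA e) Δ (.eq .bool t (.const .tt)) → Der (NHA e) Δ A)
    (hB : ∀ Δ, Γ ⊆ Δ → Der (NHA e) Δ (.eq .bool t (.const .ff)) → Der (NHA e) Δ B) :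
    Der (NHA e) Γ (.or A B) := by
  refine .exT_intro t ht ?_
  change Der (NHA e) Γ (.and (.imp (.eq .bool t (.const .tt)) ((A.wk 1).inst t))
    (.imp (.eq .bool t (.const .ff)) ((B.wk 1).inst t)))
  rw [Fm.wk_inst, Fm.wk_inst, Der.and_iff, Der.imp_iff, Der.imp_iff]
  exact ⟨hA, hB⟩

theorem Der.or_elim (h : Der (NHA e) Γ (.or A B))
    (hC : ∀ Δ t, Γ ⊆ Δ → Der (NHA e) Δ (.typ .bool t) →
      Der (NHA e) Δ (.imp (.eq .bool t (.const .tt)) A) →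
      Der (NHA e) Δ (.imp (.eq .bool t (.const .ff)) B) → Der (NHA e) Δ C) :
    Der (NHA e) Γ C := by
  refine h.exT_elim fun Δ t hΔ ht h => ?_
  change Der (NHA e) Δ (.and (.imp (.eq .bool t (.const .tt)) ((A.wk 1).inst t))
    (.imp (.eq .bool t (.const .ff)) ((B.wk 1).inst t))) at h
  rw [Fm.wk_inst, Fm.wk_inst, Der.and_iff] at h
  exact hC Δ t hΔ ht h.1 h.2

theorem Der.or_left (h : Der (NHA e) Γ A) : Der (NHA e) Γ (.or A B) :=
  .or_intro .ty_tt (fun _ hΔ _ => h.mono hΔ) fun _ _ h => h.tt_ne_ff.exfalso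

theorem Der.or_right (h : Der (NHA e) Γ B) : Der (NHA e) Γ (.or A B) :=
  .or_intro .ty_ff (fun _ _ h => (h.symm .ty_ff).tt_ne_ff.exfalso) fun _ hΔ _ => h.mono hΔ

/-- If some set in `y` or in `w` is empty, the corresponding bounded disjunct holds vacuously.
Otherwise fixed entries of one tuple release the implication for arbitrary entries of the other, and
the boolean behind the existential selects the disjunct. -/
theorem or_of_J_or (hx : x.length = (hdn.pos A).length) (hv : v.length = (hdn.pos B).length)
    (hy : Typs e Γ ((hdn.neg A).map Ty.star) y) (hw : Typs e Γ ((hdn.neg B).map Ty.star) w)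
    (h : Der (NHA e) Γ (J (.or A B) θ (b :: (x ++ v)) (y ++ w))) :
    Der (NHA e) Γ (.or (JB A θ x y) (JB B θ v w)) := by
  have hyl : y.length = (hdn.neg A).length := by simpa using hy.length
  have hwl : w.length = (hdn.neg B).length := by simpa using hw.length
  refine J_ex_elim (A := .and (.typ .bool (.var 0)) (orBody A B))
    (by simp [pos_orBody, hx, hv]) (by simp [neg_orBody, hyl, hwl]) h fun Δ t hΔ h => ?_
  rw [JB_orBody_iff hx hv hyl hwl] at h
  refine (hy.mono hΔ).inh_cases (fun Δ₁ y₀ h₁ hy₀ => ?_)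
    fun Δ₁ h₁ hem => .or_left (JB_of_empty hx hyl hem)
  refine ((hw.mono hΔ).mono h₁).inh_cases (fun Δ₂ w₀ h₂ hw₀ => ?_)
    fun Δ₂ h₂ hem => .or_right (JB_of_empty hv hwl hem)
  have h := fun Δ y' w' hΔ => h Δ y' w' (List.Subset.trans (List.Subset.trans h₁ h₂) hΔ)
  have hy₀ := hy₀.mono h₂
  refine .or_intro (h Δ₂ y₀ w₀ (List.Subset.refl _) hy₀ hw₀).1.1 (fun Δ₃ h₃ ht => ?_)
    fun Δ₃ h₃ ht => ?_
  · refine (JB_iff hx hyl).2 fun Δ₄ zs h₄ hz => ?_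
    exact (h Δ₄ zs w₀ (List.Subset.trans h₃ h₄) hz (hw₀.mono (List.Subset.trans h₃ h₄))).2.1
      (ht.mono h₄)
  · refine (JB_iff hv hwl).2 fun Δ₄ zs h₄ hz => ?_
    exact (h Δ₄ y₀ zs (List.Subset.trans h₃ h₄) (hy₀.mono (List.Subset.trans h₃ h₄)) hz).2.2
      (ht.mono h₄)

theorem J_or_of_or (hx : x.length = (hdn.pos A).length) (hv : v.length = (hdn.pos B).length)
    (hy : y.length = (hdn.neg A).length) (hw : w.length = (hdn.neg B).length)
    (hT : Der (NHA e) Γ (.mem .bool (.const .tt) b))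
    (hF : Der (NHA e) Γ (.mem .bool (.const .ff) b))
    (h : Der (NHA e) Γ (.or (JB A θ x y) (JB B θ v w))) :
    Der (NHA e) Γ (J (.or A B) θ (b :: (x ++ v)) (y ++ w)) := by
  refine h.or_elim fun Δ t hΔ ht hA hB => ?_
  -- The boolean selecting the disjunct is unknown, so both truth values have to be in `b`.
  have hmem : Der (NHA e) Δ (.mem .bool t b) := by
    have key : ∀ c, (Fm.mem .bool (.var 0) (b.wk 1)).inst c = .mem .bool c b := by
      simp [Fm.inst]
    rw [← key]
    exact .bool_ind _ (by rw [key]; exact hT.mono hΔ) (by rw [key]; exact hF.mono hΔ) ht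
  refine J_ex_intro (A := .and (.typ .bool (.var 0)) (orBody A B))
    (by simp [pos_orBody, hx, hv]) (by simp [neg_orBody, hy, hw]) t ?_
  rw [JB_orBody_iff hx hv hy hw]
  intro Δ' y' w' hΔ' hy' hw'
  exact ⟨⟨ht.mono hΔ', hmem.mono hΔ'⟩, fun h => JB_elim ((hA.mono hΔ').impE h) hx hy',
    fun h => JB_elim ((hB.mono hΔ').impE h) hv hw'⟩

theorem Typs.of_hyp_append (hy : y.length = (hdn.neg A).length)
    (hw : w.length = (hdn.neg B).length)
    (h : typs ((hdn.neg A).map Ty.star) y ++ typs ((hdn.neg B).map Ty.star) w ⊆ Γ) :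
    Typs e Γ ((hdn.neg A).map Ty.star) y ∧ Typs e Γ ((hdn.neg B).map Ty.star) w :=
  ⟨.of_hyp (by simpa using hy) fun _ hC => h (List.mem_append_left _ hC),
    .of_hyp (by simpa using hw) fun _ hC => h (List.mem_append_right _ hC)⟩

theorem inter_or_imp (hx : x.length = (hdn.pos A).length) (hv : v.length = (hdn.pos B).length)
    (hy : y.length = (hdn.neg A).length) (hw : w.length = (hdn.neg B).length) :
    Der (NHA e) (typs ((hdn.neg A).map Ty.star) y ++ typs ((hdn.neg B).map Ty.star) w)
      (.imp (hdn.inter (.or A B) (b :: (x ++ v)) (y ++ w))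
        (.or (memInter A x y) (memInter B v w))) := by
  refine Der.imp_iff.2 fun Δ hΔ h => ?_
  obtain ⟨hy, hw⟩ := Typs.of_hyp_append (e := e) hy hw hΔ
  rw [memInter_eq_JB, memInter_eq_JB]
  exact or_of_J_or hx hv hy hw h

theorem inter_or_iff (hx : x.length = (hdn.pos A).length) (hv : v.length = (hdn.pos B).length)
    (hy : y.length = (hdn.neg A).length) (hw : w.length = (hdn.neg B).length) :
    Der (NHA e) (.mem .bool (.const .tt) b :: .mem .bool (.const .ff) b ::
        (typs ((hdn.neg A).map Ty.star) y ++ typs ((hdn.neg B).map Ty.star) w))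
      (.iff (hdn.inter (.or A B) (b :: (x ++ v)) (y ++ w))
        (.or (memInter A x y) (memInter B v w))) := by
  refine .iff_intro fun Δ hΔ => ?_
  obtain ⟨hy', hw'⟩ := Typs.of_hyp_append (e := e) (A := A) (B := B) hy hw
    fun C hC => hΔ (List.mem_cons_of_mem _ (List.mem_cons_of_mem _ hC))
  rw [memInter_eq_JB, memInter_eq_JB]
  exact ⟨or_of_J_or hx hv hy' hw', J_or_of_or hx hv hy hw (.hyp (hΔ (by simp)))
    (.hyp (hΔ (by simp)))⟩

end

end HDN

theorem mainTheorem7 (wext : Bool) :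
    -- implication
    (∀ (A B : Fm) (f g x w : List Tm),
      f.length = (hdn.pos B).length → g.length = (hdn.neg A).length →
      x.length = (hdn.pos A).length → w.length = (hdn.neg B).length →
      Der (NHA wext) []
        (.iff (hdn.inter (.imp A B) (f ++ g) (x ++ w))
          (.imp
            (memInter A x
              (apTs (hdn.pos A ++ hdn.neg B) ((hdn.neg A).map Ty.star) g (x ++ w)))
            (hdn.inter B (apTs (hdn.pos A) (hdn.pos B) f x) w)))) ∧
    -- conjunction
    (∀ (A B : Fm) (x v y w : List Tm),
      x.length = (hdn.pos A).length → v.length = (hdn.pos B).length →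
      y.length = (hdn.neg A).length → w.length = (hdn.neg B).length →
      Der (NHA wext) []
        (.iff (hdn.inter (.and A B) (x ++ v) (y ++ w))
          (.and (hdn.inter A x y) (hdn.inter B v w)))) ∧
    -- disjunction
    (∀ (A B : Fm) (b : Tm) (x v y w : List Tm),
      x.length = (hdn.pos A).length → v.length = (hdn.pos B).length →
      y.length = (hdn.neg A).length → w.length = (hdn.neg B).length →
      Der (NHA wext)
        (typs ((hdn.neg A).map Ty.star) y ++ typs ((hdn.neg B).map Ty.star) w)
        (.imp (hdn.inter (.or A B) (b :: (x ++ v)) (y ++ w))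
          (.or (memInter A x y) (memInter B v w))) ∧
      Der (NHA wext)
        (.mem .bool (.const .tt) b :: .mem .bool (.const .ff) b ::
          (typs ((hdn.neg A).map Ty.star) y ++ typs ((hdn.neg B).map Ty.star) w))
        (.iff (hdn.inter (.or A B) (b :: (x ++ v)) (y ++ w))
          (.or (memInter A x y) (memInter B v w)))) ∧
    -- existential quantifier
    (∀ (τ : Ty) (A : Fm) (c : Tm) (x y : List Tm),
      x.length = (hdn.pos A).length → y.length = (hdn.neg A).length →
      Der (NHA wext) []
        (.imp
          (.exT τ (.and (.mem τ (.var 0) (c.wk 1))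
            (memInter A (x.map (Tm.wk 1)) (y.map (Tm.wk 1)))))
          (hdn.inter (.exT τ A) (c :: x) y)) ∧
      Der (NHA wext) (List.zipWith Fm.inh (hdn.neg A) y)
        (.iff (hdn.inter (.exT τ A) (c :: x) y)
          (.exT τ (.and (.mem τ (.var 0) (c.wk 1))
            (memInter A (x.map (Tm.wk 1)) (y.map (Tm.wk 1)))))) ∧
      Der (NHA wext) (.inh τ c :: typs ((hdn.neg A).map Ty.star) y)
        (.iff (hdn.inter (.exT τ A) (c :: x) y)
          (.exT τ (.and (.mem τ (.var 0) (c.wk 1))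
            (memInter A (x.map (Tm.wk 1)) (y.map (Tm.wk 1))))))) ∧
    -- universal quantifier
    (∀ (τ : Ty) (A : Fm) (f : List Tm) (b : Tm) (y : List Tm),
      f.length = (hdn.pos A).length → y.length = (hdn.neg A).length →
      Der (NHA wext) []
        (.iff (hdn.inter (.allT τ A) f (b :: y))
          (.allT τ (.imp (.mem τ (.var 0) (b.wk 1))
            (hdn.inter A ((apTs [.star τ] (hdn.pos A) f [b]).map (Tm.wk 1))
              (y.map (Tm.wk 1))))))) ∧
    -- soundness
    hdn.Sound (WEHA wext) (NHA wext) := by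
  exact ⟨fun A B f g x w hf _ hx _ => inter_imp_iff hf hx,
    fun A B x v y w hx _ hy _ => inter_and_iff hx hy,
    fun A B b x v y w hx hv hy hw => ⟨inter_or_imp hx hv hy hw, inter_or_iff hx hv hy hw⟩,
    fun τ A c x y hx hy =>
      ⟨inter_exT_of_mem hx hy, inter_exT_iff_of_inh hx hy, inter_exT_iff_of_typs hx hy⟩,
    fun τ A f b y hf hy => inter_allT_iff hf hy, hdn_sound wext⟩
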